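/- Let $\mathcal A$ be a unital complex $\ast$-algebra with two states (positive unital linear functionals) $\varphi,\psi$. For $a\in\mathcal A$ the free cumulants $R^\psi_n(a)$ and the two-state free cumulants $R^{\varphi,\psi}_n(a)$ are defined by $$\psi[a^n]=\sum_{\pi\in NC(n)}\prod_{V\in\pi}R^\psi_{|V|}(a),\qquad \varphi[a^n]=\sum_{\pi\in NC(n)}\ \prod_{V\ \mathrm{outer}}R^{\varphi,\psi}_{|V|}(a)\prod_{V\ \mathrm{inner}}R^{\psi}_{|V|}(a)\qquad(n\ge1),$$ where a block of a non-crossing partition is inner if it lies strictly between two elements of another block, and outer otherwise. Subalgebras $(\mathcal A_i)$ are two-state freely independent if $\psi[a_1\cdots a_n]=0$ and $\varphi[a_1\cdots a_n]=\varphi[a_1]\cdots\varphi[a_n]$ whenever $n\ge1$, $a_j\in\mathcal A_{i(j)}$, $i(j)\ne i(j+1)$ and $\psi[a_j]=0$ for all $j$. Let $\alpha\in\mathbb R$, $T>0$, and let $\{X(t):0\le t\le T\}\subset\mathcal A$ be a two-state free Brownian motion with parameter $\alpha$: the $X(t)$ are self-adjoint, $X(0)=0$, the increments over disjoint intervals are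 two-state freely independent and are stationary with respect to both $\varphi$ and $\psi$, they satisfy $\varphi[X(t)]=0$, $\varphi[(X(t)-X(s))^2]=t-s$ and $R^{\varphi,\psi}_n(X(t)-X(s))=0$ for $n>2$, and $R^\psi_1(X(t))=\alpha t$, $R^\psi_2(X(t))=t$, $R^\psi_n(X(t))=0$ for $n>2$. Then each $X(t)$ has distributions $\mu_t$ with respect to $\varphi$ and $\nu_t$ with respect to $\psi$, that is, probability measures on $\mathbb R$ with $\int x^n\,d\mu_t=\varphi[X(t)^n]$ and $\int x^n\,d\nu_t=\psi[X(t)^n]$ for all $n\geq 0$. The process has a classical version which is a Markov process: there are transition functions $\mathcal K_{s,t}$, $0\le s<t\le T$ (Markov kernels on $\mathbb R$ satisfying the Chapman--Kolmogorov equations) such that the Markov process $Z$ with these transition functions and $Z_0=0$ satisfies $$\mathbb E[Z_{t_1}^{k_1}\cdots Z_{t_n}^{k_n}]=\varphi[X(t_1)^{k_1}\cdots X(t_n)^{k_n}]\qquad\text{for all }0<t_1<\dots<t_n\le T,\ k_i\ge0,$$ with all these moments finite. Moreover, for every such family of transition functions and every $0\le t<T$, on the polynomial functions, which form a dense domain in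 $L^2(\mathbb R,\mu_t)$, the generator of the process at time $t$ is $$A_t=\alpha(\partial_x-L_{\mu_t})+\partial_xL_{\nu_t},\qquad L_\nu[f](x)=\int_{\mathbb R}\frac{f(x)-f(y)}{x-y}\,d\nu(y),$$ where the difference quotient is read as $f'(x)$ for $y=x$. That is, for every polynomial $f$, $$\lim_{h\downarrow0}\frac{\mathcal K_{t,t+h}(f)-f}{h}=A_tf\quad\text{in }L^2(\mathbb R,\mu_t),\qquad \mathcal K_{t,t+h}(f)(x)=\int f(y)\,\mathcal K_{t,t+h}(x,dy).$$ -/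

import Mathlib

open MeasureTheory ProbabilityTheory Filter Topology

noncomputable section

namespace TwoStateFree

/-! ### Non-crossing partitions and cumulants -/

/-- A partition of `{0, …, n-1}` is non-crossing. -/
def NonCrossing {n : ℕ} (π : Finpartition (Finset.univ : Finset (Fin n))) : Prop :=
  ∀ U ∈ π.parts, ∀ V ∈ π.parts, ∀ x₁ y₁ x₂ y₂ : Fin n,
    x₁ < y₁ → y₁ < x₂ → x₂ < y₂ → x₁ ∈ U → x₂ ∈ U → y₁ ∈ V → y₂ ∈ V → U = V

/-- A block `V` of `π` is inner if it lies strictly between two elements of another block;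
a block which is not inner is outer. -/
def IsInner {n : ℕ} (π : Finpartition (Finset.univ : Finset (Fin n))) (V : Finset (Fin n)) : Prop :=
  ∃ W ∈ π.parts, W ≠ V ∧ ∃ y₁ ∈ W, ∃ y₂ ∈ W, ∀ x ∈ V, y₁ < x ∧ x < y₂

/-- The non-crossing partitions of `{0, …, n-1}`, except for the one-block partition. -/
def ProperNC (n : ℕ) : Type :=
  {π : Finpartition (Finset.univ : Finset (Fin n)) //
    NonCrossing π ∧ ∀ V ∈ π.parts, V.card < n}

instance (n : ℕ) : Fintype (ProperNC n) := by
  classical exact Subtype.fintype _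

open Classical in
/-- The free cumulants `R n` of a moment sequence `m`: for `1 ≤ n`,
`m n = ∑ π ∈ NC(n), ∏ V ∈ π, R |V|`, solved for the term of the one-block partition. -/
def freeCumulant (m : ℕ → ℂ) (n : ℕ) : ℂ :=
  m n - ∑ π : ProperNC n, ∏ V : {V // V ∈ π.1.parts}, freeCumulant m V.1.card
termination_by n
decreasing_by exact π.2.2 V.1 V.2

open Classical in
/-- The two-state free cumulants `R n` of a pair of moment sequences (`m` for `φ`, `m'` for `ψ`):
for `1 ≤ n`,
`m n = ∑ π ∈ NC(n), (∏ V ∈ π outer, R |V|) * (∏ V ∈ π inner, freeCumulant m' |V|)`,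
solved for the term of the one-block partition. -/
def twoStateCumulant (m m' : ℕ → ℂ) (n : ℕ) : ℂ :=
  m n - ∑ π : ProperNC n, ∏ V : {V // V ∈ π.1.parts},
    if IsInner π.1 V.1 then freeCumulant m' V.1.card else twoStateCumulant m m' V.1.card
termination_by n
decreasing_by exact π.2.2 V.1 V.2

/-! ### Two-state non-commutative probability spaces -/

section Algebra

variable {A : Type*} [Ring A] [StarRing A] [Algebra ℂ A]

/-- A state on a unital star-algebra: a positive unital linear functional. -/
structure IsState (φ : A →ₗ[ℂ] ℂ) : Prop where
  map_one : φ 1 = 1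
  nonneg : ∀ a : A, 0 ≤ (φ (star a * a)).re ∧ (φ (star a * a)).im = 0

/-- The free cumulants `R^ψ_n(a)` of an element. -/
def elemFreeCumulant (ψ : A →ₗ[ℂ] ℂ) (a : A) (n : ℕ) : ℂ :=
  freeCumulant (fun k => ψ (a ^ k)) n

/-- The two-state free cumulants `R^{φ,ψ}_n(a)` of an element. -/
def elemTwoStateCumulant (φ ψ : A →ₗ[ℂ] ℂ) (a : A) (n : ℕ) : ℂ :=
  twoStateCumulant (fun k => φ (a ^ k)) (fun k => ψ (a ^ k)) n

/-- Two-state free independence of a family of unital subalgebras: an alternating product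
`a₀ a₁ ⋯ aₙ` of `ψ`-centered elements is `ψ`-centered, and `φ` is multiplicative on it. -/
def TwoStateFreelyIndependent (φ ψ : A →ₗ[ℂ] ℂ) {ι : Type*} (S : ι → Subalgebra ℂ A) : Prop :=
  ∀ (n : ℕ) (i : Fin (n + 1) → ι) (a : Fin (n + 1) → A),
    (∀ j : Fin n, i j.castSucc ≠ i j.succ) → (∀ j, a j ∈ S (i j)) → (∀ j, ψ (a j) = 0) →
      ψ (List.ofFn a).prod = 0 ∧ φ (List.ofFn a).prod = ∏ j, φ (a j)

/-- `X(t)`, `0 ≤ t ≤ T`, is a process of self-adjoint elements with two-state freely independent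
stationary increments, started at `0` and `φ`-centered. -/
structure HasTwoStateFreeIncrements (φ ψ : A →ₗ[ℂ] ℂ) (T : ℝ) (X : ℝ → A) : Prop where
  selfAdjoint : ∀ t ∈ Set.Icc 0 T, IsSelfAdjoint (X t)
  zero : X 0 = 0
  centered : ∀ t ∈ Set.Icc 0 T, φ (X t) = 0
  free : ∀ (k : ℕ) (s t : Fin k → ℝ), (∀ i, 0 ≤ s i ∧ s i < t i ∧ t i ≤ T) →
    (∀ i j, i ≠ j → Disjoint (Set.Ico (s i) (t i)) (Set.Ico (s j) (t j))) →
    TwoStateFreelyIndependent φ ψ fun i => Algebra.adjoin ℂ {X (t i) - X (s i)}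
  stationary : ∀ s t : ℝ, 0 ≤ s → s ≤ t → t ≤ T → ∀ n : ℕ,
    φ ((X t - X s) ^ n) = φ (X (t - s) ^ n) ∧ ψ ((X t - X s) ^ n) = ψ (X (t - s) ^ n)

/-- An algebraic two-state free Brownian motion: the increments have two-state normal
distributions with `φ`-variance equal to the length of the time interval. -/
structure IsAlgebraicTwoStateFBM (φ ψ : A →ₗ[ℂ] ℂ) (T : ℝ) (X : ℝ → A) : Prop
    extends HasTwoStateFreeIncrements φ ψ T X where
  normal : ∀ s t : ℝ, 0 ≤ s → s ≤ t → t ≤ T → ∀ n : ℕ, 2 < n →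
    elemTwoStateCumulant φ ψ (X t - X s) n = 0
  variance : ∀ s t : ℝ, 0 ≤ s → s ≤ t → t ≤ T → φ ((X t - X s) ^ 2) = ((t - s : ℝ) : ℂ)

/-- A two-state free Brownian motion with parameter `α`: the free cumulant generating function of
`X(t)` with respect to `ψ` is `α t z + t z ^ 2`. -/
structure IsTwoStateFBM (φ ψ : A →ₗ[ℂ] ℂ) (α T : ℝ) (X : ℝ → A) : Prop
    extends IsAlgebraicTwoStateFBM φ ψ T X where
  psi_one : ∀ t ∈ Set.Icc 0 T, elemFreeCumulant ψ (X t) 1 = ((α * t : ℝ) : ℂ)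
  psi_two : ∀ t ∈ Set.Icc 0 T, elemFreeCumulant ψ (X t) 2 = (t : ℂ)
  psi_higher : ∀ t ∈ Set.Icc 0 T, ∀ n : ℕ, 2 < n → elemFreeCumulant ψ (X t) n = 0

/-- The probability measure `μ` is the distribution of `a` with respect to the functional `χ`. -/
structure IsDistribution (χ : A →ₗ[ℂ] ℂ) (a : A) (μ : Measure ℝ) : Prop where
  prob : IsProbabilityMeasure μ
  integrable : ∀ n : ℕ, Integrable (fun x : ℝ => x ^ n) μ
  moment : ∀ n : ℕ, ((∫ x, x ^ n ∂μ : ℝ) : ℂ) = χ (a ^ n)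

end Algebra

/-! ### The classical version -/

/-- The joint law of the positions at the times `τ 0 < τ 1 < ⋯`, given the position at the earlier
time `s`, of a Markov process with transition functions `K`. -/
def pathKernel (K : ℝ → ℝ → Kernel ℝ ℝ) : (n : ℕ) → ℝ → (Fin n → ℝ) → Kernel ℝ (Fin n → ℝ)
  | 0, _, _ => Kernel.const ℝ (Measure.dirac Fin.elim0)
  | n + 1, s, τ =>
    (K s (τ 0) ⊗ₖ Kernel.prodMkLeft ℝ (pathKernel K n (τ 0) (Fin.tail τ))).map
      fun p => (Fin.cons p.1 p.2 : Fin (n + 1) → ℝ)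

/-- `K` is the family of transition functions of a classical version of the process `X(t)`,
`0 ≤ t ≤ T`, which is a Markov process: the Markov process started at `0` at time `0` with
transition functions `K s t`, `0 ≤ s < t ≤ T`, has the time-ordered joint moments
`φ[X(t₁)^{k₁} ⋯ X(tₙ)^{kₙ}]`, `t₁ < ⋯ < tₙ`. -/
structure IsClassicalMarkovVersion {A : Type*} [Ring A] [Algebra ℂ A] (φ : A →ₗ[ℂ] ℂ)
    (T : ℝ) (X : ℝ → A) (K : ℝ → ℝ → Kernel ℝ ℝ) : Prop where
  markov : ∀ s t, IsMarkovKernel (K s t)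
  chapman_kolmogorov : ∀ r s t : ℝ, 0 ≤ r → r < s → s < t → t ≤ T → K s t ∘ₖ K r s = K r t
  integrable : ∀ (n : ℕ) (τ : Fin n → ℝ) (k : Fin n → ℕ), StrictMono τ →
    (∀ i, τ i ∈ Set.Ioc 0 T) → Integrable (fun x => ∏ i, x i ^ k i) (pathKernel K n 0 τ 0)
  moment : ∀ (n : ℕ) (τ : Fin n → ℝ) (k : Fin n → ℕ), StrictMono τ →
    (∀ i, τ i ∈ Set.Ioc 0 T) →
    ((∫ x, ∏ i, x i ^ k i ∂(pathKernel K n 0 τ 0) : ℝ) : ℂ) =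
      φ (List.ofFn fun i => X (τ i) ^ k i).prod

/-! ### The generator -/

/-- `L_ν[f](x) = ∫ (f(x) - f(y)) / (x - y) dν(y)`, where the difference quotient is `f'(x)` on the
diagonal. -/
def diffQuot (ν : Measure ℝ) (f : ℝ → ℝ) (x : ℝ) : ℝ := ∫ y, dslope f x y ∂ν

/-- The operator `α (∂_x - L_μ) + ∂_x L_ν`. -/
def genOp (α : ℝ) (μ ν : Measure ℝ) (f : ℝ → ℝ) (x : ℝ) : ℝ :=
  α * (deriv f x - diffQuot μ f x) + deriv (diffQuot ν f) x

/-- The polynomial functions on the real line. -/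
def polynomialFunctions : Set (ℝ → ℝ) := Set.range fun (p : Polynomial ℝ) (x : ℝ) => p.eval x

/-- `G` is, on the dense domain `D` of `L²(μ)`, the generator at time `t` of the process with
transition functions `K`: the right derivative at `h = 0`, in `L²(μ)`, of
`x ↦ ∫ f(y) K_{t,t+h}(x, dy)` is `G f`, for `f ∈ D`. -/
structure IsGeneratorAt (K : ℝ → ℝ → Kernel ℝ ℝ) (t : ℝ) (μ : Measure ℝ) (D : Set (ℝ → ℝ))
    (G : (ℝ → ℝ) → ℝ → ℝ) : Prop where
  memLp : ∀ f ∈ D, MemLp f 2 μ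
  dense : ∀ g : ℝ → ℝ, MemLp g 2 μ → ∀ ε : ENNReal, 0 < ε → ∃ f ∈ D, eLpNorm (g - f) 2 μ < ε
  memLp_image : ∀ f ∈ D, MemLp (G f) 2 μ
  integrable : ∀ f ∈ D, ∀ᶠ h in 𝓝[>] (0 : ℝ),
    (∀ᵐ x ∂μ, Integrable f (K t (t + h) x)) ∧ MemLp (fun x => ∫ y, f y ∂(K t (t + h) x)) 2 μ
  tendsto : ∀ f ∈ D, Tendsto
    (fun h : ℝ => eLpNorm (fun x => h⁻¹ * ((∫ y, f y ∂(K t (t + h) x)) - f x) - G f x) 2 μ)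
    (𝓝[>] 0) (𝓝 0)

end TwoStateFree

end

/-!
The cumulants of an increment over a time interval of length `h` are linear in `h`, so its moments
are its cumulants up to `o(h)`. The generating function `∑ Uₙ zⁿ` of the orthogonal polynomials of
the semicircle law with mean `a` and variance `b`, evaluated at `x`, has the inverse
`1 - (x - a) z + b z²`, which up to the constant `1` is additive in `(a, b, x)`. So for free `x` and
`y` the generating function at `x + y` is the one at `x` times a series of alternating words, on
which freeness computes `ψ` and `φ`. Take `x = X(t)`, `a = α t` and `b = t`. Then `ψ(Uₙ)` is
additive in `t` and of order `o(t)`, hence zero for `n ≥ 1`, and the inverse of `φ(∑ Uₙ zⁿ)`, minus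
`1`, is additive in `t` and equal to `α t z + o(t)`, hence to `α t z`. Consequently the coefficients
`Qₙ = Uₙ + α t Uₙ₋₁` of `(1 + α t z) ∑ Uₙ zⁿ` are martingale polynomials of the process.

A classical Markov version thus has to map `Qₙ` at time `t` to `Qₙ` at time `s`. A measure
`K_{s,t}(x, ·)` with this property is obtained as the spectral measure of a bounded Jacobi operator.
In an arbitrary Markov version the moments determine the action of the kernels on polynomials almost
everywhere, since a function orthogonal to all polynomials vanishes when the support is bounded. The
generator sends `Qₙ` to minus its derivative in time, which is computed from the recurrence; on the
other side, the difference quotients `L_μ` and `L_ν` turn `Qₙ` and `Uₙ` into `Uₙ₋₁`.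
-/

namespace TwoStateFree

/-! ### Small-time asymptotics of moments -/

section CumulantAsymptotics

variable {β : Type*} {l : Filter β} {g : β → ℝ}

lemma isLittleO_prod_of_one_lt_card {ι 𝕜 : Type*} [NormedField 𝕜] (hg : Tendsto g l (𝓝 0))
    {s : Finset ι} {f : ι → β → 𝕜} (hf : ∀ i ∈ s, f i =O[l] g) (hs : 1 < s.card) :
    (fun x => ∏ i ∈ s, f i x) =o[l] g := by
  classical
  obtain ⟨a, ha, b, hb, hab⟩ := Finset.one_lt_card.1 hs
  have hrest : Tendsto (fun x => ∏ i ∈ s.erase a, f i x) l (𝓝 0) := by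
    rw [← Finset.prod_eq_zero (f := fun _ : ι => (0 : 𝕜)) (Finset.mem_erase.2 ⟨hab.symm, hb⟩) rfl]
    exact tendsto_finsetProd _ fun i hi =>
      (hf i (Finset.mem_of_mem_erase hi)).trans_tendsto hg
  have hmul := (hf a ha).mul_isLittleO ((Asymptotics.isLittleO_one_iff ℝ).2 hrest)
  simp only [mul_one] at hmul
  exact hmul.congr_left fun x => Finset.mul_prod_erase s (f · x) ha

lemma ProperNC.one_lt_card_parts {n : ℕ} (hn : 1 ≤ n) (π : ProperNC n) :
    1 < π.1.parts.card := by
  have : NeZero n := ⟨by omega⟩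
  by_contra! hcard
  obtain ⟨V, hV, -⟩ := π.1.exists_mem (Finset.mem_univ (0 : Fin n))
  have hV_univ : V = Finset.univ := Finset.eq_univ_iff_forall.2 fun x => by
    obtain ⟨W, hW, hx⟩ := π.1.exists_mem (Finset.mem_univ x)
    rwa [Finset.card_le_one.1 hcard V hV W hW]
  simpa [hV_univ] using π.2.2 V hV

lemma ProperNC.one_le_card_part {n : ℕ} (π : ProperNC n) (V : {V // V ∈ π.1.parts}) :
    1 ≤ V.1.card :=
  Finset.card_pos.2 (π.1.nonempty_of_mem_parts V.2)

lemma ProperNC.sum_prod_isLittleO (hg : Tendsto g l (𝓝 0)) {n : ℕ} (hn : 1 ≤ n)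
    {f : (π : ProperNC n) → {V // V ∈ π.1.parts} → β → ℂ} (hf : ∀ π V, f π V =O[l] g) :
    (fun x => ∑ π : ProperNC n, ∏ V : {V // V ∈ π.1.parts}, f π V x) =o[l] g :=
  Asymptotics.IsLittleO.fun_sum fun π _ =>
    isLittleO_prod_of_one_lt_card hg (fun V _ => hf π V)
      (by simpa using π.one_lt_card_parts hn)

lemma moment_sub_freeCumulant_isLittleO (hg : Tendsto g l (𝓝 0)) {m : β → ℕ → ℂ} {n : ℕ}
    (hn : 1 ≤ n) (hm : ∀ k, 1 ≤ k → k < n → (fun x => freeCumulant (m x) k) =O[l] g) :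
    (fun x => m x n - freeCumulant (m x) n) =o[l] g := by
  refine (ProperNC.sum_prod_isLittleO hg hn (f := fun π V x => freeCumulant (m x) V.1.card)
    fun π V => hm _ (π.one_le_card_part V) (π.2.2 _ V.2)).congr_left fun x => ?_
  rw [freeCumulant, sub_sub_cancel]

open Classical in
lemma moment_sub_twoStateCumulant_isLittleO (hg : Tendsto g l (𝓝 0)) {m m' : β → ℕ → ℂ} {n : ℕ}
    (hn : 1 ≤ n) (hm : ∀ k, 1 ≤ k → k < n → (fun x => twoStateCumulant (m x) (m' x) k) =O[l] g)
    (hm' : ∀ k, 1 ≤ k → k < n → (fun x => freeCumulant (m' x) k) =O[l] g) :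
    (fun x => m x n - twoStateCumulant (m x) (m' x) n) =o[l] g := by
  refine (ProperNC.sum_prod_isLittleO hg hn (f := fun π V x => if IsInner π.1 V.1 then
    freeCumulant (m' x) V.1.card else twoStateCumulant (m x) (m' x) V.1.card)
    fun π V => ?_).congr_left fun x => ?_
  · split_ifs
    exacts [hm' _ (π.one_le_card_part V) (π.2.2 _ V.2), hm _ (π.one_le_card_part V) (π.2.2 _ V.2)]
  · rw [twoStateCumulant, sub_sub_cancel]

end CumulantAsymptotics

section SmallTimeMoments

variable {A : Type*} [Ring A] [Algebra ℂ A]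

/-- The moments of `X(h)` with respect to `χ` are `χ[X(h)ⁿ] = κ n * h + o(h)` as `h ↓ 0`. -/
def HasSmallTimeMoments (χ : A →ₗ[ℂ] ℂ) (X : ℝ → A) (κ : ℕ → ℝ) : Prop :=
  ∀ n, 1 ≤ n → (fun h : ℝ => χ (X h ^ n) - ((κ n * h : ℝ) : ℂ)) =o[𝓝[>] 0] (id : ℝ → ℝ)

/-- The cumulants of the normal distribution with mean `c` and variance `1`; the value at `0` is
never used. -/
def normalCumulant (c : ℝ) : ℕ → ℝ
  | 1 => c
  | 2 => 1
  | _ => 0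

lemma normalCumulant_of_two_lt (c : ℝ) {n : ℕ} (hn : 2 < n) : normalCumulant c n = 0 := by
  unfold normalCumulant
  split <;> first | omega | rfl

lemma ofReal_mul_isBigO (c : ℝ) {l : Filter ℝ} :
    (fun h : ℝ => ((c * h : ℝ) : ℂ)) =O[l] (id : ℝ → ℝ) :=
  Asymptotics.IsBigO.of_bound |c| (Eventually.of_forall fun h => by simp)

lemma tendsto_id_nhdsGT_zero : Tendsto (id : ℝ → ℝ) (𝓝[>] 0) (𝓝 0) :=
  tendsto_nhdsWithin_of_tendsto_nhds tendsto_id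

lemma isBigO_of_sub_ofReal_mul_isLittleO {f : ℝ → ℂ} {c : ℝ} {l : Filter ℝ}
    (hf : (fun h => f h - ((c * h : ℝ) : ℂ)) =o[l] (id : ℝ → ℝ)) : f =O[l] (id : ℝ → ℝ) := by
  simpa only [sub_add_cancel] using hf.isBigO.add (ofReal_mul_isBigO c)

variable [StarRing A] {φ ψ : A →ₗ[ℂ] ℂ} {α T : ℝ} {X : ℝ → A}

lemma IsTwoStateFBM.freeCumulant_eq (hX : IsTwoStateFBM φ ψ α T X) {t : ℝ}
    (ht : t ∈ Set.Icc 0 T) {n : ℕ} (hn : 1 ≤ n) :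
    freeCumulant (fun k => ψ (X t ^ k)) n = ((normalCumulant α n * t : ℝ) : ℂ) := by
  rcases (show n = 1 ∨ n = 2 ∨ 2 < n by omega) with rfl | rfl | h2
  · exact hX.psi_one t ht
  · simpa [normalCumulant, elemFreeCumulant] using hX.psi_two t ht
  · simpa [normalCumulant_of_two_lt α h2, elemFreeCumulant] using hX.psi_higher t ht n h2

lemma IsTwoStateFBM.freeCumulant_isBigO (hT : 0 < T) (hX : IsTwoStateFBM φ ψ α T X) {n : ℕ}
    (hn : 1 ≤ n) :
    (fun h => freeCumulant (fun k => ψ (X h ^ k)) n) =O[𝓝[>] 0] (id : ℝ → ℝ) := by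
  refine (ofReal_mul_isBigO (normalCumulant α n)).congr' ?_ EventuallyEq.rfl
  filter_upwards [Ioc_mem_nhdsGT hT] with h hh using
    (hX.freeCumulant_eq (Set.Ioc_subset_Icc_self hh) hn).symm

lemma IsTwoStateFBM.hasSmallTimeMoments_psi (hT : 0 < T) (hX : IsTwoStateFBM φ ψ α T X) :
    HasSmallTimeMoments ψ X (normalCumulant α) := fun n hn => by
  refine (moment_sub_freeCumulant_isLittleO tendsto_id_nhdsGT_zero hn
    fun k hk _ => hX.freeCumulant_isBigO hT hk).congr' ?_ EventuallyEq.rfl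
  filter_upwards [Ioc_mem_nhdsGT hT] with h hh
  rw [hX.freeCumulant_eq (Set.Ioc_subset_Icc_self hh) hn]

lemma IsTwoStateFBM.phi_pow_eq (hX : IsTwoStateFBM φ ψ α T X) {t : ℝ} (ht : t ∈ Set.Icc 0 T)
    {n : ℕ} (hn : 1 ≤ n) (hn2 : n ≤ 2) :
    φ (X t ^ n) = ((normalCumulant 0 n * t : ℝ) : ℂ) := by
  obtain rfl | rfl : n = 1 ∨ n = 2 := by omega
  · simpa [normalCumulant] using hX.centered t ht
  · simpa [normalCumulant, hX.zero] using hX.variance 0 t le_rfl ht.1 ht.2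

lemma IsTwoStateFBM.twoStateCumulant_eq_zero (hX : IsTwoStateFBM φ ψ α T X) {t : ℝ}
    (ht : t ∈ Set.Icc 0 T) {n : ℕ} (hn : 2 < n) :
    twoStateCumulant (fun k => φ (X t ^ k)) (fun k => ψ (X t ^ k)) n = 0 := by
  simpa [elemTwoStateCumulant, hX.zero] using hX.normal 0 t le_rfl ht.1 ht.2 n hn

lemma IsTwoStateFBM.twoStateCumulant_isBigO (hT : 0 < T) (hX : IsTwoStateFBM φ ψ α T X) (n : ℕ)
    (hn : 1 ≤ n) :
    (fun h => twoStateCumulant (fun k => φ (X h ^ k)) (fun k => ψ (X h ^ k)) n)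
      =O[𝓝[>] 0] (id : ℝ → ℝ) := by
  induction n using Nat.strong_induction_on with
  | _ n ih =>
    rcases le_or_gt n 2 with h2 | h2
    · have hmoment : (fun h => φ (X h ^ n)) =O[𝓝[>] 0] (id : ℝ → ℝ) := by
        refine (ofReal_mul_isBigO (normalCumulant 0 n)).congr' ?_ EventuallyEq.rfl
        filter_upwards [Ioc_mem_nhdsGT hT] with h hh using
          (hX.phi_pow_eq (Set.Ioc_subset_Icc_self hh) hn h2).symm
      simpa only [sub_sub_cancel] using hmoment.sub
        (moment_sub_twoStateCumulant_isLittleO tendsto_id_nhdsGT_zero hn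
          (fun k hk hkn => ih k hkn hk) fun k hk _ => hX.freeCumulant_isBigO hT hk).isBigO
    · refine (Asymptotics.isBigO_zero (id : ℝ → ℝ) _).congr' ?_ EventuallyEq.rfl
      filter_upwards [Ioc_mem_nhdsGT hT] with h hh using
        (hX.twoStateCumulant_eq_zero (Set.Ioc_subset_Icc_self hh) h2).symm

lemma IsTwoStateFBM.hasSmallTimeMoments_phi (hT : 0 < T) (hX : IsTwoStateFBM φ ψ α T X) :
    HasSmallTimeMoments φ X (normalCumulant 0) := fun n hn => by
  rcases le_or_gt n 2 with h2 | h2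
  · refine (Asymptotics.isLittleO_zero (id : ℝ → ℝ) _).congr' ?_ EventuallyEq.rfl
    filter_upwards [Ioc_mem_nhdsGT hT] with h hh
    rw [hX.phi_pow_eq (Set.Ioc_subset_Icc_self hh) hn h2, sub_self]
  · refine (moment_sub_twoStateCumulant_isLittleO tendsto_id_nhdsGT_zero hn
      (fun k hk _ => hX.twoStateCumulant_isBigO hT k hk)
      fun k hk _ => hX.freeCumulant_isBigO hT hk).congr' ?_ EventuallyEq.rfl
    filter_upwards [Ioc_mem_nhdsGT hT] with h hh
    rw [hX.twoStateCumulant_eq_zero (Set.Ioc_subset_Icc_self hh) h2,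
      normalCumulant_of_two_lt 0 h2, zero_mul, Complex.ofReal_zero]

end SmallTimeMoments

/-! ### Orthogonal polynomials -/

section Polynomials

open Polynomial

variable {k : Type*} [CommRing k]

/-- The monic orthogonal polynomials of the semicircle law with mean `a` and variance `b`, whose
Jacobi parameters are the constants `a` and `b`. -/
noncomputable def semicirclePoly (a b : k) : ℕ → k[X]
  | 0 => 1
  | 1 => X - C a
  | n + 2 => (X - C a) * semicirclePoly a b (n + 1) - C b * semicirclePoly a b n

/-- The monic orthogonal polynomials with Jacobi parameters `0, a, a, …` and `b, b, …`. For
`a = α t` and `b = t`, evaluated at `X(t)`, they are the martingale polynomials of the process. -/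
noncomputable def martingalePoly (a b : k) : ℕ → k[X]
  | 0 => 1
  | 1 => X
  | n + 2 => (X - C a) * martingalePoly a b (n + 1) - C b * martingalePoly a b n

lemma semicirclePoly_add_two (a b : k) (n : ℕ) :
    semicirclePoly a b (n + 2) =
      (X - C a) * semicirclePoly a b (n + 1) - C b * semicirclePoly a b n := by
  rw [semicirclePoly]

lemma martingalePoly_succ (a b : k) (n : ℕ) :
    martingalePoly a b (n + 1) = semicirclePoly a b (n + 1) + C a * semicirclePoly a b n := by
  induction n using Nat.twoStepInduction with
  | zero => simp [martingalePoly, semicirclePoly]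
  | one =>
    simp only [martingalePoly, semicirclePoly]
    ring
  | more n ih0 ih1 =>
    rw [martingalePoly, ih0, ih1, semicirclePoly_add_two a b (n + 1), semicirclePoly_add_two a b n]
    ring

variable [IsDomain k]

lemma monic_and_degree_martingalePoly (a b : k) (n : ℕ) :
    (martingalePoly a b n).Monic ∧ (martingalePoly a b n).degree = n := by
  induction n using Nat.twoStepInduction with
  | zero => simp [martingalePoly]
  | one => simp [martingalePoly, monic_X]
  | more n ih0 ih1 =>
    have hmonic := (monic_X_sub_C a).mul ih1.1
    have hdegree : ((X - C a) * martingalePoly a b (n + 1)).degree =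
        ((n + 2 : ℕ) : WithBot ℕ) := by
      rw [degree_mul, degree_X_sub_C, ih1.2, ← Nat.cast_one, ← Nat.cast_add, add_comm 1]
    have hlt : (C b * martingalePoly a b n).degree
        < ((X - C a) * martingalePoly a b (n + 1)).degree := by
      rw [hdegree, ← smul_eq_C_mul]
      refine (degree_smul_le b _).trans_lt ?_
      rw [ih0.2]
      exact_mod_cast (by omega : n < n + 2)
    rw [martingalePoly]
    exact ⟨hmonic.sub_of_left hlt, (degree_sub_eq_left_of_degree_lt hlt).trans hdegree⟩

/-- The martingale polynomials as a sequence of polynomials of degrees `0, 1, 2, …`. -/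
noncomputable def martingaleSequence (a b : k) : Polynomial.Sequence k where
  elems' := martingalePoly a b
  degree_eq' n := (monic_and_degree_martingalePoly a b n).2

/-- The basis of the space of polynomials consisting of the martingale polynomials. -/
noncomputable def martingaleBasis (a b : k) : Module.Basis ℕ k k[X] :=
  (martingaleSequence a b).basis fun n =>
    (monic_and_degree_martingalePoly a b n).1.leadingCoeff.symm ▸ isUnit_one

lemma martingaleBasis_apply (a b : k) (n : ℕ) : martingaleBasis a b n = martingalePoly a b n :=
  Polynomial.Sequence.basis_eq_self _ _ n

lemma linearMap_ext_martingalePoly {M : Type*} [AddCommGroup M] [Module k M] (a b : k)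
    {f g : k[X] →ₗ[k] M} (h : ∀ n, f (martingalePoly a b n) = g (martingalePoly a b n)) : f = g :=
  (martingaleBasis a b).ext fun n => by rw [martingaleBasis_apply, h]

/-- The action on polynomials of the transition function from time `s` to time `t`: it maps the
martingale polynomials of time `t` to those of time `s`. -/
noncomputable def transitionOp (α s t : k) : k[X] →ₗ[k] k[X] :=
  (martingaleBasis (α * t) t).constr k fun n => martingalePoly (α * s) s n

lemma transitionOp_martingalePoly (α s t : k) (n : ℕ) :
    transitionOp α s t (martingalePoly (α * t) t n) = martingalePoly (α * s) s n := by
  rw [← martingaleBasis_apply, transitionOp, Module.Basis.constr_basis]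

lemma transitionOp_comp (α r s t : k) (p : k[X]) :
    transitionOp α r s (transitionOp α s t p) = transitionOp α r t p :=
  LinearMap.congr_fun (f := transitionOp α r s ∘ₗ transitionOp α s t)
    (linearMap_ext_martingalePoly (α * t) t fun n => by simp [transitionOp_martingalePoly]) p

end Polynomials

/-! ### Generating functions -/

section Series

open PowerSeries in
/-- The inverse `1 - (x - a) z + b z²` of the generating function of the polynomials
`semicirclePoly a b` at `x`. -/
noncomputable def semicircleSeriesInv {k R : Type*} [CommRing k] [Ring R] [Algebra k R]
    (a b : k) (x : R) : PowerSeries R :=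
  1 - X * (C (x - algebraMap k R a) - X * C (algebraMap k R b))

/-- The generating function of the polynomials `semicirclePoly a b` at `x`. -/
noncomputable def semicircleSeries {k R : Type*} [CommRing k] [Ring R] [Algebra k R]
    (a b : k) (x : R) : PowerSeries R :=
  PowerSeries.mk fun n => Polynomial.aeval x (semicirclePoly a b n)

variable {k R : Type*} [CommRing k] [Ring R] [Algebra k R]

lemma coeff_semicircleSeries (a b : k) (x : R) (n : ℕ) :
    (semicircleSeries a b x).coeff n = Polynomial.aeval x (semicirclePoly a b n) :=
  PowerSeries.coeff_mk _ _

lemma semicircleSeriesInv_mul (a b : k) (x : R) :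
    semicircleSeriesInv a b x * semicircleSeries a b x = 1 := by
  have hexpand : semicircleSeriesInv a b x * semicircleSeries a b x = semicircleSeries a b x
      - PowerSeries.X * (PowerSeries.C (x - algebraMap k R a) * semicircleSeries a b x
        - PowerSeries.X * (PowerSeries.C (algebraMap k R b) * semicircleSeries a b x)) := by
    rw [semicircleSeriesInv]
    noncomm_ring
  ext n
  rw [hexpand]
  match n with
  | 0 => simp [semicircleSeries, semicirclePoly]
  | 1 => simp [semicircleSeries, semicirclePoly, PowerSeries.coeff_one,
      PowerSeries.coeff_succ_X_mul]
  | n + 2 =>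
    rw [map_sub, PowerSeries.coeff_succ_X_mul, map_sub, PowerSeries.coeff_C_mul,
      PowerSeries.coeff_succ_X_mul, PowerSeries.coeff_C_mul]
    simp [coeff_semicircleSeries, semicirclePoly_add_two, PowerSeries.coeff_one]

/- Over the commutative ring `k[X]` the left inverse is a right inverse; the identity is then
evaluated at `x`. -/
lemma semicircleSeries_mul_inv (a b : k) (x : R) :
    semicircleSeries a b x * semicircleSeriesInv a b x = 1 := by
  have hgeneric := congrArg (PowerSeries.map (Polynomial.aeval x : Polynomial k →ₐ[k] R).toRingHom)
    ((mul_comm _ _).trans (semicircleSeriesInv_mul a b (Polynomial.X : Polynomial k)))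
  have hseries : PowerSeries.map (Polynomial.aeval x : Polynomial k →ₐ[k] R).toRingHom
      (semicircleSeries a b Polynomial.X) = semicircleSeries a b x := by
    ext n
    simp [coeff_semicircleSeries]
  have hinv : PowerSeries.map (Polynomial.aeval x : Polynomial k →ₐ[k] R).toRingHom
      (semicircleSeriesInv a b Polynomial.X) = semicircleSeriesInv a b x := by
    simp [semicircleSeriesInv]
  rwa [map_mul, hseries, hinv, map_one] at hgeneric

lemma semicircleSeriesInv_add (a b a' b' : k) (x y : R) :
    semicircleSeriesInv (a + a') (b + b') (x + y) =
      semicircleSeriesInv a b x + semicircleSeriesInv a' b' y - 1 := by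
  simp only [semicircleSeriesInv, map_add, map_sub]
  noncomm_ring

/-- The right factor, minus `1`, of the generating function at `x + y` relative to the one at `x`.
Its coefficients turn out to be combinations of words starting with `y`. -/
noncomputable def tailSeries (a b a' b' : k) (x y : R) : PowerSeries R :=
  semicircleSeriesInv a b x * semicircleSeries (a + a') (b + b') (x + y) - 1

lemma semicircleSeries_add (a b a' b' : k) (x y : R) :
    semicircleSeries (a + a') (b + b') (x + y) =
      semicircleSeries a b x * (1 + tailSeries a b a' b' x y) := by
  rw [tailSeries, add_sub_cancel, ← mul_assoc, semicircleSeries_mul_inv, one_mul]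

/-- The part, starting with `x` or constant, of the right factor of the generating function at
`x + y` relative to the one at `y`. -/
noncomputable def otherTailSeries (a b a' b' : k) (x y : R) : PowerSeries R :=
  1 + (semicircleSeries a b x - 1) * (1 + tailSeries a b a' b' x y)

lemma tailSeries_eq (a b a' b' : k) (x y : R) :
    tailSeries a b a' b' x y =
      (semicircleSeries a' b' y - 1) * otherTailSeries a b a' b' x y := by
  set S := semicircleSeries (a + a') (b + b') (x + y) with hS
  have hadd : semicircleSeriesInv a b x * S = 1 + S - semicircleSeriesInv a' b' y * S := by
    have h := semicircleSeriesInv_mul (a + a') (b + b') (x + y)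
    rw [semicircleSeriesInv_add, sub_mul, add_mul, one_mul] at h
    rw [← h]
    abel
  have htail : otherTailSeries a b a' b' x y = semicircleSeriesInv a' b' y * S := by
    rw [otherTailSeries, sub_mul, ← semicircleSeries_add, one_mul, tailSeries, ← hS, hadd]
    abel
  rw [htail, sub_mul, ← mul_assoc, semicircleSeries_mul_inv, one_mul, one_mul, tailSeries, ← hS,
    hadd]
  abel

end Series

/-! ### Small-time asymptotics of the orthogonal polynomials -/

section SmallTimePolynomials

variable {A : Type*} [Ring A] [Algebra ℂ A] {χ : A →ₗ[ℂ] ℂ} {α : ℝ} {κ : ℕ → ℝ} {X : ℝ → A}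

lemma map_algebraMap_real_mul (χ : A →ₗ[ℂ] ℂ) (r : ℝ) (a : A) :
    χ (algebraMap ℝ A r * a) = r * χ a := by
  rw [IsScalarTower.algebraMap_apply ℝ ℂ A, ← Algebra.smul_def, map_smul]
  simp

lemma map_pow_mul_semicirclePoly_add_two (χ : A →ₗ[ℂ] ℂ) (a b : ℝ) (x : A) (k n : ℕ) :
    χ (x ^ k * Polynomial.aeval x (semicirclePoly a b (n + 2))) =
      χ (x ^ (k + 1) * Polynomial.aeval x (semicirclePoly a b (n + 1)))
        - a * χ (x ^ k * Polynomial.aeval x (semicirclePoly a b (n + 1)))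
        - b * χ (x ^ k * Polynomial.aeval x (semicirclePoly a b n)) := by
  rw [← map_algebraMap_real_mul, ← map_algebraMap_real_mul, ← map_sub, ← map_sub,
    semicirclePoly_add_two]
  simp only [map_sub, map_mul, Polynomial.aeval_X, Polynomial.aeval_C, mul_sub, sub_mul, mul_assoc,
    pow_succ, Algebra.left_comm]

lemma isLittleO_mul_of_tendsto_zero {f g : ℝ → ℂ} {l : Filter ℝ}
    (hf : f =O[l] (id : ℝ → ℝ)) (hg : Tendsto g l (𝓝 0)) :
    (fun h => f h * g h) =o[l] (id : ℝ → ℝ) := by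
  simpa [Function.id_def] using hf.mul_isLittleO ((Asymptotics.isLittleO_one_iff ℝ).2 hg)

lemma HasSmallTimeMoments.isBigO (hχ : HasSmallTimeMoments χ X κ) {n : ℕ} (hn : 1 ≤ n) :
    (fun h => χ (X h ^ n)) =O[𝓝[>] 0] (id : ℝ → ℝ) :=
  isBigO_of_sub_ofReal_mul_isLittleO (hχ n hn)

lemma HasSmallTimeMoments.pow_mul_semicirclePoly (hχ : HasSmallTimeMoments χ X κ) (n : ℕ) {k : ℕ}
    (hk : 1 ≤ k) :
    (fun h => χ (X h ^ k * Polynomial.aeval (X h) (semicirclePoly (α * h) h n)) - χ (X h ^ (k + n)))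
      =o[𝓝[>] 0] (id : ℝ → ℝ) := by
  induction n using Nat.strong_induction_on generalizing k with
  | _ n ih =>
    have htendsto : ∀ m < n, Tendsto
        (fun h => χ (X h ^ k * Polynomial.aeval (X h) (semicirclePoly (α * h) h m)))
        (𝓝[>] 0) (𝓝 0) := fun m hm => by
      have hbigO := (ih m hm hk).isBigO.add (hχ.isBigO (n := k + m) (by omega))
      simp only [sub_add_cancel] at hbigO
      exact hbigO.trans_tendsto tendsto_id_nhdsGT_zero
    have hmean := fun m (hm : m < n) =>
      isLittleO_mul_of_tendsto_zero (ofReal_mul_isBigO α) (htendsto m hm)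
    match n with
    | 0 => simp [semicirclePoly]
    | 1 =>
      refine (hmean 0 one_pos).neg_left.congr_left fun h => ?_
      rw [← map_algebraMap_real_mul, ← map_neg, ← map_sub, Algebra.commutes]
      simp [semicirclePoly, mul_sub, pow_succ]
    | n + 2 =>
      have hvariance :=
        isLittleO_mul_of_tendsto_zero (ofReal_mul_isBigO 1) (htendsto n (by omega))
      refine (((ih (n + 1) (by omega) k.succ_pos).sub (hmean (n + 1) (by omega))).sub
        hvariance).congr_left fun h => ?_
      rw [map_pow_mul_semicirclePoly_add_two, one_mul, Nat.succ_add_eq_add_succ]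
      ring

/- To first order in `h`, `semicirclePoly (α h) h n` is `xⁿ` corrected by `- α h` for `n = 1` and
by `- h` for `n = 2`, apart from terms of order `h` which are multiples of `x`. -/
lemma HasSmallTimeMoments.semicirclePoly (hχ : HasSmallTimeMoments χ X κ) (hχ_one : χ 1 = 1)
    {n : ℕ} (hn : 1 ≤ n) :
    (fun h => χ (Polynomial.aeval (X h) (semicirclePoly (α * h) h n))
        - (((κ n - normalCumulant α n) * h : ℝ) : ℂ)) =o[𝓝[>] 0] (id : ℝ → ℝ) := by
  induction n using Nat.strong_induction_on with
  | _ n ih =>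
    have htendsto : ∀ m < n, 1 ≤ m → Tendsto
        (fun h => χ (Polynomial.aeval (X h) (TwoStateFree.semicirclePoly (α * h) h m)))
        (𝓝[>] 0) (𝓝 0) := fun m hmn hm =>
      (isBigO_of_sub_ofReal_mul_isLittleO (ih m hmn hm)).trans_tendsto tendsto_id_nhdsGT_zero
    match n with
    | 1 =>
      refine (hχ 1 le_rfl).congr_left fun h => ?_
      have hconst : χ (algebraMap ℝ A (α * h)) = ((α * h : ℝ) : ℂ) := by
        simpa [hχ_one] using map_algebraMap_real_mul χ (α * h) 1
      simp only [TwoStateFree.semicirclePoly, normalCumulant, pow_one, map_sub, Polynomial.aeval_X,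
        Polynomial.aeval_C, hconst]
      push_cast
      ring
    | n + 2 =>
      have hmoment := (hχ.pow_mul_semicirclePoly (α := α) (n + 1) le_rfl).add
        (hχ (1 + (n + 1)) (by omega))
      have hmean := isLittleO_mul_of_tendsto_zero (ofReal_mul_isBigO α)
        (htendsto (n + 1) (by omega) (by omega))
      have hvariance_tendsto : Tendsto
          (fun h => χ (Polynomial.aeval (X h) (TwoStateFree.semicirclePoly (α * h) h n))
            - (normalCumulant α (n + 2) : ℂ)) (𝓝[>] 0) (𝓝 0) := by
        match n with
        | 0 => simp [TwoStateFree.semicirclePoly, normalCumulant, hχ_one]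
        | n + 1 =>
          simpa [normalCumulant_of_two_lt α (show 2 < n + 1 + 2 by omega)] using
            htendsto (n + 1) (by omega) (by omega)
      have hvariance := isLittleO_mul_of_tendsto_zero (ofReal_mul_isBigO 1) hvariance_tendsto
      refine ((hmoment.sub hmean).sub hvariance).congr_left fun h => ?_
      have hrec := map_pow_mul_semicirclePoly_add_two χ (α * h) h (X h) 0 n
      simp only [pow_zero, one_mul, zero_add] at hrec
      rw [hrec, show 1 + (n + 1) = n + 2 by ring]
      push_cast
      ring

end SmallTimePolynomials

/-! ### Alternating words in two-state free subalgebras -/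

section Words

variable {A : Type*} [Ring A] [Algebra ℂ A] {ι : Type*}

/-- Alternating products of `ψ`-centered elements of the subalgebras `S i` with `p i`; the index is
that of the first factor. -/
inductive AlternatingWord (ψ : A →ₗ[ℂ] ℂ) (S : ι → Subalgebra ℂ A) (p : ι → Prop) : ι → A → Prop
  | single {i : ι} {a : A} : p i → a ∈ S i → ψ a = 0 → AlternatingWord ψ S p i a
  | cons {i j : ι} {a w : A} : p i → a ∈ S i → ψ a = 0 → i ≠ j → AlternatingWord ψ S p j w →
      AlternatingWord ψ S p i (a * w)

/-- The span of the alternating words with all indices satisfying `p` and the first one `q`. -/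
def wordSpan (ψ : A →ₗ[ℂ] ℂ) (S : ι → Subalgebra ℂ A) (p q : ι → Prop) : Submodule ℂ A :=
  Submodule.span ℂ {w | ∃ i, q i ∧ AlternatingWord ψ S p i w}

/-- The span of the alternating words starting in `S ℓ`. -/
abbrev startSpan (ψ : A →ₗ[ℂ] ℂ) (S : ι → Subalgebra ℂ A) (ℓ : ι) : Submodule ℂ A :=
  wordSpan ψ S (fun _ => True) (· = ℓ)

/-- The span of the alternating words not starting in `S ℓ`. -/
abbrev otherStartSpan (ψ : A →ₗ[ℂ] ℂ) (S : ι → Subalgebra ℂ A) (ℓ : ι) : Submodule ℂ A :=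
  wordSpan ψ S (fun _ => True) (· ≠ ℓ)

/-- The span of the alternating words without factors in `S ℓ`. -/
abbrev avoidingSpan (ψ : A →ₗ[ℂ] ℂ) (S : ι → Subalgebra ℂ A) (ℓ : ι) : Submodule ℂ A :=
  wordSpan ψ S (· ≠ ℓ) (· ≠ ℓ)

/-- The constants plus the alternating words without factors in `S ℓ`. -/
abbrev constSpan (ψ : A →ₗ[ℂ] ℂ) (S : ι → Subalgebra ℂ A) (ℓ : ι) : Submodule ℂ A :=
  Submodule.span ℂ {1} ⊔ avoidingSpan ψ S ℓ

/-- The algebra generated by the subalgebras other than `S ℓ`. -/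
def otherAlgebra (S : ι → Subalgebra ℂ A) (ℓ : ι) : Subalgebra ℂ A :=
  Algebra.adjoin ℂ {a | ∃ i, i ≠ ℓ ∧ a ∈ S i}

variable {φ ψ : A →ₗ[ℂ] ℂ} {S : ι → Subalgebra ℂ A} {p q : ι → Prop} {ℓ : ι}

namespace AlternatingWord

lemma prop_index {i : ι} {w : A} (hw : AlternatingWord ψ S p i w) : p i := by
  cases hw <;> assumption

lemma mono (hpq : ∀ i, p i → q i) {i : ι} {w : A} (hw : AlternatingWord ψ S p i w) :
    AlternatingWord ψ S q i w := by
  induction hw with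
  | single hi ha ha_zero => exact .single (hpq _ hi) ha ha_zero
  | cons hi ha ha_zero hne _ ih => exact .cons (hpq _ hi) ha ha_zero hne ih

lemma mem_wordSpan {i : ι} {w : A} (hi : q i) (hw : AlternatingWord ψ S p i w) :
    w ∈ wordSpan ψ S p q :=
  Submodule.subset_span ⟨i, hi, hw⟩

lemma exists_factorization {i : ι} {w : A} (hw : AlternatingWord ψ S p i w) :
    ∃ (n : ℕ) (k : Fin (n + 1) → ι) (a : Fin (n + 1) → A), k 0 = i ∧
      (∀ j : Fin n, k j.castSucc ≠ k j.succ) ∧ (∀ j, a j ∈ S (k j)) ∧ (∀ j, ψ (a j) = 0) ∧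
      (List.ofFn a).prod = w := by
  induction hw with
  | @single i a _ ha ha_zero =>
    exact ⟨0, fun _ => i, fun _ => a, rfl, fun j => j.elim0, fun _ => ha, fun _ => ha_zero, by simp⟩
  | @cons i j a w _ ha ha_zero hne _ ih =>
    obtain ⟨n, k, b, hk, halternating, hmem, hcentered, hprod⟩ := ih
    refine ⟨n + 1, Fin.cons i k, Fin.cons a b, rfl, Fin.cases (by simpa [hk] using hne)
        fun j => by simpa using halternating j, Fin.cases (by simpa using ha) (by simpa using hmem),
      Fin.cases (by simpa using ha_zero) (by simpa using hcentered), ?_⟩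
    rw [List.ofFn_cons, List.prod_cons, hprod]

lemma psi_eq_zero (hS : TwoStateFreelyIndependent φ ψ S) {i : ι} {w : A}
    (hw : AlternatingWord ψ S p i w) : ψ w = 0 := by
  obtain ⟨n, k, a, -, halternating, hmem, hcentered, rfl⟩ := hw.exists_factorization
  exact (hS n k a halternating hmem hcentered).1

lemma phi_mul (hS : TwoStateFreelyIndependent φ ψ S) {i j : ι} {a w : A} (ha : a ∈ S i)
    (ha_zero : ψ a = 0) (hij : i ≠ j) (hw : AlternatingWord ψ S p j w) :
    φ (a * w) = φ a * φ w := by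
  obtain ⟨n, k, b, hk, halternating, hmem, hcentered, rfl⟩ := hw.exists_factorization
  have hcons := (hS (n + 1) (Fin.cons i k) (Fin.cons a b)
    (fun j => Fin.cases (by simpa [hk] using hij) (fun j => by simpa using halternating j) j)
    (fun j => Fin.cases (by simpa using ha) (fun j => by simpa using hmem j) j)
    (fun j => Fin.cases (by simpa using ha_zero) (fun j => by simpa using hcentered j) j)).2
  rw [List.ofFn_cons, List.prod_cons, Fin.prod_univ_succ] at hcons
  rw [hcons, (hS n k b halternating hmem hcentered).2]
  simp

lemma mul_of_ne (hS : TwoStateFreelyIndependent φ ψ S) {i : ι} {w r : A}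
    (hw : AlternatingWord ψ S (· ≠ ℓ) i w) (hr : AlternatingWord ψ S (fun _ => True) ℓ r) :
    AlternatingWord ψ S (fun _ => True) i (w * r) ∧ φ (w * r) = φ w * φ r := by
  induction hw with
  | single hi ha ha_zero => exact ⟨.cons trivial ha ha_zero hi hr, phi_mul hS ha ha_zero hi hr⟩
  | cons hi ha ha_zero hne hw ih =>
    rw [mul_assoc]
    refine ⟨.cons trivial ha ha_zero hne ih.1, ?_⟩
    rw [phi_mul hS ha ha_zero hne ih.1, phi_mul hS ha ha_zero hne hw, ih.2, mul_assoc]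

end AlternatingWord

lemma psi_eq_zero_of_mem_wordSpan (hS : TwoStateFreelyIndependent φ ψ S) {w : A}
    (hw : w ∈ wordSpan ψ S p q) : ψ w = 0 := by
  have hle : wordSpan ψ S p q ≤ LinearMap.ker ψ :=
    Submodule.span_le.2 fun w ⟨_, _, hw⟩ => hw.psi_eq_zero hS
  exact hle hw

lemma avoidingSpan_le_otherStartSpan : avoidingSpan ψ S ℓ ≤ otherStartSpan ψ S ℓ :=
  Submodule.span_mono fun _ ⟨i, hi, hw⟩ => ⟨i, hi, hw.mono fun _ _ => trivial⟩

lemma mem_startSpan {y : A} (hy : y ∈ S ℓ) (hy_zero : ψ y = 0) : y ∈ startSpan ψ S ℓ :=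
  AlternatingWord.mem_wordSpan rfl (.single trivial hy hy_zero)

lemma mul_mem_and_map_mul_of_mem_span {R : Submodule ℂ A} {s t : Set A}
    (h : ∀ a ∈ s, ∀ b ∈ t, a * b ∈ R ∧ φ (a * b) = φ a * φ b) {a b : A}
    (ha : a ∈ Submodule.span ℂ s) (hb : b ∈ Submodule.span ℂ t) :
    a * b ∈ R ∧ φ (a * b) = φ a * φ b := by
  induction ha, hb using Submodule.span_induction₂ with
  | mem_mem x y hx hy => exact h x hx y hy
  | zero_left => simp
  | zero_right => simp
  | add_left x y z _ _ _ hxz hyz =>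
    rw [add_mul, map_add, map_add, add_mul, hxz.2, hyz.2]
    exact ⟨R.add_mem hxz.1 hyz.1, rfl⟩
  | add_right x y z _ _ _ hxy hxz =>
    rw [mul_add, map_add, map_add, mul_add, hxy.2, hxz.2]
    exact ⟨R.add_mem hxy.1 hxz.1, rfl⟩
  | smul_left r x y _ _ hxy =>
    rw [smul_mul_assoc, map_smul, map_smul, hxy.2, smul_mul_assoc]
    exact ⟨R.smul_mem r hxy.1, rfl⟩
  | smul_right r x y _ _ hxy =>
    rw [mul_smul_comm, map_smul, map_smul, hxy.2, mul_smul_comm]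
    exact ⟨R.smul_mem r hxy.1, rfl⟩

lemma psi_sub_algebraMap_psi (hψ_one : ψ 1 = 1) (a : A) : ψ (a - algebraMap ℂ A (ψ a)) = 0 := by
  rw [map_sub, Algebra.algebraMap_eq_smul_one, map_smul, hψ_one]
  simp

lemma sub_algebraMap_mem {B : Subalgebra ℂ A} {a : A} (ha : a ∈ B) (c : ℂ) :
    a - algebraMap ℂ A c ∈ B :=
  B.sub_mem ha (B.algebraMap_mem c)

lemma algebraMap_mem_constSpan (c : ℂ) : algebraMap ℂ A c ∈ constSpan ψ S ℓ := by
  rw [Algebra.algebraMap_eq_smul_one]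
  exact Submodule.smul_mem _ c (Submodule.mem_sup_left (Submodule.mem_span_singleton_self 1))

lemma mem_constSpan_of_mem (hψ_one : ψ 1 = 1) {i : ι} {a : A} (hi : i ≠ ℓ) (ha : a ∈ S i) :
    a ∈ constSpan ψ S ℓ := by
  rw [← sub_add_cancel a (algebraMap ℂ A (ψ a))]
  exact Submodule.add_mem _ (Submodule.mem_sup_right (AlternatingWord.mem_wordSpan hi
    (.single hi (sub_algebraMap_mem ha _) (psi_sub_algebraMap_psi hψ_one a))))
    (algebraMap_mem_constSpan _)

lemma AlternatingWord.mul_mem_constSpan (hψ_one : ψ 1 = 1) {i j : ι} {a w : A} (hi : i ≠ ℓ)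
    (ha : a ∈ S i) (hij : i ≠ j) (hw : AlternatingWord ψ S (· ≠ ℓ) j w) :
    a * w ∈ constSpan ψ S ℓ := by
  have hsplit : a * w = (a - algebraMap ℂ A (ψ a)) * w + ψ a • w := by
    rw [sub_mul, Algebra.smul_def, sub_add_cancel]
  rw [hsplit]
  exact Submodule.mem_sup_right (Submodule.add_mem _
    (mem_wordSpan hi
      (.cons hi (sub_algebraMap_mem ha _) (psi_sub_algebraMap_psi hψ_one a) hij hw))
    (Submodule.smul_mem _ _ (hw.mem_wordSpan hw.prop_index)))

lemma mul_mem_constSpan (hψ_one : ψ 1 = 1) {i : ι} {a w : A} (hi : i ≠ ℓ) (ha : a ∈ S i)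
    (hw : w ∈ constSpan ψ S ℓ) : a * w ∈ constSpan ψ S ℓ := by
  have hle : constSpan ψ S ℓ ≤ (constSpan ψ S ℓ).comap (LinearMap.mulLeft ℂ a) := by
    refine sup_le ?_ (Submodule.span_le.2 fun w ⟨j, hj, hw⟩ => ?_)
    · rw [Submodule.span_le, Set.singleton_subset_iff]
      simpa using mem_constSpan_of_mem hψ_one hi ha
    · simp only [SetLike.mem_coe, Submodule.mem_comap, LinearMap.mulLeft_apply]
      by_cases hij : i = j
      · subst hij
        cases hw with
        | single _ hb _ => exact mem_constSpan_of_mem hψ_one hi ((S i).mul_mem ha hb)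
        | cons _ hb _ hne hw =>
          rw [← mul_assoc]
          exact hw.mul_mem_constSpan hψ_one hi ((S i).mul_mem ha hb) hne
      · exact hw.mul_mem_constSpan hψ_one hi ha hij
  exact hle hw

lemma otherAlgebra_le_constSpan (hψ_one : ψ 1 = 1) {b : A} (hb : b ∈ otherAlgebra S ℓ) :
    b ∈ constSpan ψ S ℓ := by
  have hmul : ∀ v ∈ constSpan ψ S ℓ, b * v ∈ constSpan ψ S ℓ := by
    induction hb using Algebra.adjoin_induction with
    | mem x hx =>
      obtain ⟨i, hi, hx⟩ := hx
      exact fun v hv => mul_mem_constSpan hψ_one hi hx hv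
    | algebraMap r =>
      intro v hv
      rw [← Algebra.smul_def]
      exact Submodule.smul_mem _ _ hv
    | add x y _ _ hx hy =>
      intro v hv
      rw [add_mul]
      exact Submodule.add_mem _ (hx v hv) (hy v hv)
    | mul x y _ _ hx hy =>
      intro v hv
      rw [mul_assoc]
      exact hx _ (hy v hv)
  have hone : (1 : A) ∈ constSpan ψ S ℓ := by
    simpa using algebraMap_mem_constSpan (ψ := ψ) (S := S) (ℓ := ℓ) 1
  simpa using hmul 1 hone

lemma mem_avoidingSpan_of_mem_otherAlgebra (hS : TwoStateFreelyIndependent φ ψ S)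
    (hψ_one : ψ 1 = 1) {b : A} (hb : b ∈ otherAlgebra S ℓ) (hb_zero : ψ b = 0) :
    b ∈ avoidingSpan ψ S ℓ := by
  obtain ⟨x, hx, y, hy, rfl⟩ := Submodule.mem_sup.1 (otherAlgebra_le_constSpan hψ_one hb)
  obtain ⟨c, rfl⟩ := Submodule.mem_span_singleton.1 hx
  rw [map_add, psi_eq_zero_of_mem_wordSpan hS hy, map_smul, hψ_one] at hb_zero
  have hc : c = 0 := by simpa using hb_zero
  simpa [hc] using hy

lemma centered_mul_startSpan (hS : TwoStateFreelyIndependent φ ψ S) (hψ_one : ψ 1 = 1) {b r : A}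
    (hb : b ∈ otherAlgebra S ℓ) (hb_zero : ψ b = 0) (hr : r ∈ startSpan ψ S ℓ) :
    b * r ∈ otherStartSpan ψ S ℓ ∧ φ (b * r) = φ b * φ r := by
  refine mul_mem_and_map_mul_of_mem_span ?_
    (mem_avoidingSpan_of_mem_otherAlgebra hS hψ_one hb hb_zero) hr
  rintro a ⟨i, hi, ha⟩ w ⟨j, rfl, hw⟩
  have hmul := ha.mul_of_ne hS hw
  exact ⟨hmul.1.mem_wordSpan hi, hmul.2⟩

lemma centered_mul_otherStartSpan (hS : TwoStateFreelyIndependent φ ψ S) {y r : A}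
    (hy : y ∈ S ℓ) (hy_zero : ψ y = 0) (hr : r ∈ otherStartSpan ψ S ℓ) :
    y * r ∈ startSpan ψ S ℓ ∧ φ (y * r) = φ y * φ r := by
  refine mul_mem_and_map_mul_of_mem_span ?_ (Submodule.mem_span_singleton_self y) hr
  rintro _ rfl w ⟨j, hj, hw⟩
  exact ⟨AlternatingWord.mem_wordSpan rfl (.cons trivial hy hy_zero hj.symm hw),
    hw.phi_mul hS hy hy_zero hj.symm⟩

lemma psi_mul_startSpan (hS : TwoStateFreelyIndependent φ ψ S) (hψ_one : ψ 1 = 1) {b r : A}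
    (hb : b ∈ otherAlgebra S ℓ) (hb_zero : ψ b = 0) (hr : r ∈ startSpan ψ S ℓ) : ψ (b * r) = 0 :=
  psi_eq_zero_of_mem_wordSpan hS (centered_mul_startSpan hS hψ_one hb hb_zero hr).1

lemma phi_mul_startSpan (hS : TwoStateFreelyIndependent φ ψ S) (hψ_one : ψ 1 = 1)
    (hφ_one : φ 1 = 1) {b r : A} (hb : b ∈ otherAlgebra S ℓ) (hr : r ∈ startSpan ψ S ℓ) :
    φ (b * r) = φ b * φ r := by
  have hcentered := (centered_mul_startSpan hS hψ_one (sub_algebraMap_mem hb (ψ b))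
    (psi_sub_algebraMap_psi hψ_one b) hr).2
  rw [sub_mul, map_sub, map_sub, ← Algebra.smul_def, map_smul, Algebra.algebraMap_eq_smul_one,
    map_smul, hφ_one] at hcentered
  simp only [smul_eq_mul, mul_one] at hcentered
  linear_combination hcentered

end Words

/-! ### Generating functions of sums of two-state free elements -/

section MapSeries

variable {A : Type*} [Ring A] [Algebra ℂ A] {φ : A →ₗ[ℂ] ℂ}

/-- The power series whose `n`-th coefficient is `φ (w fₙ)`. -/
noncomputable def mapSeries (φ : A →ₗ[ℂ] ℂ) (w : A) (f : PowerSeries A) : PowerSeries ℂ :=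
  PowerSeries.mk fun n => φ (w * f.coeff n)

lemma coeff_mapSeries (w : A) (f : PowerSeries A) (n : ℕ) :
    (mapSeries φ w f).coeff n = φ (w * f.coeff n) := by
  simp [mapSeries]

lemma mapSeries_add (w : A) (f g : PowerSeries A) :
    mapSeries φ w (f + g) = mapSeries φ w f + mapSeries φ w g := by
  ext n
  simp [coeff_mapSeries, mul_add]

lemma mapSeries_sub (w : A) (f g : PowerSeries A) :
    mapSeries φ w (f - g) = mapSeries φ w f - mapSeries φ w g := by
  ext n
  simp [coeff_mapSeries, mul_sub]

lemma mapSeries_one (hφ_one : φ 1 = 1) : mapSeries φ 1 1 = 1 := by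
  ext n
  rw [coeff_mapSeries, PowerSeries.coeff_one, PowerSeries.coeff_one]
  split_ifs <;> simp [hφ_one]

lemma mapSeries_mul (w : A) (f g : PowerSeries A)
    (h : ∀ i j, φ (w * (f.coeff i * g.coeff j)) = φ (w * f.coeff i) * φ (g.coeff j)) :
    mapSeries φ w (f * g) = mapSeries φ w f * mapSeries φ 1 g := by
  ext n
  rw [coeff_mapSeries, PowerSeries.coeff_mul, PowerSeries.coeff_mul, Finset.mul_sum, map_sum]
  exact Finset.sum_congr rfl fun ij _ => by rw [h, coeff_mapSeries, coeff_mapSeries, one_mul]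

end MapSeries

section Coefficients

variable {k R : Type*} [CommRing k] [Ring R] [Algebra k R]

lemma coeff_zero_semicircleSeries_sub_one (a b : k) (x : R) :
    (semicircleSeries a b x - 1).coeff 0 = 0 := by
  simp [semicircleSeries, semicirclePoly]

lemma coeff_semicircleSeries_sub_one (a b : k) (x : R) {n : ℕ} (hn : 1 ≤ n) :
    (semicircleSeries a b x - 1).coeff n = Polynomial.aeval x (semicirclePoly a b n) := by
  rw [map_sub, coeff_semicircleSeries, PowerSeries.coeff_one, if_neg (by omega), sub_zero]

lemma coeff_zero_tailSeries (a b a' b' : k) (x y : R) :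
    (tailSeries a b a' b' x y).coeff 0 = 0 := by
  rw [tailSeries_eq, PowerSeries.coeff_mul]
  simp [semicircleSeries, semicirclePoly]

lemma coeff_zero_otherTailSeries (a b a' b' : k) (x y : R) :
    (otherTailSeries a b a' b' x y).coeff 0 = 1 := by
  rw [otherTailSeries, map_add, PowerSeries.coeff_mul]
  simp [semicircleSeries, semicirclePoly]

end Coefficients

section SumFree

variable {A : Type*} [Ring A] [Algebra ℂ A] {ι : Type*}
variable {φ ψ : A →ₗ[ℂ] ℂ} {S : ι → Subalgebra ℂ A} {ℓ : ι}

lemma aeval_mem_subalgebra {B : Subalgebra ℂ A} {x : A} (hx : x ∈ B) (p : Polynomial ℝ) :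
    Polynomial.aeval x p ∈ B :=
  Algebra.adjoin_singleton_le (S := B.restrictScalars ℝ) hx
    (Polynomial.aeval_mem_adjoin_singleton ℝ x)

variable {a b a' b' : ℝ} {x y : A} {n : ℕ}

lemma coeff_otherTailSeries_mem (hS : TwoStateFreelyIndependent φ ψ S) (hψ_one : ψ 1 = 1)
    (hx : x ∈ otherAlgebra S ℓ) (hn : 1 ≤ n)
    (hx_zero : ∀ m, 1 ≤ m → m ≤ n → ψ (Polynomial.aeval x (semicirclePoly a b m)) = 0)
    (htail : ∀ m, 1 ≤ m → m < n → (tailSeries a b a' b' x y).coeff m ∈ startSpan ψ S ℓ) :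
    (otherTailSeries a b a' b' x y).coeff n ∈ otherStartSpan ψ S ℓ := by
  rw [otherTailSeries, map_add, PowerSeries.coeff_one, if_neg (by omega), zero_add,
    PowerSeries.coeff_mul]
  refine Submodule.sum_mem _ fun ⟨i, j⟩ hij => ?_
  rw [Finset.HasAntidiagonal.mem_antidiagonal] at hij
  simp only at hij ⊢
  rcases Nat.eq_zero_or_pos i with rfl | hi
  · rw [coeff_zero_semicircleSeries_sub_one, zero_mul]
    exact Submodule.zero_mem _
  rw [coeff_semicircleSeries_sub_one _ _ _ hi]
  have hmem := aeval_mem_subalgebra hx (semicirclePoly a b i)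
  rcases Nat.eq_zero_or_pos j with rfl | hj
  · rw [map_add, coeff_zero_tailSeries, PowerSeries.coeff_one, if_pos rfl, add_zero, mul_one]
    exact avoidingSpan_le_otherStartSpan
      (mem_avoidingSpan_of_mem_otherAlgebra hS hψ_one hmem (hx_zero i hi (by omega)))
  · rw [map_add, PowerSeries.coeff_one, if_neg (by omega), zero_add]
    exact (centered_mul_startSpan hS hψ_one hmem (hx_zero i hi (by omega))
      (htail j hj (by omega))).1

lemma coeff_tailSeries_sub_mem (hS : TwoStateFreelyIndependent φ ψ S) (hψ_one : ψ 1 = 1)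
    (hx : x ∈ otherAlgebra S ℓ) (hy : y ∈ S ℓ) (hn : 1 ≤ n)
    (hx_zero : ∀ m, 1 ≤ m → m < n → ψ (Polynomial.aeval x (semicirclePoly a b m)) = 0)
    (hy_zero : ∀ m, 1 ≤ m → m < n → ψ (Polynomial.aeval y (semicirclePoly a' b' m)) = 0) :
    (tailSeries a b a' b' x y).coeff n - Polynomial.aeval y (semicirclePoly a' b' n)
      ∈ startSpan ψ S ℓ := by
  induction n using Nat.strong_induction_on with
  | _ n ih =>
    have htail : ∀ m, 1 ≤ m → m < n →
        (tailSeries a b a' b' x y).coeff m ∈ startSpan ψ S ℓ := fun m hm hmn => by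
      rw [← sub_add_cancel ((tailSeries a b a' b' x y).coeff m)
        (Polynomial.aeval y (semicirclePoly a' b' m))]
      exact Submodule.add_mem _ (ih m hmn hm (fun i hi _ => hx_zero i hi (by omega))
        fun i hi _ => hy_zero i hi (by omega))
        (mem_startSpan (aeval_mem_subalgebra hy _) (hy_zero m hm hmn))
    rw [tailSeries_eq, PowerSeries.coeff_mul, ← Finset.sum_erase_add _ _
      (show (n, 0) ∈ Finset.HasAntidiagonal.antidiagonal n by simp)]
    simp only [coeff_zero_otherTailSeries, mul_one]
    rw [coeff_semicircleSeries_sub_one _ _ _ hn, add_sub_cancel_right]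
    refine Submodule.sum_mem _ fun ⟨i, j⟩ hij => ?_
    rw [Finset.mem_erase, Finset.HasAntidiagonal.mem_antidiagonal] at hij
    simp only [ne_eq, Prod.mk.injEq, not_and] at hij ⊢
    rcases Nat.eq_zero_or_pos i with rfl | hi
    · rw [coeff_zero_semicircleSeries_sub_one, zero_mul]
      exact Submodule.zero_mem _
    have hj : 1 ≤ j := by omega
    rw [coeff_semicircleSeries_sub_one _ _ _ hi]
    exact (centered_mul_otherStartSpan hS (aeval_mem_subalgebra hy _) (hy_zero i hi (by omega))
      (coeff_otherTailSeries_mem hS hψ_one hx hj (fun m hm _ => hx_zero m hm (by omega))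
        fun m hm _ => htail m hm (by omega))).1

lemma coeff_tailSeries_mem (hS : TwoStateFreelyIndependent φ ψ S) (hψ_one : ψ 1 = 1)
    (hx : x ∈ otherAlgebra S ℓ) (hy : y ∈ S ℓ) (hn : 1 ≤ n)
    (hx_zero : ∀ m, 1 ≤ m → m < n → ψ (Polynomial.aeval x (semicirclePoly a b m)) = 0)
    (hy_zero : ∀ m, 1 ≤ m → m ≤ n → ψ (Polynomial.aeval y (semicirclePoly a' b' m)) = 0) :
    (tailSeries a b a' b' x y).coeff n ∈ startSpan ψ S ℓ := by
  rw [← sub_add_cancel ((tailSeries a b a' b' x y).coeff n)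
    (Polynomial.aeval y (semicirclePoly a' b' n))]
  exact Submodule.add_mem _
    (coeff_tailSeries_sub_mem hS hψ_one hx hy hn hx_zero fun m hm hmn => hy_zero m hm hmn.le)
    (mem_startSpan (aeval_mem_subalgebra hy _) (hy_zero n hn le_rfl))

lemma psi_semicirclePoly_add (hS : TwoStateFreelyIndependent φ ψ S) (hψ_one : ψ 1 = 1)
    (hx : x ∈ otherAlgebra S ℓ) (hy : y ∈ S ℓ) (hn : 1 ≤ n)
    (hx_zero : ∀ m, 1 ≤ m → m < n → ψ (Polynomial.aeval x (semicirclePoly a b m)) = 0)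
    (hy_zero : ∀ m, 1 ≤ m → m < n → ψ (Polynomial.aeval y (semicirclePoly a' b' m)) = 0) :
    ψ (Polynomial.aeval (x + y) (semicirclePoly (a + a') (b + b') n)) =
      ψ (Polynomial.aeval x (semicirclePoly a b n)) +
        ψ (Polynomial.aeval y (semicirclePoly a' b' n)) := by
  have htail_n := psi_eq_zero_of_mem_wordSpan hS
    (coeff_tailSeries_sub_mem hS hψ_one hx hy hn hx_zero hy_zero)
  rw [map_sub, sub_eq_zero] at htail_n
  rw [← coeff_semicircleSeries, semicircleSeries_add, mul_add, mul_one, map_add, map_add,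
    coeff_semicircleSeries]
  congr 1
  rw [PowerSeries.coeff_mul, map_sum, Finset.sum_eq_single (0, n) _ (by simp)]
  · simp [coeff_semicircleSeries, semicirclePoly, htail_n]
  · rintro ⟨i, j⟩ hij hne
    rw [Finset.HasAntidiagonal.mem_antidiagonal] at hij
    simp only [ne_eq, Prod.mk.injEq, not_and] at hij hne ⊢
    rcases Nat.eq_zero_or_pos j with rfl | hj
    · rw [coeff_zero_tailSeries, mul_zero, map_zero]
    have hi : 1 ≤ i := by omega
    rw [coeff_semicircleSeries]
    exact psi_mul_startSpan hS hψ_one (aeval_mem_subalgebra hx _) (hx_zero i hi (by omega))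
      (coeff_tailSeries_mem hS hψ_one hx hy hj (fun m hm _ => hx_zero m hm (by omega))
        fun m hm _ => hy_zero m hm (by omega))

section AllDegrees

variable (hS : TwoStateFreelyIndependent φ ψ S) (hψ_one : ψ 1 = 1)
  (hx : x ∈ otherAlgebra S ℓ) (hy : y ∈ S ℓ)
  (hx_zero : ∀ m, 1 ≤ m → ψ (Polynomial.aeval x (semicirclePoly a b m)) = 0)
  (hy_zero : ∀ m, 1 ≤ m → ψ (Polynomial.aeval y (semicirclePoly a' b' m)) = 0)

include hS hψ_one hx hy hx_zero hy_zero

lemma phi_mul_coeff_one_add_tailSeries (hφ_one : φ 1 = 1) {w : A} (hw : w ∈ otherAlgebra S ℓ)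
    (m : ℕ) : φ (w * (1 + tailSeries a b a' b' x y).coeff m) =
      φ w * φ ((1 + tailSeries a b a' b' x y).coeff m) := by
  rcases Nat.eq_zero_or_pos m with rfl | hm
  · simp [coeff_zero_tailSeries, hφ_one, -PowerSeries.coeff_zero_eq_constantCoeff]
  · rw [map_add, PowerSeries.coeff_one, if_neg (by omega), zero_add]
    exact phi_mul_startSpan hS hψ_one hφ_one hw (coeff_tailSeries_mem hS hψ_one hx hy hm
      (fun m hm _ => hx_zero m hm) fun m hm _ => hy_zero m hm)

lemma mapSeries_semicircleSeries_add_eq_mul (hφ_one : φ 1 = 1) {w : A}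
    (hw : w ∈ otherAlgebra S ℓ) :
    mapSeries φ w (semicircleSeries (a + a') (b + b') (x + y)) =
      mapSeries φ w (semicircleSeries a b x) *
        (1 + mapSeries φ 1 (tailSeries a b a' b' x y)) := by
  rw [semicircleSeries_add, mapSeries_mul, mapSeries_add, mapSeries_one hφ_one]
  intro i j
  rw [← mul_assoc, phi_mul_coeff_one_add_tailSeries hS hψ_one hx hy hx_zero hy_zero hφ_one]
  rw [coeff_semicircleSeries]
  exact (otherAlgebra S ℓ).mul_mem hw (aeval_mem_subalgebra hx _)

lemma mapSeries_otherTailSeries (hφ_one : φ 1 = 1) :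
    mapSeries φ 1 (otherTailSeries a b a' b' x y) =
      1 + (mapSeries φ 1 (semicircleSeries a b x) - 1) *
        (1 + mapSeries φ 1 (tailSeries a b a' b' x y)) := by
  rw [otherTailSeries, mapSeries_add, mapSeries_one hφ_one, mapSeries_mul, mapSeries_sub,
    mapSeries_add, mapSeries_one hφ_one]
  intro i j
  rw [one_mul, one_mul,
    phi_mul_coeff_one_add_tailSeries hS hψ_one hx hy hx_zero hy_zero hφ_one]
  rw [map_sub, coeff_semicircleSeries, PowerSeries.coeff_one]
  refine (otherAlgebra S ℓ).sub_mem (aeval_mem_subalgebra hx _) ?_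
  split_ifs
  exacts [one_mem _, zero_mem _]

lemma mapSeries_tailSeries (hφ_one : φ 1 = 1) :
    mapSeries φ 1 (tailSeries a b a' b' x y) =
      (mapSeries φ 1 (semicircleSeries a' b' y) - 1) *
        mapSeries φ 1 (otherTailSeries a b a' b' x y) := by
  rw [tailSeries_eq, mapSeries_mul, mapSeries_sub, mapSeries_one hφ_one]
  intro i j
  rw [one_mul, one_mul]
  rcases Nat.eq_zero_or_pos i with rfl | hi
  · simp [coeff_zero_semicircleSeries_sub_one, -PowerSeries.coeff_zero_eq_constantCoeff]
  rcases Nat.eq_zero_or_pos j with rfl | hj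
  · simp [coeff_zero_otherTailSeries, hφ_one, -PowerSeries.coeff_zero_eq_constantCoeff]
  rw [coeff_semicircleSeries_sub_one _ _ _ hi]
  exact (centered_mul_otherStartSpan hS (aeval_mem_subalgebra hy _) (hy_zero i hi)
    (coeff_otherTailSeries_mem hS hψ_one hx hj (fun m hm _ => hx_zero m hm) fun m hm _ =>
      coeff_tailSeries_mem hS hψ_one hx hy hm (fun m hm _ => hx_zero m hm)
        fun m hm _ => hy_zero m hm)).2

lemma mapSeries_semicircleSeries_add (hφ_one : φ 1 = 1) {w : A} (hw : w ∈ otherAlgebra S ℓ) :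
    mapSeries φ w (semicircleSeries (a + a') (b + b') (x + y)) *
        (1 - (mapSeries φ 1 (semicircleSeries a' b' y) - 1) *
          (mapSeries φ 1 (semicircleSeries a b x) - 1)) =
      mapSeries φ w (semicircleSeries a b x) * mapSeries φ 1 (semicircleSeries a' b' y) := by
  rw [mapSeries_semicircleSeries_add_eq_mul hS hψ_one hx hy hx_zero hy_zero hφ_one hw]
  have htail := mapSeries_tailSeries hS hψ_one hx hy hx_zero hy_zero hφ_one
  rw [mapSeries_otherTailSeries hS hψ_one hx hy hx_zero hy_zero hφ_one] at htail
  linear_combination (mapSeries φ w (semicircleSeries a b x)) * htail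

end AllDegrees

end SumFree

/-! ### Additive functions of time -/

section Additive

variable {E : Type*} [NormedAddCommGroup E] [NormedSpace ℝ E] {f : ℝ → E} {T : ℝ}

lemma map_natCast_mul_of_additive
    (hadd : ∀ s t, 0 ≤ s → s < t → t ≤ T → f t = f s + f (t - s)) (k : ℕ) {h : ℝ} (hh : 0 < h)
    (hkh : ((k : ℝ) + 1) * h ≤ T) : f (((k : ℝ) + 1) * h) = ((k : ℝ) + 1) • f h := by
  induction k with
  | zero => simp
  | succ k ih =>
    push_cast at hkh ⊢
    rw [hadd ((k + 1) * h) ((k + 1 + 1) * h) (by positivity) (by nlinarith) hkh,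
      ih (by nlinarith), show (k + 1 + 1) * h - (k + 1) * h = h by ring]
    module

lemma eq_zero_of_additive_of_isLittleO
    (hadd : ∀ s t, 0 ≤ s → s < t → t ≤ T → f t = f s + f (t - s))
    (hf : f =o[𝓝[>] 0] (id : ℝ → ℝ)) {t : ℝ} (ht : t ∈ Set.Ioc 0 T) : f t = 0 := by
  have hstep : Tendsto (fun N : ℕ => t / ((N : ℝ) + 1)) atTop (𝓝[>] 0) :=
    tendsto_nhdsWithin_iff.2
      ⟨by simpa [div_eq_mul_inv] using tendsto_one_div_add_atTop_nhds_zero_nat.const_mul t,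
        Eventually.of_forall fun N => div_pos ht.1 N.cast_add_one_pos⟩
  have hmul (N : ℕ) : ((N : ℝ) + 1) * (t / ((N : ℝ) + 1)) = t := by field_simp
  have hsum := (Asymptotics.isBigO_refl (fun N : ℕ => (N : ℝ) + 1) atTop).smul_isLittleO
    (hf.comp_tendsto hstep)
  refine (Asymptotics.isLittleO_const_const_iff (c := t)).1
    (hsum.congr (fun N => ?_) fun N => ?_)
  · rw [Function.comp_apply, ← map_natCast_mul_of_additive hadd N
      (div_pos ht.1 N.cast_add_one_pos) (by rw [hmul]; exact ht.2), hmul]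
  · rw [Function.comp_apply, id, smul_eq_mul, hmul]

end Additive

/-! ### Free families of increments -/

lemma exists_finset_of_mem_adjoin_image {R A ι : Type*} [CommSemiring R] [Semiring A] [Algebra R A]
    {f : ι → A} {s : Set ι} {x : A} (hx : x ∈ Algebra.adjoin R (f '' s)) :
    ∃ F : Finset ι, ↑F ⊆ s ∧ x ∈ Algebra.adjoin R (f '' F) := by
  classical
  have hunion {F G : Finset ι} : Algebra.adjoin R (f '' (F ∪ G : Finset ι)) =
      Algebra.adjoin R (f '' F) ⊔ Algebra.adjoin R (f '' G) := by
    rw [Finset.coe_union, Set.image_union, Algebra.adjoin_union]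
  induction hx using Algebra.adjoin_induction with
  | mem x hx =>
    obtain ⟨r, hr, rfl⟩ := hx
    exact ⟨{r}, by simpa using hr, Algebra.subset_adjoin ⟨r, by simp, rfl⟩⟩
  | algebraMap r => exact ⟨∅, by simp, Subalgebra.algebraMap_mem _ r⟩
  | add x y _ _ hx hy =>
    obtain ⟨F, hF, hx⟩ := hx
    obtain ⟨G, hG, hy⟩ := hy
    refine ⟨F ∪ G, by simp [hF, hG], ?_⟩
    rw [hunion]
    exact add_mem (Algebra.mem_sup_left hx) (Algebra.mem_sup_right hy)
  | mul x y _ _ hx hy =>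
    obtain ⟨F, hF, hx⟩ := hx
    obtain ⟨G, hG, hy⟩ := hy
    refine ⟨F ∪ G, by simp [hF, hG], ?_⟩
    rw [hunion]
    exact mul_mem (Algebra.mem_sup_left hx) (Algebra.mem_sup_right hy)

lemma exists_strictMono_fin_of_subset_Icc {β : Type*} [LinearOrder β] {a b : β} (hab : a ≤ b)
    {F : Finset β} (hF : ↑F ⊆ Set.Icc a b) :
    ∃ (k : ℕ) (g : Fin (k + 1) → β), StrictMono g ∧ g 0 = a ∧ g (Fin.last k) = b ∧
      ↑F ⊆ Set.range g := by
  set G : Finset β := insert a (insert b F)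
  have hG : ∀ r ∈ G, r ∈ Set.Icc a b := by
    simpa [G, hab] using fun r hr => hF hr
  obtain ⟨k, hk⟩ := Nat.exists_eq_add_one_of_ne_zero
    (Finset.card_ne_zero_of_mem (Finset.mem_insert_self a (insert b F)))
  have hrange : Set.range (G.orderEmbOfFin hk) = G := Finset.range_orderEmbOfFin G hk
  obtain ⟨i, hi⟩ : a ∈ Set.range (G.orderEmbOfFin hk) := by simp [hrange, G]
  obtain ⟨j, hj⟩ : b ∈ Set.range (G.orderEmbOfFin hk) := by simp [hrange, G]
  refine ⟨k, G.orderEmbOfFin hk, (G.orderEmbOfFin hk).strictMono, ?_, ?_, ?_⟩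
  · exact (hi ▸ (G.orderEmbOfFin hk).monotone (Fin.zero_le i)).antisymm
      (hG _ (G.orderEmbOfFin_mem hk 0)).1
  · exact (hG _ (G.orderEmbOfFin_mem hk _)).2.antisymm
      (hj ▸ (G.orderEmbOfFin hk).monotone (Fin.le_last j))
  · rw [hrange]
    intro r hr
    simp [G, Finset.mem_coe.1 hr]

section Increments

variable {A : Type*} [Ring A] [Algebra ℂ A] {φ ψ : A →ₗ[ℂ] ℂ} {T : ℝ} {X : ℝ → A}

/-- The algebra generated by the process up to time `s`. -/
def pastAlgebra (X : ℝ → A) (s : ℝ) : Subalgebra ℂ A := Algebra.adjoin ℂ (X '' Set.Icc 0 s)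

lemma mem_pastAlgebra (X : ℝ → A) {r s : ℝ} (hr : 0 ≤ r) (hrs : r ≤ s) : X r ∈ pastAlgebra X s :=
  Algebra.subset_adjoin ⟨r, ⟨hr, hrs⟩, rfl⟩

lemma pastAlgebra_mono (X : ℝ → A) {r s : ℝ} (hrs : r ≤ s) : pastAlgebra X r ≤ pastAlgebra X s :=
  Algebra.adjoin_mono (Set.image_mono (Set.Icc_subset_Icc_right hrs))

/-- The algebras generated by the increments of `X` between consecutive times `g i`. -/
def incrementAlgebra {k : ℕ} (X : ℝ → A) (g : Fin (k + 2) → ℝ) (i : Fin (k + 1)) :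
    Subalgebra ℂ A :=
  Algebra.adjoin ℂ {X (g i.succ) - X (g i.castSucc)}

lemma mem_otherAlgebra_incrementAlgebra {k : ℕ} {g : Fin (k + 2) → ℝ} (hg : X (g 0) = 0)
    (i : Fin (k + 1)) : X (g i.castSucc) ∈ otherAlgebra (incrementAlgebra X g) (Fin.last k) := by
  induction i using Fin.induction with
  | zero =>
    rw [Fin.castSucc_zero, hg]
    exact zero_mem _
  | succ i ih =>
    have hincrement : X (g i.castSucc.succ) - X (g i.castSucc.castSucc) ∈
        otherAlgebra (incrementAlgebra X g) (Fin.last k) :=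
      Algebra.subset_adjoin ⟨i.castSucc, (Fin.castSucc_lt_last i).ne, Algebra.subset_adjoin rfl⟩
    simpa using add_mem hincrement ih

variable [StarRing A]

lemma HasTwoStateFreeIncrements.freelyIndependent_incrementAlgebra
    (hX : HasTwoStateFreeIncrements φ ψ T X) {k : ℕ} {g : Fin (k + 2) → ℝ} (hg : StrictMono g)
    (hg_zero : 0 ≤ g 0) (hg_last : g (Fin.last _) ≤ T) :
    TwoStateFreelyIndependent φ ψ (incrementAlgebra X g) := by
  have hdisjoint : ∀ i j : Fin (k + 1), i < j →
      Disjoint (Set.Ico (g i.castSucc) (g i.succ)) (Set.Ico (g j.castSucc) (g j.succ)) :=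
    fun i j hij => Set.disjoint_left.2 fun _ hx hx' =>
      (hx.2.trans_le (hg.monotone (Fin.succ_le_castSucc_iff.2 hij))).not_ge hx'.1
  refine hX.free (k + 1) (fun i => g i.castSucc) (fun i => g i.succ) (fun i => ⟨?_, ?_, ?_⟩)
    fun i j hij => ?_
  · exact hg_zero.trans (hg.monotone (Fin.zero_le _))
  · exact hg i.castSucc_lt_succ
  · exact (hg.monotone (Fin.le_last _)).trans hg_last
  · rcases lt_or_gt_of_ne hij with hlt | hlt
    exacts [hdisjoint i j hlt, (hdisjoint j i hlt).symm]

lemma HasTwoStateFreeIncrements.exists_free_family (hX : HasTwoStateFreeIncrements φ ψ T X)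
    {s t : ℝ} (hs : 0 ≤ s) (hst : s < t) (htT : t ≤ T) {w : A} (hw : w ∈ pastAlgebra X s) :
    ∃ (k : ℕ) (S : Fin (k + 1) → Subalgebra ℂ A), TwoStateFreelyIndependent φ ψ S ∧
      w ∈ otherAlgebra S (Fin.last k) ∧ X s ∈ otherAlgebra S (Fin.last k) ∧
      X t - X s ∈ S (Fin.last k) := by
  obtain ⟨F, hF, hw⟩ := exists_finset_of_mem_adjoin_image hw
  obtain ⟨k, g, hg, hg_zero, hg_last, hg_range⟩ := exists_strictMono_fin_of_subset_Icc hs hF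
  set g' : Fin (k + 2) → ℝ := Fin.snoc g t with hg'
  have hg'_castSucc (i : Fin (k + 1)) : g' i.castSucc = g i := by simp [hg']
  have hg'_last : g' (Fin.last _) = t := by simp [hg']
  have hg'_zero : g' 0 = 0 := (hg'_castSucc 0).trans hg_zero
  have hg'_mono : StrictMono g' := by
    rw [Fin.strictMono_iff_lt_succ]
    refine Fin.lastCases ?_ fun i => ?_
    · rwa [Fin.succ_last, hg'_last, hg'_castSucc, hg_last]
    · rw [← Fin.castSucc_succ, hg'_castSucc, hg'_castSucc]
      exact hg i.castSucc_lt_succ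
  have hmem (i : Fin (k + 1)) : X (g i) ∈ otherAlgebra (incrementAlgebra X g') (Fin.last k) := by
    rw [← hg'_castSucc]
    exact mem_otherAlgebra_incrementAlgebra (by rw [hg'_zero, hX.zero]) i
  refine ⟨k, incrementAlgebra X g',
    hX.freelyIndependent_incrementAlgebra hg'_mono hg'_zero.ge (hg'_last.trans_le htT), ?_,
    hg_last ▸ hmem (Fin.last k), ?_⟩
  · refine Algebra.adjoin_le ?_ hw
    rintro _ ⟨r, hr, rfl⟩
    obtain ⟨i, rfl⟩ := hg_range hr
    exact hmem i
  · rw [← hg_last, ← hg'_castSucc, ← hg'_last, ← Fin.succ_last]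
    exact Algebra.subset_adjoin rfl

end Increments

/-! ### Martingale polynomials of the process -/

lemma inv_coeff_add_coeff_isLittleO {β 𝕜 : Type*} [NormedField 𝕜] {l : Filter β} {g : β → ℝ}
    (hg : Tendsto g l (𝓝 0)) {f : β → PowerSeries 𝕜} (hf : ∀ x, (f x).constantCoeff = 1)
    (hf_coeff : ∀ n, 1 ≤ n → (fun x => (f x).coeff n) =O[l] g) {n : ℕ} (hn : 1 ≤ n) :
    (fun x => (f x)⁻¹.coeff n + (f x).coeff n) =o[l] g := by
  have hprod (x : β) : f x + (f x)⁻¹ = 1 + 1 - (f x - 1) * ((f x)⁻¹ - 1) := by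
    linear_combination PowerSeries.mul_inv_cancel (f x) (by simp [hf])
  induction n using Nat.strong_induction_on with
  | _ n ih =>
    have hinv_tendsto : ∀ j, 1 ≤ j → j < n → Tendsto (fun x => (f x)⁻¹.coeff j) l (𝓝 0) :=
      fun j hj hjn => by
        have hbigO := (ih j hjn hj).isBigO.sub (hf_coeff j hj)
        simp only [add_sub_cancel_right] at hbigO
        exact hbigO.trans_tendsto hg
    have hterm : ∀ ij ∈ Finset.HasAntidiagonal.antidiagonal n,
        (fun x => (f x - 1).coeff ij.1 * ((f x)⁻¹ - 1).coeff ij.2) =o[l] g := by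
      rintro ⟨i, j⟩ hij
      rw [Finset.HasAntidiagonal.mem_antidiagonal] at hij
      rcases Nat.eq_zero_or_pos i with rfl | hi
      · simp [hf]
      rcases Nat.eq_zero_or_pos j with rfl | hj
      · simp [hf]
      simpa [PowerSeries.coeff_one, hi.ne', hj.ne'] using (hf_coeff i hi).mul_isLittleO
        ((Asymptotics.isLittleO_one_iff ℝ).2 (hinv_tendsto j hj (by simp at hij; omega)))
    refine (Asymptotics.IsLittleO.fun_sum hterm).neg_left.congr_left fun x => ?_
    rw [← PowerSeries.coeff_mul, add_comm, ← map_add, hprod]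
    simp [PowerSeries.coeff_one, Nat.one_le_iff_ne_zero.1 hn]

lemma map_aeval_congr {A : Type*} [Ring A] [Algebra ℂ A] {χ : A →ₗ[ℂ] ℂ} {x y : A}
    (h : ∀ n : ℕ, χ (x ^ n) = χ (y ^ n)) (p : Polynomial ℝ) :
    χ (Polynomial.aeval x p) = χ (Polynomial.aeval y p) := by
  simp only [Polynomial.aeval_eq_sum_range, map_sum, LinearMap.map_smul_of_tower, h]

section Martingale

variable {A : Type*} [Ring A] [Algebra ℂ A] {φ ψ : A →ₗ[ℂ] ℂ} {α T : ℝ} {X : ℝ → A}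

/-- The `φ`-expectation of the generating function of the polynomials
`semicirclePoly (α * t) t` at `X t`. -/
noncomputable def phiSeries (φ : A →ₗ[ℂ] ℂ) (α : ℝ) (X : ℝ → A) (t : ℝ) : PowerSeries ℂ :=
  mapSeries φ 1 (semicircleSeries (α * t) t (X t))

lemma coeff_phiSeries (t : ℝ) (n : ℕ) : (phiSeries φ α X t).coeff n =
    φ (Polynomial.aeval (X t) (semicirclePoly (α * t) t n)) := by
  rw [phiSeries, coeff_mapSeries, coeff_semicircleSeries, one_mul]

lemma constantCoeff_phiSeries (hφ_one : φ 1 = 1) (t : ℝ) :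
    (phiSeries φ α X t).constantCoeff = 1 := by
  rw [← PowerSeries.coeff_zero_eq_constantCoeff_apply, coeff_phiSeries]
  simp [semicirclePoly, hφ_one]

lemma phiSeries_mul_inv (hφ_one : φ 1 = 1) (t : ℝ) :
    phiSeries φ α X t * (phiSeries φ α X t)⁻¹ = 1 :=
  PowerSeries.mul_inv_cancel _ (by simp [constantCoeff_phiSeries hφ_one])

lemma coeff_succ_mul_mapSeries_semicircleSeries (w y : A) (a b : ℝ) (n : ℕ) :
    ((1 + PowerSeries.C (a : ℂ) * PowerSeries.X) *
        mapSeries φ w (semicircleSeries a b y)).coeff (n + 1) =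
      φ (w * Polynomial.aeval y (martingalePoly a b (n + 1))) := by
  rw [add_mul, one_mul, map_add, mul_assoc, PowerSeries.coeff_C_mul, PowerSeries.coeff_succ_X_mul,
    coeff_mapSeries, coeff_mapSeries, coeff_semicircleSeries, coeff_semicircleSeries,
    martingalePoly_succ, map_add (Polynomial.aeval y), map_mul (Polynomial.aeval y),
    Polynomial.aeval_C, mul_add, map_add φ, Algebra.left_comm, map_algebraMap_real_mul]

variable [StarRing A]

namespace IsTwoStateFBM

variable (hX : IsTwoStateFBM φ ψ α T X) (hT : 0 < T)
include hX hT

lemma psi_semicirclePoly_eq_zero (hψ_one : ψ 1 = 1) {n : ℕ} (hn : 1 ≤ n) {t : ℝ}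
    (ht : t ∈ Set.Icc 0 T) : ψ (Polynomial.aeval (X t) (semicirclePoly (α * t) t n)) = 0 := by
  induction n using Nat.strong_induction_on generalizing t with
  | _ n ih =>
    have hadd : ∀ s t, 0 ≤ s → s < t → t ≤ T →
        ψ (Polynomial.aeval (X t) (semicirclePoly (α * t) t n)) =
          ψ (Polynomial.aeval (X s) (semicirclePoly (α * s) s n)) +
            ψ (Polynomial.aeval (X (t - s)) (semicirclePoly (α * (t - s)) (t - s) n)) := by
      intro s t hs hst htT
      obtain ⟨k, S, hS, -, hx, hy⟩ := hX.exists_free_family hs hst htT (Subalgebra.one_mem _)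
      have hstationary := map_aeval_congr fun n => (hX.stationary s t hs hst.le htT n).2
      have hsum := psi_semicirclePoly_add (a := α * s) (b := s) (a' := α * (t - s)) (b' := t - s)
        hS hψ_one hx hy hn (fun m hm hmn => ih m hmn hm ⟨hs, hst.le.trans htT⟩)
        (fun m hm hmn => by
          rw [hstationary]
          exact ih m hmn hm ⟨by linarith, by linarith⟩)
      rw [hstationary] at hsum
      simpa [← mul_add] using hsum
    have hsmall := (hX.hasSmallTimeMoments_psi hT).semicirclePoly (α := α) hψ_one hn
    simp only [sub_self, zero_mul, Complex.ofReal_zero, sub_zero] at hsmall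
    rcases ht.1.eq_or_lt with rfl | ht_pos
    · simpa using hadd 0 T le_rfl hT le_rfl
    · exact eq_zero_of_additive_of_isLittleO hadd hsmall ⟨ht_pos, ht.2⟩

variable (hψ_one : ψ 1 = 1) (hφ_one : φ 1 = 1)
include hψ_one hφ_one

lemma mapSeries_semicircleSeries {s t : ℝ} (hs : 0 ≤ s) (hst : s < t) (htT : t ≤ T) {w : A}
    (hw : w ∈ pastAlgebra X s) :
    mapSeries φ w (semicircleSeries (α * t) t (X t)) *
        (1 - (phiSeries φ α X (t - s) - 1) * (phiSeries φ α X s - 1)) =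
      mapSeries φ w (semicircleSeries (α * s) s (X s)) * phiSeries φ α X (t - s) := by
  obtain ⟨k, S, hS, hw, hx, hy⟩ := hX.exists_free_family hs hst htT hw
  have hstationary := fun n => hX.stationary s t hs hst.le htT n
  have hsum := mapSeries_semicircleSeries_add (a := α * s) (b := s) (a' := α * (t - s))
    (b' := t - s) hS hψ_one hx hy
    (fun m hm => hX.psi_semicirclePoly_eq_zero hT hψ_one hm ⟨hs, hst.le.trans htT⟩)
    (fun m hm => by
      rw [map_aeval_congr fun n => (hstationary n).2]
      exact hX.psi_semicirclePoly_eq_zero hT hψ_one hm ⟨by linarith, by linarith⟩) hφ_one hw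
  have hincrement : mapSeries φ 1 (semicircleSeries (α * (t - s)) (t - s) (X t - X s)) =
      phiSeries φ α X (t - s) := by
    ext n
    rw [coeff_mapSeries, coeff_phiSeries, one_mul, coeff_semicircleSeries,
      map_aeval_congr fun n => (hstationary n).1]
  rw [hincrement] at hsum
  simpa [phiSeries, ← mul_add] using hsum

lemma inv_phiSeries_add {s t : ℝ} (hs : 0 ≤ s) (hst : s < t) (htT : t ≤ T) :
    (phiSeries φ α X t)⁻¹ = (phiSeries φ α X s)⁻¹ + (phiSeries φ α X (t - s))⁻¹ - 1 := by
  have hsum := hX.mapSeries_semicircleSeries hT hψ_one hφ_one hs hst htT (Subalgebra.one_mem _)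
  change phiSeries φ α X t * _ = phiSeries φ α X s * _ at hsum
  have ht_inv := phiSeries_mul_inv (φ := φ) (α := α) (X := X) hφ_one t
  have hs_inv := phiSeries_mul_inv (φ := φ) (α := α) (X := X) hφ_one s
  have hts_inv := phiSeries_mul_inv (φ := φ) (α := α) (X := X) hφ_one (t - s)
  generalize phiSeries φ α X t = D, (phiSeries φ α X t)⁻¹ = d at *
  generalize phiSeries φ α X s = P, (phiSeries φ α X s)⁻¹ = p at *
  generalize phiSeries φ α X (t - s) = Q, (phiSeries φ α X (t - s))⁻¹ = q at *
  have hcleared : d * (P * p) * (Q * q) =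
      (D * d) * ((P * p) * q + (Q * q) * p - (P * p) * (Q * q)) := by
    linear_combination (-d * p * q) * hsum
  rw [ht_inv, hs_inv, hts_inv] at hcleared
  linear_combination hcleared

omit hψ_one in
lemma coeff_inv_phiSeries_isLittleO {n : ℕ} (hn : 1 ≤ n) :
    (fun h => (phiSeries φ α X h)⁻¹.coeff n
        - (((normalCumulant α n - normalCumulant 0 n) * h : ℝ) : ℂ)) =o[𝓝[>] 0] (id : ℝ → ℝ) := by
  have hcoeff : ∀ m, 1 ≤ m → (fun h => (phiSeries φ α X h).coeff m
      - (((normalCumulant 0 m - normalCumulant α m) * h : ℝ) : ℂ)) =o[𝓝[>] 0] (id : ℝ → ℝ) :=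
    fun m hm => by
      simpa only [coeff_phiSeries] using (hX.hasSmallTimeMoments_phi hT).semicirclePoly hφ_one hm
  refine ((inv_coeff_add_coeff_isLittleO tendsto_id_nhdsGT_zero (constantCoeff_phiSeries hφ_one)
    (fun m hm => isBigO_of_sub_ofReal_mul_isLittleO (hcoeff m hm)) hn).sub
      (hcoeff n hn)).congr_left fun h => ?_
  push_cast
  ring

lemma inv_phiSeries_eq {t : ℝ} (ht : t ∈ Set.Icc 0 T) :
    (phiSeries φ α X t)⁻¹ = 1 + PowerSeries.C ((α * t : ℝ) : ℂ) * PowerSeries.X := by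
  ext n
  rcases Nat.eq_zero_or_pos n with rfl | hn
  · simp [constantCoeff_phiSeries hφ_one]
  have hadd : ∀ s t, 0 ≤ s → s < t → t ≤ T → (phiSeries φ α X t)⁻¹.coeff n
        - (((normalCumulant α n - normalCumulant 0 n) * t : ℝ) : ℂ) =
      ((phiSeries φ α X s)⁻¹.coeff n
        - (((normalCumulant α n - normalCumulant 0 n) * s : ℝ) : ℂ)) +
      ((phiSeries φ α X (t - s))⁻¹.coeff n
        - (((normalCumulant α n - normalCumulant 0 n) * (t - s) : ℝ) : ℂ)) := by
    intro s t hs hst htT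
    rw [hX.inv_phiSeries_add hT hψ_one hφ_one hs hst htT, map_sub, map_add,
      PowerSeries.coeff_one, if_neg hn.ne']
    push_cast
    ring
  have hcoeff : (phiSeries φ α X t)⁻¹.coeff n
      - (((normalCumulant α n - normalCumulant 0 n) * t : ℝ) : ℂ) = 0 := by
    rcases ht.1.eq_or_lt with rfl | ht_pos
    · simpa using hadd 0 T le_rfl hT le_rfl
    · exact eq_zero_of_additive_of_isLittleO hadd
        (hX.coeff_inv_phiSeries_isLittleO hT hφ_one hn) ⟨ht_pos, ht.2⟩
  rw [sub_eq_zero.1 hcoeff]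
  match n with
  | 1 => simp [normalCumulant, PowerSeries.coeff_one]
  | 2 => simp [normalCumulant, PowerSeries.coeff_one]
  | n + 3 => simp [normalCumulant, PowerSeries.coeff_one]

lemma one_add_mul_mapSeries_semicircleSeries {s t : ℝ} (hs : 0 ≤ s) (hst : s < t) (htT : t ≤ T)
    {w : A} (hw : w ∈ pastAlgebra X s) :
    (1 + PowerSeries.C ((α * t : ℝ) : ℂ) * PowerSeries.X) *
        mapSeries φ w (semicircleSeries (α * t) t (X t)) =
      (1 + PowerSeries.C ((α * s : ℝ) : ℂ) * PowerSeries.X) *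
        mapSeries φ w (semicircleSeries (α * s) s (X s)) := by
  have hsum := hX.mapSeries_semicircleSeries hT hψ_one hφ_one hs hst htT hw
  have hs_inv := phiSeries_mul_inv (φ := φ) (α := α) (X := X) hφ_one s
  have hts_inv := phiSeries_mul_inv (φ := φ) (α := α) (X := X) hφ_one (t - s)
  rw [hX.inv_phiSeries_eq hT hψ_one hφ_one ⟨hs, hst.le.trans htT⟩] at hs_inv
  rw [hX.inv_phiSeries_eq hT hψ_one hφ_one ⟨by linarith, by linarith⟩] at hts_inv
  have hC : PowerSeries.C ((α * t : ℝ) : ℂ) =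
      PowerSeries.C ((α * s : ℝ) : ℂ) + PowerSeries.C ((α * (t - s) : ℝ) : ℂ) := by
    rw [← map_add, ← Complex.ofReal_add]
    ring_nf
  rw [hC]
  set a := PowerSeries.C ((α * s : ℝ) : ℂ) * PowerSeries.X
  set b := PowerSeries.C ((α * (t - s) : ℝ) : ℂ) * PowerSeries.X
  set D := mapSeries φ w (semicircleSeries (α * t) t (X t))
  set E := mapSeries φ w (semicircleSeries (α * s) s (X s))
  linear_combination ((1 + a) * (1 + b)) * hsum
    - (D * (1 + b - (1 + b) * phiSeries φ α X (t - s))) * hs_inv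
    - (D * a - E * (1 + a)) * hts_inv

lemma phi_mul_martingalePoly {s t : ℝ} (hs : 0 ≤ s) (hst : s < t) (htT : t ≤ T) {w : A}
    (hw : w ∈ pastAlgebra X s) (n : ℕ) :
    φ (w * Polynomial.aeval (X t) (martingalePoly (α * t) t n)) =
      φ (w * Polynomial.aeval (X s) (martingalePoly (α * s) s n)) := by
  match n with
  | 0 => simp [martingalePoly]
  | n + 1 =>
    rw [← coeff_succ_mul_mapSeries_semicircleSeries, ← coeff_succ_mul_mapSeries_semicircleSeries,
      hX.one_add_mul_mapSeries_semicircleSeries hT hψ_one hφ_one hs hst htT hw]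

lemma phi_mul_aeval_eq_transitionOp {s t : ℝ} (hs : 0 ≤ s) (hst : s < t) (htT : t ≤ T) {w : A}
    (hw : w ∈ pastAlgebra X s) (p : Polynomial ℝ) :
    φ (w * Polynomial.aeval (X t) p) =
      φ (w * Polynomial.aeval (X s) (transitionOp α s t p)) := by
  let f (r : ℝ) : Polynomial ℝ →ₗ[ℝ] ℂ := (φ.restrictScalars ℝ) ∘ₗ (LinearMap.mulLeft ℝ w) ∘ₗ
    (Polynomial.aeval (X r)).toLinearMap
  have hmartingale : f t = f s ∘ₗ transitionOp α s t :=
    linearMap_ext_martingalePoly (α * t) t fun n => by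
      simpa [f, transitionOp_martingalePoly] using
        hX.phi_mul_martingalePoly hT hψ_one hφ_one hs hst htT hw n
  exact LinearMap.congr_fun hmartingale p

end IsTwoStateFBM

end Martingale

/-! ### Spectral measures -/

section Spectral

variable {E : Type*} [NormedAddCommGroup E] [InnerProductSpace ℂ E] [CompleteSpace E]
  {J : E →L[ℂ] E}

/-- The functional `f ↦ ⟨e, f(J) e⟩` on continuous functions on the spectrum of `J`. -/
noncomputable def spectralFunctional (hJ : IsSelfAdjoint J) (e : E) :
    C(spectrum ℝ J, ℝ) →ₗ[ℝ] ℝ where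
  toFun f := (inner ℂ e (cfcHom hJ f e)).re
  map_add' f g := by simp
  map_smul' c f := by
    simp only [map_smul, smul_apply, RingHom.id_apply, smul_eq_mul]
    rw [← Complex.coe_smul, inner_smul_right]
    simp

lemma spectralFunctional_nonneg (hJ : IsSelfAdjoint J) (e : E) {f : C(spectrum ℝ J, ℝ)}
    (hf : 0 ≤ f) : 0 ≤ spectralFunctional hJ e f := by
  have hpos := (ContinuousLinearMap.nonneg_iff_isPositive _).1 ((cfcHom_nonneg_iff hJ).2 hf)
  exact (Complex.nonneg_iff.1 (hpos.inner_nonneg_right e)).1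

lemma cfcHom_toContinuousMapOn (hJ : IsSelfAdjoint J) (p : Polynomial ℝ) :
    cfcHom hJ (p.toContinuousMapOn (spectrum ℝ J)) = Polynomial.aeval J p := by
  have hp : p.toContinuousMapOn (spectrum ℝ J) =
      Polynomial.aeval ((ContinuousMap.id ℝ).restrict (spectrum ℝ J)) p := by
    ext x
    simp [Polynomial.aeval_continuousMap_apply]
  rw [hp, ← Polynomial.aeval_algHom_apply, cfcHom_id]

/-- `spectralFunctional` in the form required by the Riesz–Markov–Kakutani theorem. -/
noncomputable def spectralPositiveFunctional (hJ : IsSelfAdjoint J) (e : E) :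
    CompactlySupportedContinuousMap (spectrum ℝ J) ℝ →ₚ[ℝ] ℝ :=
  PositiveLinearMap.mk₀
    { toFun := fun f => spectralFunctional hJ e f.toContinuousMap
      map_add' := fun _ _ => (spectralFunctional hJ e).map_add _ _
      map_smul' := fun c _ => (spectralFunctional hJ e).map_smul c _ }
    fun _ hf => spectralFunctional_nonneg hJ e hf

/-- The spectral measure of a self-adjoint operator at the vector `e`. -/
noncomputable def spectralMeasure (hJ : IsSelfAdjoint J) (e : E) : Measure ℝ :=
  (RealRMK.rieszMeasure (spectralPositiveFunctional hJ e)).map Subtype.val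

lemma ae_mem_spectrum_spectralMeasure (hJ : IsSelfAdjoint J) (e : E) :
    ∀ᵐ x ∂spectralMeasure hJ e, x ∈ spectrum ℝ J :=
  (ae_map_iff measurable_subtype_coe.aemeasurable (spectrum.isCompact J).measurableSet).2
    (Eventually.of_forall Subtype.property)

lemma integral_eval_spectralMeasure (hJ : IsSelfAdjoint J) (e : E) (p : Polynomial ℝ) :
    ∫ x, p.eval x ∂spectralMeasure hJ e = (inner ℂ e (Polynomial.aeval J p e)).re := by
  rw [spectralMeasure, integral_map measurable_subtype_coe.aemeasurable
    p.continuous.aestronglyMeasurable, ← cfcHom_toContinuousMapOn hJ]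
  exact RealRMK.integral_rieszMeasure (spectralPositiveFunctional hJ e)
    (CompactlySupportedContinuousMap.continuousMapEquiv (p.toContinuousMapOn (spectrum ℝ J)))

lemma isProbabilityMeasure_spectralMeasure (hJ : IsSelfAdjoint J) {e : E} (he : ‖e‖ = 1) :
    IsProbabilityMeasure (spectralMeasure hJ e) := by
  have hone := integral_eval_spectralMeasure hJ e 1
  simp only [Polynomial.eval_one, integral_const, smul_eq_mul, mul_one, map_one,
    one_apply_eq_self, inner_self_eq_norm_sq_to_K, he] at hone
  simpa [measureReal_def, ENNReal.toReal_eq_one_iff, isProbabilityMeasure_iff] using hone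

end Spectral

/-! ### Measures with bounded support -/

/-- A measure on the line carried by a bounded interval. -/
def HasBoundedSupport (μ : Measure ℝ) : Prop :=
  ∃ R : ℝ, ∀ᵐ x ∂μ, |x| ≤ R

section BoundedSupport

variable {μ ν : Measure ℝ}

lemma hasBoundedSupport_of_ae_mem {K : Set ℝ} (hK : Bornology.IsBounded K)
    (hμ : ∀ᵐ x ∂μ, x ∈ K) : HasBoundedSupport μ := by
  obtain ⟨R, hR⟩ := hK.subset_closedBall 0
  exact ⟨R, hμ.mono fun x hx => by simpa using hR hx⟩

lemma hasBoundedSupport_dirac (x : ℝ) : HasBoundedSupport (Measure.dirac x) :=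
  ⟨|x|, by simp [ae_dirac_eq]⟩

lemma HasBoundedSupport.memLp [IsFiniteMeasure μ] (hμ : HasBoundedSupport μ) {f : ℝ → ℝ}
    (hf : Continuous f) {p : ENNReal} : MemLp f p μ := by
  obtain ⟨R, hR⟩ := hμ
  obtain ⟨C, hC⟩ := (isCompact_Icc (a := -R) (b := R)).exists_bound_of_continuousOn hf.continuousOn
  exact MemLp.of_bound hf.aestronglyMeasurable C (hR.mono fun x hx => hC x (abs_le.1 hx))

lemma HasBoundedSupport.integrable [IsFiniteMeasure μ] (hμ : HasBoundedSupport μ) {f : ℝ → ℝ}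
    (hf : Continuous f) : Integrable f μ :=
  memLp_one_iff_integrable.1 (hμ.memLp hf)

lemma HasBoundedSupport.integrable_mul (hμ : HasBoundedSupport μ) {f d : ℝ → ℝ}
    (hf : Continuous f) (hd : Integrable d μ) : Integrable (fun x => f x * d x) μ := by
  obtain ⟨R, hR⟩ := hμ
  obtain ⟨C, hC⟩ := (isCompact_Icc (a := -R) (b := R)).exists_bound_of_continuousOn hf.continuousOn
  exact hd.bdd_mul hf.aestronglyMeasurable (hR.mono fun x hx => hC x (abs_le.1 hx))

lemma exists_seq_polynomial_near {f : ℝ → ℝ} (hf : Continuous f) :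
    ∃ p : ℕ → Polynomial ℝ,
      ∀ k : ℕ, ∀ x : ℝ, |x| ≤ k → |(p k).eval x - f x| < 1 / ((k : ℝ) + 1) := by
  choose p hp using fun k : ℕ => exists_polynomial_near_of_continuousOn (-(k : ℝ)) k f
    hf.continuousOn (1 / ((k : ℝ) + 1)) (by positivity)
  exact ⟨p, fun k x hx => hp k x (abs_le.1 hx)⟩

lemma HasBoundedSupport.eventually_abs_eval_sub_lt (hμ : HasBoundedSupport μ) {f : ℝ → ℝ}
    {p : ℕ → Polynomial ℝ}
    (hp : ∀ k : ℕ, ∀ x : ℝ, |x| ≤ k → |(p k).eval x - f x| < 1 / ((k : ℝ) + 1)) :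
    ∀ᶠ k : ℕ in atTop, ∀ᵐ x ∂μ, |(p k).eval x - f x| < 1 / ((k : ℝ) + 1) := by
  obtain ⟨R, hR⟩ := hμ
  filter_upwards [eventually_ge_atTop ⌈R⌉₊] with k hk
  exact hR.mono fun x hx => hp k x (hx.trans ((Nat.le_ceil R).trans (by exact_mod_cast hk)))

lemma HasBoundedSupport.tendsto_integral_mul (hμ : HasBoundedSupport μ)
    {f d : ℝ → ℝ} (hf : Continuous f) (hd : Integrable d μ) {p : ℕ → Polynomial ℝ}
    (hp : ∀ k : ℕ, ∀ x : ℝ, |x| ≤ k → |(p k).eval x - f x| < 1 / ((k : ℝ) + 1)) :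
    Tendsto (fun k => ∫ x, (p k).eval x * d x ∂μ) atTop (𝓝 (∫ x, f x * d x ∂μ)) := by
  rw [← tendsto_sub_nhds_zero_iff]
  refine squeeze_zero_norm' (a := fun k : ℕ => 1 / ((k : ℝ) + 1) * ∫ x, |d x| ∂μ) ?_
    (by simpa using tendsto_one_div_add_atTop_nhds_zero_nat.mul_const (∫ x, |d x| ∂μ))
  filter_upwards [hμ.eventually_abs_eval_sub_lt hp] with k hk
  rw [← integral_sub (hμ.integrable_mul (p k).continuous hd) (hμ.integrable_mul hf hd),
    ← integral_const_mul]
  refine norm_integral_le_of_norm_le (hd.abs.const_mul _) (hk.mono fun x hx => ?_)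
  rw [← sub_mul, norm_mul, Real.norm_eq_abs, Real.norm_eq_abs]
  exact mul_le_mul_of_nonneg_right hx.le (abs_nonneg _)

lemma HasBoundedSupport.tendsto_integral [IsFiniteMeasure μ] (hμ : HasBoundedSupport μ)
    {f : ℝ → ℝ} (hf : Continuous f) {p : ℕ → Polynomial ℝ}
    (hp : ∀ k : ℕ, ∀ x : ℝ, |x| ≤ k → |(p k).eval x - f x| < 1 / ((k : ℝ) + 1)) :
    Tendsto (fun k => ∫ x, (p k).eval x ∂μ) atTop (𝓝 (∫ x, f x ∂μ)) := by
  simpa using hμ.tendsto_integral_mul hf (integrable_const 1) hp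

lemma HasBoundedSupport.ae_eq_zero_of_integral_eval_mul_eq_zero (hμ : HasBoundedSupport μ)
    {d : ℝ → ℝ} (hd : Integrable d μ) (h : ∀ p : Polynomial ℝ, ∫ x, p.eval x * d x ∂μ = 0) :
    ∀ᵐ x ∂μ, d x = 0 := by
  refine ae_eq_zero_of_integral_contDiff_smul_eq_zero hd.locallyIntegrable fun g hg _ => ?_
  obtain ⟨p, hp⟩ := exists_seq_polynomial_near hg.continuous
  have hlim := hμ.tendsto_integral_mul hg.continuous hd hp
  simp only [h] at hlim
  exact tendsto_nhds_unique hlim tendsto_const_nhds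

lemma HasBoundedSupport.ae_eq_zero_of_integral_pow_mul_eq_zero (hμ : HasBoundedSupport μ)
    {d : ℝ → ℝ} (hd : Integrable d μ) (h : ∀ n : ℕ, ∫ x, x ^ n * d x ∂μ = 0) :
    ∀ᵐ x ∂μ, d x = 0 := by
  refine hμ.ae_eq_zero_of_integral_eval_mul_eq_zero hd fun p => ?_
  simp only [Polynomial.eval_eq_sum_range, Finset.sum_mul, mul_assoc]
  rw [integral_finsetSum _ fun n _ =>
    (hμ.integrable_mul (continuous_pow n) hd).const_mul (p.coeff n)]
  simp only [integral_const_mul, h, mul_zero, Finset.sum_const_zero]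

lemma HasBoundedSupport.exists_polynomial_eLpNorm_sub_lt [IsFiniteMeasure μ]
    (hμ : HasBoundedSupport μ) {q : ENNReal} (hq_one : 1 ≤ q) (hq_top : q ≠ ⊤) {g : ℝ → ℝ}
    (hg : MemLp g q μ) {ε : ENNReal} (hε : 0 < ε) :
    ∃ p : Polynomial ℝ, eLpNorm (g - fun x => p.eval x) q μ < ε := by
  obtain ⟨δ, hδ, hδε⟩ := exists_between hε
  have hε_sub : 0 < ε - δ := tsub_pos_of_lt hδε
  obtain ⟨f, hgf, hf⟩ := hg.exists_boundedContinuous_eLpNorm_sub_le hq_top hδ.ne'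
  obtain ⟨p, hp⟩ := exists_seq_polynomial_near f.continuous
  have hlim : Tendsto (fun k : ℕ => μ Set.univ ^ q.toReal⁻¹ *
      ENNReal.ofReal (1 / ((k : ℝ) + 1))) atTop (𝓝 0) := by
    simpa using ENNReal.Tendsto.const_mul (a := μ Set.univ ^ q.toReal⁻¹)
      (ENNReal.tendsto_ofReal (tendsto_one_div_add_atTop_nhds_zero_nat (𝕜 := ℝ)))
      (Or.inr (ENNReal.rpow_ne_top_of_nonneg (by positivity) (measure_ne_top μ _)))
  obtain ⟨k, hk, hk_lt⟩ := ((hμ.eventually_abs_eval_sub_lt hp).and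
    (hlim.eventually_lt_const hε_sub)).exists
  have hfp : eLpNorm (⇑f - fun x => (p k).eval x) q μ < ε - δ :=
    (eLpNorm_le_of_ae_bound (hk.mono fun x hx => by
      rw [Pi.sub_apply, norm_sub_rev]
      exact hx.le)).trans_lt hk_lt
  refine ⟨p k, ?_⟩
  calc eLpNorm (g - fun x => (p k).eval x) q μ
      = eLpNorm ((g - ⇑f) + (⇑f - fun x => (p k).eval x)) q μ := by rw [sub_add_sub_cancel]
    _ ≤ eLpNorm (g - ⇑f) q μ + eLpNorm (⇑f - fun x => (p k).eval x) q μ :=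
        eLpNorm_add_le (hg.1.sub hf.1) (hf.1.sub (p k).continuous.aestronglyMeasurable) hq_one
    _ < δ + (ε - δ) := ENNReal.add_lt_add_of_le_of_lt (hgf.trans_lt hδε.lt_top).ne hgf hfp
    _ = ε := add_tsub_cancel_of_le hδε.le

lemma HasBoundedSupport.eq_of_integral_eval_eq [IsFiniteMeasure μ] [IsFiniteMeasure ν]
    (hμ : HasBoundedSupport μ) (hν : HasBoundedSupport ν)
    (h : ∀ p : Polynomial ℝ, ∫ x, p.eval x ∂μ = ∫ x, p.eval x ∂ν) : μ = ν := by
  refine ext_of_forall_integral_eq_of_IsFiniteMeasure fun f => ?_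
  obtain ⟨p, hp⟩ := exists_seq_polynomial_near f.continuous
  refine tendsto_nhds_unique (hμ.tendsto_integral f.continuous hp) ?_
  simpa only [h] using hν.tendsto_integral f.continuous hp

lemma measureReal_lt_abs_le_of_integral_pow_le [IsFiniteMeasure μ] {r : ℝ} (hr : 0 < r) {n : ℕ}
    {c : ℝ} (hint : Integrable (fun x : ℝ => x ^ (2 * n)) μ)
    (hle : ∫ x, x ^ (2 * n) ∂μ ≤ c) : μ.real {x | r < |x|} ≤ c / r ^ (2 * n) := by
  rw [le_div_iff₀' (by positivity)]
  have hsubset : {x : ℝ | r < |x|} ⊆ {x | r ^ (2 * n) ≤ x ^ (2 * n)} := fun x hx => by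
    rw [Set.mem_ofPred_eq, ← (even_two_mul n).pow_abs x]
    exact pow_le_pow_left₀ hr.le (le_of_lt hx) _
  calc r ^ (2 * n) * μ.real {x | r < |x|}
      ≤ r ^ (2 * n) * μ.real {x | r ^ (2 * n) ≤ x ^ (2 * n)} := by
        gcongr
        exact measure_ne_top _ _
    _ ≤ ∫ x, x ^ (2 * n) ∂μ :=
        mul_meas_ge_le_integral_of_nonneg (Eventually.of_forall fun x =>
          (even_two_mul n).pow_nonneg x) hint _
    _ ≤ c := hle

lemma ae_abs_le_of_integral_pow_le [IsFiniteMeasure μ] {R r c : ℝ} (hR : 0 ≤ R) (hRr : R < r)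
    (hint : ∀ n : ℕ, Integrable (fun x : ℝ => x ^ (2 * n)) μ)
    (hle : ∀ n : ℕ, ∫ x, x ^ (2 * n) ∂μ ≤ c * R ^ (2 * n)) : ∀ᵐ x ∂μ, |x| ≤ r := by
  have hr : 0 < r := hR.trans_lt hRr
  have hratio : (R / r) ^ 2 < 1 :=
    pow_lt_one₀ (by positivity) ((div_lt_one hr).2 hRr) two_ne_zero
  have hlim : Tendsto (fun n : ℕ => c * R ^ (2 * n) / r ^ (2 * n)) atTop (𝓝 0) := by
    simpa only [mul_div_assoc, ← div_pow, pow_mul, mul_zero] using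
      (tendsto_pow_atTop_nhds_zero_of_lt_one (by positivity) hratio).const_mul c
  have hzero : μ.real {x | r < |x|} = 0 :=
    le_antisymm (ge_of_tendsto' hlim fun n =>
      measureReal_lt_abs_le_of_integral_pow_le hr (hint n) (hle n)) measureReal_nonneg
  rw [ae_iff]
  simpa [measureReal_def, ENNReal.toReal_eq_zero_iff] using hzero

lemma HasBoundedSupport.of_integral_eval_eq [IsFiniteMeasure μ] [IsFiniteMeasure ν]
    (hμ : HasBoundedSupport μ) (hint : ∀ p : Polynomial ℝ, Integrable (fun x => p.eval x) ν)
    (h : ∀ p : Polynomial ℝ, ∫ x, p.eval x ∂ν = ∫ x, p.eval x ∂μ) : HasBoundedSupport ν := by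
  have ⟨R, hR⟩ := hμ
  refine ⟨|R| + 1, ae_abs_le_of_integral_pow_le (c := μ.real Set.univ) (abs_nonneg R)
    (lt_add_one _) (fun n => by simpa using hint (Polynomial.X ^ (2 * n))) fun n => ?_⟩
  calc ∫ x, x ^ (2 * n) ∂ν = ∫ x, x ^ (2 * n) ∂μ := by simpa using h (Polynomial.X ^ (2 * n))
    _ ≤ ∫ _, |R| ^ (2 * n) ∂μ := by
      refine integral_mono_ae (hμ.integrable (by fun_prop)) (integrable_const _) ?_
      filter_upwards [hR] with x hx
      rw [← (even_two_mul n).pow_abs]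
      exact pow_le_pow_left₀ (abs_nonneg x) (hx.trans (le_abs_self R)) _
    _ = μ.real Set.univ * |R| ^ (2 * n) := by simp

lemma integrable_eval_of_integrable_pow (hμ : ∀ n : ℕ, Integrable (fun x : ℝ => x ^ n) μ)
    (p : Polynomial ℝ) : Integrable (fun x => p.eval x) μ := by
  simp only [Polynomial.eval_eq_sum_range]
  exact integrable_finsetSum _ fun i _ => (hμ i).const_mul _

lemma integral_eval_eq_sum_range (hμ : ∀ n : ℕ, Integrable (fun x : ℝ => x ^ n) μ)
    (p : Polynomial ℝ) :
    ∫ x, p.eval x ∂μ = ∑ i ∈ Finset.range (p.natDegree + 1), p.coeff i * ∫ x, x ^ i ∂μ := by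
  simp only [Polynomial.eval_eq_sum_range]
  rw [integral_finsetSum _ fun i _ => (hμ i).const_mul _]
  simp only [integral_const_mul]

/-- Integration of polynomials against `μ`, as a linear functional. -/
noncomputable def integralFunctional (hμ : ∀ n : ℕ, Integrable (fun x : ℝ => x ^ n) μ) :
    Polynomial ℝ →ₗ[ℝ] ℝ where
  toFun p := ∫ x, p.eval x ∂μ
  map_add' p q := by
    simp only [Polynomial.eval_add]
    exact integral_add (integrable_eval_of_integrable_pow hμ p)
      (integrable_eval_of_integrable_pow hμ q)
  map_smul' c p := by
    simp only [Polynomial.eval_smul, RingHom.id_apply, smul_eq_mul]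
    exact integral_const_mul c _

lemma measurable_of_forall_measurable_lintegral {Ω S : Type*} [MeasurableSpace S]
    [TopologicalSpace Ω] [HasOuterApproxClosed Ω] [MeasurableSpace Ω] [BorelSpace Ω]
    {κ : S → Measure Ω} [∀ x, IsProbabilityMeasure (κ x)]
    (hκ : ∀ f : BoundedContinuousFunction Ω NNReal, Measurable fun x => ∫⁻ y, f y ∂κ x) :
    Measurable κ := by
  refine Measurable.measure_of_isPiSystem_of_isProbabilityMeasure
    (BorelSpace.measurable_eq.trans borel_eq_generateFrom_isClosed) isPiSystem_isClosed
    fun F hF => ?_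
  exact measurable_of_tendsto_metrizable (fun n => hκ (IsClosed.apprSeq hF n))
    (tendsto_pi_nhds.2 fun x => HasOuterApproxClosed.tendsto_lintegral_apprSeq hF (κ x))

lemma measurable_of_forall_measurable_integral_eval {S : Type*} [MeasurableSpace S]
    {κ : S → Measure ℝ} [∀ x, IsProbabilityMeasure (κ x)] (hκ : ∀ x, HasBoundedSupport (κ x))
    (hp : ∀ p : Polynomial ℝ, Measurable fun x => ∫ y, p.eval y ∂κ x) : Measurable κ := by
  refine measurable_of_forall_measurable_lintegral fun f => ?_
  have hf : Continuous fun y => (f y : ℝ) := by fun_prop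
  obtain ⟨p, hpf⟩ := exists_seq_polynomial_near hf
  have hmeas : Measurable fun x => ∫ y, (f y : ℝ) ∂κ x :=
    measurable_of_tendsto_metrizable (fun k => hp (p k))
      (tendsto_pi_nhds.2 fun x => (hκ x).tendsto_integral hf hpf)
  convert hmeas.ennreal_ofReal using 2 with x
  rw [ofReal_integral_eq_lintegral_ofReal ((hκ x).integrable hf)
    (Eventually.of_forall fun y => (f y).2)]
  simp

end BoundedSupport

/-! ### Jacobi operators -/

lemma exists_unilateral_shift :
    ∃ (S : lp (fun _ : ℕ => ℂ) 2 →L[ℂ] lp (fun _ : ℕ => ℂ) 2) (e : lp (fun _ : ℕ => ℂ) 2),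
      ‖e‖ = 1 ∧ star S * S = 1 ∧ star S e = 0 := by
  have horth : Orthonormal ℂ fun i : ℕ => (lp.single 2 i (1 : ℂ) : lp (fun _ : ℕ => ℂ) 2) :=
    orthonormal_iff_ite.2 fun i j => by
      rw [lp.inner_single_left, lp.single_apply]
      simp [Pi.single_apply]
  have hV := (horth.comp _ Nat.succ_injective).orthogonalFamily
  refine ⟨hV.linearIsometry.toContinuousLinearMap, lp.single 2 0 (1 : ℂ), horth.1 0,
    (ContinuousLinearMap.norm_map_iff_adjoint_comp_self _).1 fun x => by simp,
    ext_inner_right ℂ fun f => ?_⟩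
  rw [ContinuousLinearMap.star_eq_adjoint, ContinuousLinearMap.adjoint_inner_left, inner_zero_left]
  refine ((hV.hasSum_linearIsometry f).mapL (innerSL ℂ (lp.single 2 0 (1 : ℂ)))).unique ?_
  convert hasSum_zero with i
  simp [orthonormal_iff_ite.1 horth 0 (i + 1)]

section Jacobi

variable {E : Type*} [NormedAddCommGroup E] [InnerProductSpace ℂ E]

lemma re_inner_real_smul_right (e v : E) (r : ℝ) :
    (inner ℂ e (r • v)).re = r * (inner ℂ e v).re := by
  rw [inner_smul_right_eq_smul]
  simp

lemma aeval_semicirclePoly_add_two_apply (a b : ℝ) (J : E →L[ℂ] E) (n : ℕ) (v : E) :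
    Polynomial.aeval J (semicirclePoly a b (n + 2)) v =
      J (Polynomial.aeval J (semicirclePoly a b (n + 1)) v)
        - a • Polynomial.aeval J (semicirclePoly a b (n + 1)) v
        - b • Polynomial.aeval J (semicirclePoly a b n) v := by
  rw [semicirclePoly]
  simp [ContinuousLinearMap.algebraMap_apply]

lemma aeval_martingalePoly_add_two_apply (a b : ℝ) (J : E →L[ℂ] E) (n : ℕ) (v : E) :
    Polynomial.aeval J (martingalePoly a b (n + 2)) v =
      J (Polynomial.aeval J (martingalePoly a b (n + 1)) v)
        - a • Polynomial.aeval J (martingalePoly a b (n + 1)) v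
        - b • Polynomial.aeval J (martingalePoly a b n) v := by
  rw [martingalePoly]
  simp [ContinuousLinearMap.algebraMap_apply]

variable [CompleteSpace E]

/-- For the unilateral shift `S`, the Jacobi operator with diagonal `x, a - b, a, a, …` and
off-diagonal `c, r, r, …`; here `1 - S S*` is the projection onto the vacuum vector. With the
parameters of `aeval_jacobiOp_martingalePoly` its spectral measure at the vacuum vector is the
transition probability from `x`. -/
noncomputable def jacobiOp (S : E →L[ℂ] E) (x a b r c : ℝ) : E →L[ℂ] E :=
  a • 1 + r • (S + star S) + (x - a) • (1 - S * star S) - b • (S * (1 - S * star S) * star S) +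
    (c - r) • (S * (1 - S * star S) + (1 - S * star S) * star S)

lemma isSelfAdjoint_jacobiOp (S : E →L[ℂ] E) (x a b r c : ℝ) :
    IsSelfAdjoint (jacobiOp S x a b r c) := by
  simp only [jacobiOp, IsSelfAdjoint, star_add, star_sub, star_smul, star_mul, star_star, star_one,
    star_trivial, mul_assoc]
  rw [add_comm (star S), add_comm ((1 - S * star S) * star S)]

variable {S : E →L[ℂ] E} {e : E}

lemma one_add_smul_jacobiOp_nonneg (hS : star S * S = 1) {α x d : ℝ} (r u : ℝ)
    (hd : d ^ 2 = 1 + α * x) :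
    0 ≤ 1 + α • jacobiOp S x (α * r ^ 2) (α * (r ^ 2 - u ^ 2)) r (u * d) := by
  set B : E →L[ℂ] E := 1 + (α * r) • star S + (d - 1) • (1 - S * star S) +
    (α * (u - r)) • ((1 - S * star S) * star S) with hB
  have hstar : star B = 1 + (α * r) • S + (d - 1) • (1 - S * star S) +
      (α * (u - r)) • (S * (1 - S * star S)) := by
    simp only [hB, star_add, star_sub, star_smul, star_mul, star_star, star_one, star_trivial]
  have hS_cancel (z : E →L[ℂ] E) : star S * (S * z) = z := by rw [← mul_assoc, hS, one_mul]
  suffices h : 1 + α • jacobiOp S x (α * r ^ 2) (α * (r ^ 2 - u ^ 2)) r (u * d) = star B * B from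
    h ▸ star_mul_self_nonneg B
  rw [hstar, hB, jacobiOp]
  simp only [mul_add, add_mul, mul_sub, sub_mul, smul_mul_assoc, mul_smul_comm, mul_assoc,
    hS_cancel, mul_one, one_mul]
  linear_combination (norm := module) -hd • (1 - S * star S)

lemma ae_nonneg_spectralMeasure {J : E →L[ℂ] E} (hJ : IsSelfAdjoint J) (e : E) {α : ℝ}
    (hα : 0 ≤ 1 + α • J) : ∀ᵐ y ∂spectralMeasure hJ e, 0 ≤ 1 + α * y := by
  filter_upwards [ae_mem_spectrum_spectralMeasure hJ e] with y hy
  have hmem := spectrum.subset_polynomial_aeval J (1 + Polynomial.C α * Polynomial.X) ⟨y, hy, rfl⟩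
  have haeval : Polynomial.aeval J (1 + Polynomial.C α * Polynomial.X) = 1 + α • J := by
    simp [Algebra.smul_def]
  rw [haeval] at hmem
  simpa using spectrum_nonneg_of_nonneg hα hmem

lemma star_apply_apply_of_star_mul_self (hS : star S * S = 1) (v : E) : star S (S v) = v := by
  simpa using congrArg (fun f : E →L[ℂ] E => f v) hS

lemma jacobiOp_apply_vacuum (he : star S e = 0) (x a b r c : ℝ) :
    jacobiOp S x a b r c e = x • e + c • S e := by
  simp only [jacobiOp, add_apply, sub_apply, smul_apply, mul_apply_eq_comp, one_apply_eq_self,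
    he, map_zero, map_sub]
  module

lemma jacobiOp_apply_shift_vacuum (hS : star S * S = 1) (he : star S e = 0) (x a b r c : ℝ) :
    jacobiOp S x a b r c (S e) = c • e + (a - b) • S e + r • S (S e) := by
  simp only [jacobiOp, add_apply, sub_apply, smul_apply, mul_apply_eq_comp, one_apply_eq_self,
    he, map_zero, map_sub, star_apply_apply_of_star_mul_self hS]
  module

lemma jacobiOp_apply_shift (hS : star S * S = 1) {v : E} (hv : S (star S v) = v)
    (x a b r c : ℝ) : jacobiOp S x a b r c (S v) = a • S v + r • (S (S v) + v) := by
  simp only [jacobiOp, add_apply, sub_apply, smul_apply, mul_apply_eq_comp, one_apply_eq_self,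
    map_sub, star_apply_apply_of_star_mul_self hS, hv]
  module

/-- The component, orthogonal to the vacuum vector `e` and divided by `c`, of the vector obtained
by applying the martingale polynomials of `jacobiOp` to `e`. -/
noncomputable def shiftPart (S : E →L[ℂ] E) (e : E) (a b r x : ℝ) : ℕ → E
  | 0 => 0
  | n + 1 => (semicirclePoly a b n).eval x • S e + r • S (shiftPart S e a b r x n)

lemma shift_star_shiftPart (hS : star S * S = 1) (a b r x : ℝ) (n : ℕ) :
    S (star S (shiftPart S e a b r x n)) = shiftPart S e a b r x n := by
  cases n with
  | zero => simp [shiftPart]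
  | succ n => simp [shiftPart, star_apply_apply_of_star_mul_self hS]

lemma inner_shiftPart (hS : star S * S = 1) (he : star S e = 0) (a b r x : ℝ) (n : ℕ) :
    inner ℂ e (shiftPart S e a b r x n) = 0 := by
  rw [← shift_star_shiftPart hS, ← ContinuousLinearMap.adjoint_inner_left,
    ← ContinuousLinearMap.star_eq_adjoint, he, inner_zero_left]

lemma eval_martingalePoly_add_mul_eval_succ (α s x : ℝ) (n : ℕ) :
    (martingalePoly (α * s) s n).eval x + α * (martingalePoly (α * s) s (n + 1)).eval x =
      (1 + α * x) * (semicirclePoly (α * s) s n).eval x := by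
  cases n with
  | zero => simp [martingalePoly, semicirclePoly]
  | succ n =>
    rw [martingalePoly_succ, martingalePoly_succ, semicirclePoly]
    simp only [Polynomial.eval_add, Polynomial.eval_sub, Polynomial.eval_mul, Polynomial.eval_X,
      Polynomial.eval_C]
    ring

lemma aeval_jacobiOp_martingalePoly (hS : star S * S = 1) (he : star S e = 0) {α s t x r c : ℝ}
    (hr : r ^ 2 = t) (hc : c ^ 2 = (t - s) * (1 + α * x)) (n : ℕ) :
    Polynomial.aeval (jacobiOp S x (α * t) (α * s) r c) (martingalePoly (α * t) t n) e =
      (martingalePoly (α * s) s n).eval x • e + c • shiftPart S e (α * s) s r x n := by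
  induction n using Nat.twoStepInduction with
  | zero => simp [martingalePoly, shiftPart]
  | one => simp [martingalePoly, shiftPart, semicirclePoly, jacobiOp_apply_vacuum he]
  | more n ih0 ih1 =>
    have hvacuum : (martingalePoly (α * s) s (n + 1)).eval x * x
        + c ^ 2 * (semicirclePoly (α * s) s n).eval x
        - α * t * (martingalePoly (α * s) s (n + 1)).eval x
        - t * (martingalePoly (α * s) s n).eval x
        = (martingalePoly (α * s) s (n + 2)).eval x := by
      simp only [martingalePoly, Polynomial.eval_sub, Polynomial.eval_mul, Polynomial.eval_X,
        Polynomial.eval_C, hc]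
      linear_combination (s - t) * eval_martingalePoly_add_mul_eval_succ α s x n
    have hshift : (martingalePoly (α * s) s (n + 1)).eval x
        - α * s * (semicirclePoly (α * s) s n).eval x
        = (semicirclePoly (α * s) s (n + 1)).eval x := by
      simp [martingalePoly_succ]
    rw [aeval_martingalePoly_add_two_apply, ih1, ih0]
    simp only [shiftPart, map_add, ContinuousLinearMap.map_smul_of_tower, jacobiOp_apply_vacuum he,
      jacobiOp_apply_shift_vacuum hS he,
      jacobiOp_apply_shift hS (shift_star_shiftPart hS _ _ _ _ n)]
    linear_combination (norm := module) hvacuum • e + (c * hshift) • S e +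
      (c * hr) • shiftPart S e (α * s) s r x n

lemma aeval_jacobiOp_semicirclePoly (hS : star S * S = 1) (he : star S e = 0) {a b r : ℝ}
    (hr : r ^ 2 = b) (n : ℕ) :
    Polynomial.aeval (jacobiOp S a a 0 r r) (semicirclePoly a b n) e = r ^ n • (S ^ n) e := by
  have hJ : jacobiOp S a a 0 r r = a • 1 + r • (S + star S) := by simp [jacobiOp]
  induction n using Nat.twoStepInduction with
  | zero => simp [semicirclePoly]
  | one => simp [semicirclePoly, ContinuousLinearMap.algebraMap_apply, jacobiOp_apply_vacuum he]
  | more n ih0 ih1 =>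
    rw [aeval_semicirclePoly_add_two_apply, ih1, ih0, hJ]
    simp only [ContinuousLinearMap.map_smul_of_tower, add_apply, smul_apply, one_apply_eq_self,
      pow_succ' S, mul_apply_eq_comp, star_apply_apply_of_star_mul_self hS]
    linear_combination (norm := module) (r ^ n * hr) • (S ^ n) e

end Jacobi

lemma exists_transition_probability {α s t x : ℝ} (hs : 0 ≤ s) (hst : s ≤ t)
    (hx : 0 ≤ 1 + α * x) :
    ∃ μ : Measure ℝ, IsProbabilityMeasure μ ∧ HasBoundedSupport μ ∧ (∀ᵐ y ∂μ, 0 ≤ 1 + α * y) ∧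
      ∀ n, ∫ y, (martingalePoly (α * t) t n).eval y ∂μ = (martingalePoly (α * s) s n).eval x := by
  obtain ⟨S, e, he_norm, hS, he⟩ := exists_unilateral_shift
  have hr : √t ^ 2 = t := Real.sq_sqrt (hs.trans hst)
  have hu : √(t - s) ^ 2 = t - s := Real.sq_sqrt (sub_nonneg.2 hst)
  have hd : √(1 + α * x) ^ 2 = 1 + α * x := Real.sq_sqrt hx
  have hJ := isSelfAdjoint_jacobiOp S x (α * t) (α * s) √t (√(t - s) * √(1 + α * x))
  refine ⟨spectralMeasure hJ e, isProbabilityMeasure_spectralMeasure hJ he_norm,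
    hasBoundedSupport_of_ae_mem (spectrum.isCompact _).isBounded
      (ae_mem_spectrum_spectralMeasure hJ e),
    ae_nonneg_spectralMeasure hJ e ?_, fun n => ?_⟩
  · simpa only [hr, hu, sub_sub_cancel] using one_add_smul_jacobiOp_nonneg hS √t √(t - s) hd
  · rw [integral_eval_spectralMeasure,
      aeval_jacobiOp_martingalePoly hS he hr (by rw [mul_pow, hu, hd]), inner_add_right,
      Complex.add_re, re_inner_real_smul_right, re_inner_real_smul_right, inner_shiftPart hS he,
      inner_self_eq_norm_sq_to_K, he_norm]
    simp

lemma exists_semicircle_probability (a : ℝ) {b : ℝ} (hb : 0 ≤ b) :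
    ∃ μ : Measure ℝ, IsProbabilityMeasure μ ∧ HasBoundedSupport μ ∧
      ∀ n, 1 ≤ n → ∫ y, (semicirclePoly a b n).eval y ∂μ = 0 := by
  obtain ⟨S, e, he_norm, hS, he⟩ := exists_unilateral_shift
  have hJ := isSelfAdjoint_jacobiOp S a a 0 √b √b
  refine ⟨spectralMeasure hJ e, isProbabilityMeasure_spectralMeasure hJ he_norm,
    hasBoundedSupport_of_ae_mem (spectrum.isCompact _).isBounded
      (ae_mem_spectrum_spectralMeasure hJ e), fun n hn => ?_⟩
  obtain ⟨n, rfl⟩ := Nat.exists_eq_add_of_le' hn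
  rw [integral_eval_spectralMeasure, aeval_jacobiOp_semicirclePoly hS he (Real.sq_sqrt hb),
    re_inner_real_smul_right, pow_succ' S, mul_apply_eq_comp,
    ← ContinuousLinearMap.adjoint_inner_left, ← ContinuousLinearMap.star_eq_adjoint, he,
    inner_zero_left]
  simp

/-! ### The transition functions -/

section TransitionFunctions

/-- The times and positions at which the transition probability of the classical version has to be
specified: the process lives on the half-line `0 ≤ 1 + α x`. -/
def IsAdmissible (α s t x : ℝ) : Prop := 0 ≤ s ∧ s ≤ t ∧ 0 ≤ 1 + α * x

variable {α r s t x : ℝ}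

open Classical in
/-- The law at time `t` of the classical version started at time `s` from `x`; at points which are
not admissible the process is frozen, so that the Chapman–Kolmogorov equations survive. -/
noncomputable def transitionMeasure (α s t x : ℝ) : Measure ℝ :=
  if h : IsAdmissible α s t x then (exists_transition_probability h.1 h.2.1 h.2.2).choose
  else Measure.dirac x

lemma IsAdmissible.transitionMeasure_spec (h : IsAdmissible α s t x) :
    IsProbabilityMeasure (transitionMeasure α s t x) ∧
      HasBoundedSupport (transitionMeasure α s t x) ∧
      (∀ᵐ y ∂transitionMeasure α s t x, 0 ≤ 1 + α * y) ∧
      ∀ n, ∫ y, (martingalePoly (α * t) t n).eval y ∂transitionMeasure α s t x =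
        (martingalePoly (α * s) s n).eval x := by
  rw [transitionMeasure, dif_pos h]
  exact (exists_transition_probability h.1 h.2.1 h.2.2).choose_spec

lemma transitionMeasure_of_not_isAdmissible (h : ¬IsAdmissible α s t x) :
    transitionMeasure α s t x = Measure.dirac x :=
  dif_neg h

instance (α s t x : ℝ) : IsProbabilityMeasure (transitionMeasure α s t x) := by
  by_cases h : IsAdmissible α s t x
  · exact h.transitionMeasure_spec.1
  · rw [transitionMeasure_of_not_isAdmissible h]
    infer_instance

lemma hasBoundedSupport_transitionMeasure (α s t x : ℝ) :
    HasBoundedSupport (transitionMeasure α s t x) := by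
  by_cases h : IsAdmissible α s t x
  · exact h.transitionMeasure_spec.2.1
  · rw [transitionMeasure_of_not_isAdmissible h]
    exact hasBoundedSupport_dirac x

lemma IsAdmissible.integral_eval_transitionMeasure (h : IsAdmissible α s t x)
    (p : Polynomial ℝ) :
    ∫ y, p.eval y ∂transitionMeasure α s t x = (transitionOp α s t p).eval x := by
  have hpow (n : ℕ) : Integrable (fun y : ℝ => y ^ n) (transitionMeasure α s t x) :=
    (hasBoundedSupport_transitionMeasure α s t x).integrable (continuous_pow n)
  have hfun : integralFunctional hpow = Polynomial.leval x ∘ₗ transitionOp α s t :=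
    linearMap_ext_martingalePoly (α * t) t fun n => by
      rw [LinearMap.comp_apply, transitionOp_martingalePoly]
      exact h.transitionMeasure_spec.2.2.2 n
  exact LinearMap.congr_fun hfun p

lemma IsAdmissible.ae_integral_eval_transitionMeasure (h : IsAdmissible α r s x) (hst : s ≤ t)
    (p : Polynomial ℝ) : ∀ᵐ y ∂transitionMeasure α r s x,
      ∫ z, p.eval z ∂transitionMeasure α s t y = (transitionOp α s t p).eval y :=
  h.transitionMeasure_spec.2.2.1.mono fun _ hy =>
    integral_eval_transitionMeasure ⟨h.1.trans h.2.1, hst, hy⟩ p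

lemma measurable_transitionMeasure (α s t : ℝ) : Measurable (transitionMeasure α s t) := by
  refine measurable_of_forall_measurable_integral_eval
    (hasBoundedSupport_transitionMeasure α s t) fun p => ?_
  classical
  have hintegral : (fun x => ∫ y, p.eval y ∂transitionMeasure α s t x) =
      fun x => if IsAdmissible α s t x then (transitionOp α s t p).eval x else p.eval x := by
    funext x
    split_ifs with h
    · exact h.integral_eval_transitionMeasure p
    · rw [transitionMeasure_of_not_isAdmissible h, integral_dirac]
  have hadmissible : MeasurableSet {x : ℝ | IsAdmissible α s t x} :=
    (MeasurableSet.const (0 ≤ s)).inter ((MeasurableSet.const (s ≤ t)).inter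
      (measurableSet_le measurable_const (measurable_id.const_mul α |>.const_add 1)))
  rw [hintegral]
  exact Measurable.ite hadmissible (Polynomial.continuous _).measurable p.continuous.measurable

/-- The transition functions of the classical version. -/
noncomputable def transitionKernel (α s t : ℝ) : Kernel ℝ ℝ :=
  ⟨transitionMeasure α s t, measurable_transitionMeasure α s t⟩

lemma transitionKernel_apply (α s t x : ℝ) :
    transitionKernel α s t x = transitionMeasure α s t x :=
  rfl

instance (α s t : ℝ) : IsMarkovKernel (transitionKernel α s t) :=
  ⟨fun x => inferInstanceAs (IsProbabilityMeasure (transitionMeasure α s t x))⟩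

lemma integral_abs_le_one_add_integral_sq {Ω : Type*} [MeasurableSpace Ω] {μ : Measure Ω}
    [IsProbabilityMeasure μ] {f : Ω → ℝ} (hf : Integrable f μ)
    (hf2 : Integrable (fun ω => f ω ^ 2) μ) : ∫ ω, |f ω| ∂μ ≤ 1 + ∫ ω, f ω ^ 2 ∂μ :=
  calc ∫ ω, |f ω| ∂μ ≤ ∫ ω, (1 + f ω ^ 2) ∂μ :=
        integral_mono hf.abs ((integrable_const 1).add hf2) fun ω => by
          dsimp only
          nlinarith [sq_nonneg (|f ω| - 1), sq_abs (f ω), abs_nonneg (f ω)]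
    _ = 1 + ∫ ω, f ω ^ 2 ∂μ := by
      rw [integral_add (integrable_const 1) hf2]
      simp

lemma integrable_eval_transitionKernel_comp (h : IsAdmissible α r s x) (hst : s ≤ t)
    (p : Polynomial ℝ) :
    Integrable (fun y => p.eval y) ((transitionKernel α s t ∘ₖ transitionKernel α r s) x) := by
  have hb := hasBoundedSupport_transitionMeasure α
  refine (integrable_comp_iff p.continuous.aestronglyMeasurable).2
    ⟨Eventually.of_forall fun y => (hb s t y).integrable p.continuous, ?_⟩
  have hmeas : StronglyMeasurable fun y => ∫ z, ‖p.eval z‖ ∂transitionKernel α s t y :=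
    p.continuous.stronglyMeasurable.norm.integral_kernel
  have hbound : Integrable (fun y => 1 + (transitionOp α s t (p ^ 2)).eval y)
      (transitionMeasure α r s x) := (hb r s x).integrable (by fun_prop)
  refine hbound.mono' hmeas.aestronglyMeasurable ?_
  filter_upwards [h.ae_integral_eval_transitionMeasure hst (p ^ 2)] with y hy
  rw [Real.norm_of_nonneg (integral_nonneg fun _ => norm_nonneg _), ← hy]
  simp only [Polynomial.eval_pow]
  exact integral_abs_le_one_add_integral_sq ((hb s t y).integrable p.continuous)
    ((hb s t y).integrable (by fun_prop))

lemma transitionKernel_comp (hr : 0 ≤ r) (hrs : r ≤ s) (hst : s ≤ t) :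
    transitionKernel α s t ∘ₖ transitionKernel α r s = transitionKernel α r t := by
  ext1 x
  by_cases hx : 0 ≤ 1 + α * x
  · have hrs' : IsAdmissible α r s x := ⟨hr, hrs, hx⟩
    have hrt' : IsAdmissible α r t x := ⟨hr, hrs.trans hst, hx⟩
    have hint := integrable_eval_transitionKernel_comp hrs' hst
    have heq (p : Polynomial ℝ) :
        ∫ y, p.eval y ∂((transitionKernel α s t ∘ₖ transitionKernel α r s) x) =
          ∫ y, p.eval y ∂(transitionKernel α r t x) := by
      simp only [Kernel.integral_comp (hint p), transitionKernel_apply]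
      rw [integral_congr_ae (hrs'.ae_integral_eval_transitionMeasure hst p),
        hrs'.integral_eval_transitionMeasure, hrt'.integral_eval_transitionMeasure,
        transitionOp_comp]
    have hb : HasBoundedSupport (transitionKernel α r t x) :=
      hasBoundedSupport_transitionMeasure α r t x
    exact (hb.of_integral_eval_eq hint heq).eq_of_integral_eval_eq hb heq
  · have hdirac (r s : ℝ) : transitionKernel α r s x = Measure.dirac x :=
      transitionMeasure_of_not_isAdmissible fun h => hx h.2.2
    rw [Kernel.comp_apply, hdirac, hdirac, Measure.dirac_bind (Kernel.measurable _), hdirac]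

/-! ### Integrals along paths -/

section Paths

variable {K : ℝ → ℝ → Kernel ℝ ℝ}

lemma isMarkovKernel_pathKernel (hK : ∀ s t, IsMarkovKernel (K s t)) (n : ℕ) (s : ℝ)
    (τ : Fin n → ℝ) : IsMarkovKernel (pathKernel K n s τ) := by
  induction n generalizing s with
  | zero =>
    rw [pathKernel]
    infer_instance
  | succ n ih =>
    have := hK s (τ 0)
    have := ih (τ 0) (Fin.tail τ)
    rw [pathKernel]
    exact Kernel.IsMarkovKernel.map _ (by fun_prop)

lemma pathKernel_zero_apply (s x : ℝ) (τ : Fin 0 → ℝ) :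
    pathKernel K 0 s τ x = Measure.dirac Fin.elim0 := by
  rw [pathKernel, Kernel.const_apply]

lemma measurable_fin_cons (n : ℕ) :
    Measurable fun p : ℝ × (Fin n → ℝ) => (Fin.cons p.1 p.2 : Fin (n + 1) → ℝ) := by
  fun_prop

lemma integrable_pathKernel_succ (hK : ∀ s t, IsMarkovKernel (K s t)) {n : ℕ}
    {τ : Fin (n + 1) → ℝ} {g : (Fin (n + 1) → ℝ) → ℝ} (hg : Continuous g) :
    Integrable g (pathKernel K (n + 1) s τ x) ↔
      (∀ᵐ y ∂K s (τ 0) x, Integrable (fun z : Fin n → ℝ => g (Fin.cons y z))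
        (pathKernel K n (τ 0) (Fin.tail τ) y)) ∧
      Integrable (fun y => ∫ z, ‖g (Fin.cons y z)‖ ∂pathKernel K n (τ 0) (Fin.tail τ) y)
        (K s (τ 0) x) := by
  have := hK s (τ 0)
  have := isMarkovKernel_pathKernel hK n (τ 0) (Fin.tail τ)
  rw [pathKernel, Kernel.map_apply _ (measurable_fin_cons n),
    integrable_map_measure hg.aestronglyMeasurable (measurable_fin_cons n).aemeasurable,
    integrable_compProd_iff (hg.measurable.comp (measurable_fin_cons n)).aestronglyMeasurable]
  rfl

lemma integral_pathKernel_succ (hK : ∀ s t, IsMarkovKernel (K s t)) {n : ℕ}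
    {τ : Fin (n + 1) → ℝ} {g : (Fin (n + 1) → ℝ) → ℝ} (hg : Continuous g)
    (hint : Integrable g (pathKernel K (n + 1) s τ x)) :
    ∫ z, g z ∂pathKernel K (n + 1) s τ x =
      ∫ y, ∫ z, g (Fin.cons y z) ∂pathKernel K n (τ 0) (Fin.tail τ) y ∂K s (τ 0) x := by
  have := hK s (τ 0)
  have := isMarkovKernel_pathKernel hK n (τ 0) (Fin.tail τ)
  rw [pathKernel, Kernel.map_apply _ (measurable_fin_cons n)] at hint ⊢
  rw [integral_map (measurable_fin_cons n).aemeasurable hg.aestronglyMeasurable]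
  exact integral_compProd ((integrable_map_measure hg.aestronglyMeasurable
    (measurable_fin_cons n).aemeasurable).1 hint)

lemma prod_cons_pow {n : ℕ} (y : ℝ) (z : Fin n → ℝ) (k : Fin (n + 1) → ℕ) :
    ∏ i, (Fin.cons y z : Fin (n + 1) → ℝ) i ^ k i = y ^ k 0 * ∏ i, z i ^ Fin.tail k i := by
  rw [Fin.prod_univ_succ]
  simp [Fin.tail]

end Paths

/-- The mixed moments `E[Z(τ 0) ^ k 0 ⋯ | Z(s)]` of the classical version, as polynomials in the
position at time `s`. -/
noncomputable def pathPoly (α : ℝ) : (n : ℕ) → ℝ → (Fin n → ℝ) → (Fin n → ℕ) → Polynomial ℝ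
  | 0, _, _, _ => 1
  | n + 1, s, τ, k =>
    transitionOp α s (τ 0) (Polynomial.X ^ k 0 * pathPoly α n (τ 0) (Fin.tail τ) (Fin.tail k))

/-- The paths of the classical version started at time `s` from `x` have the mixed moments given by
`pathPoly`. -/
def HasPathMoments (α : ℝ) (n : ℕ) (s : ℝ) (τ : Fin n → ℝ) (x : ℝ) : Prop :=
  ∀ k : Fin n → ℕ,
    Integrable (fun z => ∏ i, z i ^ k i) (pathKernel (transitionKernel α) n s τ x) ∧
      ∫ z, ∏ i, z i ^ k i ∂pathKernel (transitionKernel α) n s τ x = (pathPoly α n s τ k).eval x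

lemma HasPathMoments.integral_abs_le {n : ℕ} {τ : Fin n → ℝ} (h : HasPathMoments α n s τ x)
    (k : Fin n → ℕ) :
    ∫ z, |∏ i, z i ^ k i| ∂pathKernel (transitionKernel α) n s τ x ≤
      1 + (pathPoly α n s τ fun i => k i * 2).eval x := by
  have := isMarkovKernel_pathKernel (K := transitionKernel α) (fun _ _ => inferInstance) n s τ
  obtain ⟨hint, heq⟩ := h fun i => k i * 2
  rw [← heq]
  simp only [pow_mul, Finset.prod_pow] at hint ⊢
  exact integral_abs_le_one_add_integral_sq (h k).1 hint

lemma integrable_pathKernel_succ_of_hasPathMoments {n : ℕ} {τ : Fin (n + 1) → ℝ}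
    (hτ : ∀ᵐ y ∂transitionMeasure α s (τ 0) x, HasPathMoments α n (τ 0) (Fin.tail τ) y)
    (k : Fin (n + 1) → ℕ) :
    Integrable (fun z => ∏ i, z i ^ k i) (pathKernel (transitionKernel α) (n + 1) s τ x) := by
  have hK : ∀ s t, IsMarkovKernel (transitionKernel α s t) := fun _ _ => inferInstance
  have := isMarkovKernel_pathKernel hK n (τ 0) (Fin.tail τ)
  refine (integrable_pathKernel_succ hK (by fun_prop)).2 ⟨?_, ?_⟩ <;> simp only [prod_cons_pow]
  · exact hτ.mono fun y hy => (hy (Fin.tail k)).1.const_mul _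
  have hmeas : StronglyMeasurable fun y => ∫ z : Fin n → ℝ,
      ‖y ^ k 0 * ∏ i, z i ^ Fin.tail k i‖
        ∂pathKernel (transitionKernel α) n (τ 0) (Fin.tail τ) y :=
    StronglyMeasurable.integral_kernel_prod_right'
      (f := fun p : ℝ × (Fin n → ℝ) => ‖p.1 ^ k 0 * ∏ i, p.2 i ^ Fin.tail k i‖)
      (Continuous.stronglyMeasurable (by fun_prop))
  have hbound : Integrable (fun y => |y ^ k 0| *
      (1 + (pathPoly α n (τ 0) (Fin.tail τ) fun i => Fin.tail k i * 2).eval y))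
      (transitionMeasure α s (τ 0) x) :=
    (hasBoundedSupport_transitionMeasure α s (τ 0) x).integrable (by fun_prop)
  refine hbound.mono' hmeas.aestronglyMeasurable (hτ.mono fun y hy => ?_)
  rw [Real.norm_of_nonneg (integral_nonneg fun _ => norm_nonneg _)]
  simp only [norm_mul, Real.norm_eq_abs]
  rw [integral_const_mul]
  exact mul_le_mul_of_nonneg_left (hy.integral_abs_le _) (abs_nonneg _)

lemma hasPathMoments_succ {n : ℕ} {τ : Fin (n + 1) → ℝ} (h : IsAdmissible α s (τ 0) x)
    (hτ : ∀ᵐ y ∂transitionMeasure α s (τ 0) x, HasPathMoments α n (τ 0) (Fin.tail τ) y) :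
    HasPathMoments α (n + 1) s τ x := by
  intro k
  have hint := integrable_pathKernel_succ_of_hasPathMoments hτ k
  refine ⟨hint, ?_⟩
  rw [integral_pathKernel_succ (fun _ _ => inferInstance) (by fun_prop) hint, pathPoly,
    ← h.integral_eval_transitionMeasure]
  refine integral_congr_ae (hτ.mono fun y hy => ?_)
  simp only [prod_cons_pow, Polynomial.eval_mul, Polynomial.eval_pow, Polynomial.eval_X]
  rw [integral_const_mul, (hy (Fin.tail k)).2]

lemma hasPathMoments {n : ℕ} {τ : Fin n → ℝ} (hs : 0 ≤ s) (hτ : Monotone τ)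
    (hsτ : ∀ i, s ≤ τ i) (hx : 0 ≤ 1 + α * x) : HasPathMoments α n s τ x := by
  induction n generalizing s x with
  | zero =>
    intro k
    rw [pathKernel_zero_apply]
    simp [pathPoly]
  | succ n ih =>
    have hadm : IsAdmissible α s (τ 0) x := ⟨hs, hsτ 0, hx⟩
    exact hasPathMoments_succ hadm (hadm.transitionMeasure_spec.2.2.1.mono fun y hy =>
      ih (hs.trans (hsτ 0)) (hτ.comp (Fin.strictMono_succ).monotone)
        (fun _ => hτ (Fin.zero_le _)) hy)

/-! ### Distributions and the classical version -/

lemma linearMap_ext_semicirclePoly {M : Type*} [AddCommGroup M] [Module ℝ M] (a b : ℝ)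
    {f g : Polynomial ℝ →ₗ[ℝ] M}
    (h : ∀ n, f (semicirclePoly a b n) = g (semicirclePoly a b n)) : f = g :=
  linearMap_ext_martingalePoly a b fun n => by
    cases n with
    | zero => exact h 0
    | succ n =>
      rw [martingalePoly_succ, ← Polynomial.smul_eq_C_mul]
      simp only [map_add, map_smul, h]

lemma transitionOp_self (α t : ℝ) : transitionOp α t t = LinearMap.id :=
  linearMap_ext_martingalePoly (α * t) t (transitionOp_martingalePoly α t t)

section Version

variable {A : Type*} [Ring A] [Algebra ℂ A] {φ ψ χ : A →ₗ[ℂ] ℂ} {T : ℝ} {X : ℝ → A}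

lemma map_aeval_zero (hχ : χ 1 = 1) (p : Polynomial ℝ) :
    χ (Polynomial.aeval (0 : A) p) = ((p.eval 0 : ℝ) : ℂ) := by
  rw [← map_zero (algebraMap ℝ A), Polynomial.aeval_algebraMap_apply, Polynomial.coe_aeval_eq_eval,
    ← mul_one (algebraMap ℝ A _), map_algebraMap_real_mul, hχ, mul_one]

/-- The distribution of `a` with respect to `χ`, as a functional `p ↦ χ (p(a))` on real
polynomials. -/
noncomputable def polynomialFunctional (χ : A →ₗ[ℂ] ℂ) (a : A) : Polynomial ℝ →ₗ[ℝ] ℂ :=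
  χ.restrictScalars ℝ ∘ₗ (Polynomial.aeval a).toLinearMap

lemma polynomialFunctional_apply (χ : A →ₗ[ℂ] ℂ) (a : A) (p : Polynomial ℝ) :
    polynomialFunctional χ a p = χ (Polynomial.aeval a p) :=
  rfl

lemma HasBoundedSupport.isDistribution {a : A} {μ : Measure ℝ} [IsProbabilityMeasure μ]
    (hμ : HasBoundedSupport μ)
    (h : ∀ p : Polynomial ℝ, ((∫ x, p.eval x ∂μ : ℝ) : ℂ) = χ (Polynomial.aeval a p)) :
    IsDistribution χ a μ where
  prob := inferInstance
  integrable n := hμ.integrable (continuous_pow n)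
  moment n := by simpa using h (Polynomial.X ^ n)

lemma IsDistribution.integrable_eval {a : A} {μ : Measure ℝ} (h : IsDistribution χ a μ)
    (p : Polynomial ℝ) : Integrable (fun x => p.eval x) μ :=
  integrable_eval_of_integrable_pow h.integrable p

lemma IsDistribution.integral_eval {a : A} {μ : Measure ℝ} (h : IsDistribution χ a μ)
    (p : Polynomial ℝ) : ((∫ x, p.eval x ∂μ : ℝ) : ℂ) = χ (Polynomial.aeval a p) := by
  rw [integral_eval_eq_sum_range h.integrable, Polynomial.aeval_eq_sum_range, map_sum]
  push_cast
  simp only [Algebra.smul_def, map_algebraMap_real_mul, h.moment]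

lemma IsDistribution.hasBoundedSupport {a : A} {μ μ' : Measure ℝ} (h : IsDistribution χ a μ)
    (h' : IsDistribution χ a μ') (hμ' : HasBoundedSupport μ') : HasBoundedSupport μ := by
  have := h.prob
  have := h'.prob
  exact hμ'.of_integral_eval_eq h.integrable_eval fun p => by
    exact_mod_cast (h.integral_eval p).trans (h'.integral_eval p).symm

variable [StarRing A]

lemma IsTwoStateFBM.phi_aeval (hX : IsTwoStateFBM φ ψ α T X) (hT : 0 < T) (hψ_one : ψ 1 = 1)
    (hφ_one : φ 1 = 1) (ht : t ∈ Set.Icc 0 T) (p : Polynomial ℝ) :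
    φ (Polynomial.aeval (X t) p) = (((transitionOp α 0 t p).eval 0 : ℝ) : ℂ) := by
  rcases ht.1.eq_or_lt with rfl | ht0
  · rw [transitionOp_self, hX.zero, map_aeval_zero hφ_one, LinearMap.id_apply]
  · simpa only [one_mul, hX.zero, map_aeval_zero hφ_one] using
      hX.phi_mul_aeval_eq_transitionOp hT hψ_one hφ_one le_rfl ht0 ht.2
        (one_mem (pastAlgebra X 0)) p

lemma IsTwoStateFBM.isDistribution_transitionMeasure (hX : IsTwoStateFBM φ ψ α T X) (hT : 0 < T)
    (hψ_one : ψ 1 = 1) (hφ_one : φ 1 = 1) (ht : t ∈ Set.Icc 0 T) :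
    IsDistribution φ (X t) (transitionMeasure α 0 t 0) :=
  (hasBoundedSupport_transitionMeasure α 0 t 0).isDistribution fun p => by
    rw [IsAdmissible.integral_eval_transitionMeasure ⟨le_rfl, ht.1, by simp⟩,
      hX.phi_aeval hT hψ_one hφ_one ht]

lemma IsTwoStateFBM.exists_isDistribution_psi (hX : IsTwoStateFBM φ ψ α T X) (hT : 0 < T)
    (hψ_one : ψ 1 = 1) (ht : t ∈ Set.Icc 0 T) : ∃ ν : Measure ℝ, IsDistribution ψ (X t) ν := by
  obtain ⟨ν, hν, hνb, hsemicircle⟩ := exists_semicircle_probability (α * t) ht.1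
  have hpow (n : ℕ) : Integrable (fun y : ℝ => y ^ n) ν := hνb.integrable (continuous_pow n)
  have hfun : Complex.ofRealCLM.toLinearMap ∘ₗ integralFunctional hpow =
      polynomialFunctional ψ (X t) :=
    linearMap_ext_semicirclePoly (α * t) t fun n => by
      cases n with
      | zero => simp [semicirclePoly, integralFunctional, polynomialFunctional_apply, hψ_one]
      | succ n =>
        rw [polynomialFunctional_apply, hX.psi_semicirclePoly_eq_zero hT hψ_one n.succ_pos ht]
        simp [integralFunctional, hsemicircle (n + 1) n.succ_pos]
  exact ⟨ν, hνb.isDistribution fun p => LinearMap.congr_fun hfun p⟩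

lemma IsTwoStateFBM.phi_mul_prod_pow (hX : IsTwoStateFBM φ ψ α T X) (hT : 0 < T)
    (hψ_one : ψ 1 = 1) (hφ_one : φ 1 = 1) {n : ℕ} {τ : Fin n → ℝ} (hs : 0 ≤ s)
    (hτ : StrictMono τ) (hsτ : ∀ i, s < τ i) (hτT : ∀ i, τ i ≤ T) (k : Fin n → ℕ) {w : A}
    (hw : w ∈ pastAlgebra X s) :
    φ (w * (List.ofFn fun i => X (τ i) ^ k i).prod) =
      φ (w * Polynomial.aeval (X s) (pathPoly α n s τ k)) := by
  induction n generalizing s w with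
  | zero => simp [pathPoly]
  | succ n ih =>
    have hτ0 : 0 ≤ τ 0 := hs.trans (hsτ 0).le
    have hw' : w * X (τ 0) ^ k 0 ∈ pastAlgebra X (τ 0) :=
      mul_mem (pastAlgebra_mono X (hsτ 0).le hw) (pow_mem (mem_pastAlgebra X hτ0 le_rfl) _)
    rw [List.ofFn_succ, List.prod_cons, ← mul_assoc, pathPoly,
      ← hX.phi_mul_aeval_eq_transitionOp hT hψ_one hφ_one hs (hsτ 0) (hτT 0) hw,
      map_mul (Polynomial.aeval (X (τ 0))), map_pow, Polynomial.aeval_X, ← mul_assoc]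
    exact ih (τ := Fin.tail τ) hτ0 (hτ.comp Fin.strictMono_succ)
      (fun i => hτ (Fin.succ_pos i)) (fun i => hτT i.succ) (Fin.tail k) hw'

lemma IsTwoStateFBM.isClassicalMarkovVersion_transitionKernel (hX : IsTwoStateFBM φ ψ α T X)
    (hT : 0 < T) (hψ_one : ψ 1 = 1) (hφ_one : φ 1 = 1) :
    IsClassicalMarkovVersion φ T X (transitionKernel α) where
  markov s t := inferInstance
  chapman_kolmogorov r s t hr hrs hst _ := transitionKernel_comp hr hrs.le hst.le
  integrable n τ k hτ hτT :=
    (hasPathMoments le_rfl hτ.monotone (fun i => (hτT i).1.le) (by simp) k).1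
  moment n τ k hτ hτT := by
    rw [(hasPathMoments (α := α) le_rfl hτ.monotone (fun i => (hτT i).1.le) (by simp) k).2]
    have hpath := hX.phi_mul_prod_pow hT hψ_one hφ_one le_rfl hτ (fun i => (hτT i).1)
      (fun i => (hτT i).2) k (one_mem (pastAlgebra X 0))
    simp only [one_mul, hX.zero, map_aeval_zero hφ_one] at hpath
    exact hpath.symm

end Version

end TransitionFunctions

/-! ### The transition functions of an arbitrary classical version -/

section Paths

variable {K : ℝ → ℝ → Kernel ℝ ℝ} {s t u x : ℝ}

lemma pathKernel_one (hK : ∀ s t, IsMarkovKernel (K s t)) (s : ℝ) (τ : Fin 1 → ℝ) :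
    pathKernel K 1 s τ = (K s (τ 0)).map fun y _ => y := by
  have := hK s (τ 0)
  have hcons : Measurable fun p : ℝ × (Fin 0 → ℝ) => (Fin.cons p.1 p.2 : Fin 1 → ℝ) :=
    measurable_fin_cons 0
  have hconst : Measurable fun (y : ℝ) (_ : Fin 1) => y := by fun_prop
  ext x S hS
  rw [pathKernel, pathKernel, Kernel.map_apply' _ hcons _ hS, Kernel.map_apply' _ hconst _ hS,
    Kernel.compProd_apply (hcons hS), ← lintegral_indicator_one (hconst hS)]
  refine lintegral_congr fun y => ?_
  have hcons_elim0 : (Fin.cons y (Fin.elim0 : Fin 0 → ℝ) : Fin 1 → ℝ) = fun _ => y := by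
    ext i
    fin_cases i
    rfl
  rw [Kernel.prodMkLeft_apply, Kernel.const_apply,
    Measure.dirac_apply' _ (measurable_prodMk_left (hcons hS))]
  change S.indicator 1 (Fin.cons y Fin.elim0) = S.indicator 1 fun _ => y
  rw [hcons_elim0]

lemma integrable_pathKernel_one (hK : ∀ s t, IsMarkovKernel (K s t)) {τ : Fin 1 → ℝ}
    {f : ℝ → ℝ} (hf : Continuous f) :
    Integrable (fun z => f (z 0)) (pathKernel K 1 s τ x) ↔ Integrable f (K s (τ 0) x) := by
  have hconst : Measurable fun (y : ℝ) (_ : Fin 1) => y := by fun_prop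
  rw [pathKernel_one hK, Kernel.map_apply _ hconst, integrable_map_measure
    (Continuous.aestronglyMeasurable (by fun_prop)) hconst.aemeasurable]
  rfl

lemma integral_pathKernel_one (hK : ∀ s t, IsMarkovKernel (K s t)) {τ : Fin 1 → ℝ}
    {f : ℝ → ℝ} (hf : Continuous f) :
    ∫ z, f (z 0) ∂pathKernel K 1 s τ x = ∫ y, f y ∂K s (τ 0) x := by
  have hconst : Measurable fun (y : ℝ) (_ : Fin 1) => y := by fun_prop
  rw [pathKernel_one hK, Kernel.map_apply _ hconst, integral_map hconst.aemeasurable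
    (Continuous.aestronglyMeasurable (by fun_prop))]

lemma integrable_pathKernel_two (hK : ∀ s t, IsMarkovKernel (K s t)) {g : ℝ → ℝ → ℝ}
    (hg : Continuous fun z : ℝ × ℝ => g z.1 z.2) :
    Integrable (fun z => g (z 0) (z 1)) (pathKernel K 2 s ![t, u] x) ↔
      (∀ᵐ y ∂K s t x, Integrable (g y) (K t u y)) ∧
      Integrable (fun y => ∫ z, ‖g y z‖ ∂K t u y) (K s t x) := by
  have hgy (y : ℝ) : Continuous (g y) := hg.comp (Continuous.prodMk_right y)
  have hg_path : Continuous fun z : Fin 2 → ℝ => g (z 0) (z 1) :=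
    hg.comp₂ (continuous_apply 0) (continuous_apply 1)
  rw [integrable_pathKernel_succ hK hg_path]
  exact and_congr
    (eventually_congr (Eventually.of_forall fun y => integrable_pathKernel_one hK (hgy y)))
    (integrable_congr (Eventually.of_forall fun y => integral_pathKernel_one hK (hgy y).norm))

lemma integral_pathKernel_two (hK : ∀ s t, IsMarkovKernel (K s t)) {g : ℝ → ℝ → ℝ}
    (hg : Continuous fun z : ℝ × ℝ => g z.1 z.2)
    (hint : Integrable (fun z => g (z 0) (z 1)) (pathKernel K 2 s ![t, u] x)) :
    ∫ z, g (z 0) (z 1) ∂pathKernel K 2 s ![t, u] x = ∫ y, ∫ z, g y z ∂K t u y ∂K s t x := by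
  have hg_path : Continuous fun z : Fin 2 → ℝ => g (z 0) (z 1) :=
    hg.comp₂ (continuous_apply 0) (continuous_apply 1)
  rw [integral_pathKernel_succ hK hg_path hint]
  exact integral_congr_ae (Eventually.of_forall fun y =>
    integral_pathKernel_one hK (hg.comp (Continuous.prodMk_right y)))

end Paths

section ArbitraryVersion

variable {A : Type*} [Ring A] [Algebra ℂ A] {φ ψ : A →ₗ[ℂ] ℂ} {α T t u : ℝ} {X : ℝ → A}
  {K : ℝ → ℝ → Kernel ℝ ℝ}

lemma IsClassicalMarkovVersion.isDistribution (hK : IsClassicalMarkovVersion φ T X K)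
    (ht : t ∈ Set.Ioc 0 T) : IsDistribution φ (X t) (K 0 t 0) where
  prob := (hK.markov 0 t).isProbabilityMeasure 0
  integrable n := by
    have hint := hK.integrable 1 ![t] ![n] (Subsingleton.strictMono _) (by simpa using ht)
    simp only [Fin.prod_univ_one] at hint
    exact (integrable_pathKernel_one hK.markov (continuous_pow n)).1 hint
  moment n := by
    have hmoment := hK.moment 1 ![t] ![n] (Subsingleton.strictMono _) (by simpa using ht)
    simp only [Fin.prod_univ_one] at hmoment
    have hint := integral_pathKernel_one hK.markov (s := 0) (x := 0) (τ := ![t])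
      (continuous_pow n)
    simpa using (congrArg Complex.ofReal hint).symm.trans hmoment

section TwoTimes

variable (hK : IsClassicalMarkovVersion φ T X K) (ht : 0 < t) (htu : t < u) (hu : u ≤ T)

include hK ht htu hu

lemma IsClassicalMarkovVersion.moments_pathKernel_two (i j : ℕ) :
    Integrable (fun z => z 0 ^ i * z 1 ^ j) (pathKernel K 2 0 ![t, u] 0) ∧
      ((∫ z, z 0 ^ i * z 1 ^ j ∂pathKernel K 2 0 ![t, u] 0 : ℝ) : ℂ) =
        φ (X t ^ i * X u ^ j) := by
  have hmono : StrictMono ![t, u] := by simpa using htu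
  have hmem (a : Fin 2) : ![t, u] a ∈ Set.Ioc 0 T := by
    fin_cases a
    exacts [⟨ht, (htu.trans_le hu).le⟩, ⟨ht.trans htu, hu⟩]
  exact ⟨by simpa using hK.integrable 2 ![t, u] ![i, j] hmono hmem,
    by simpa using hK.moment 2 ![t, u] ![i, j] hmono hmem⟩

lemma IsClassicalMarkovVersion.ae_integrable_pow (j : ℕ) :
    ∀ᵐ y ∂K 0 t 0, Integrable (fun z => z ^ j) (K t u y) := by
  have hint := (hK.moments_pathKernel_two ht htu hu 0 j).1
  simp only [pow_zero, one_mul] at hint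
  exact ((integrable_pathKernel_two hK.markov (g := fun _ z => z ^ j) (by fun_prop)).1 hint).1

lemma IsClassicalMarkovVersion.integrable_pow_mul_integral_pow (i j : ℕ) :
    Integrable (fun y => y ^ i * ∫ z, z ^ j ∂K t u y) (K 0 t 0) := by
  have := hK.markov t u
  have hmeas : StronglyMeasurable fun y => ∫ z, z ^ j ∂K t u y :=
    StronglyMeasurable.integral_kernel (by fun_prop)
  refine ((integrable_pathKernel_two hK.markov (g := fun y z => y ^ i * z ^ j) (by fun_prop)).1
    (hK.moments_pathKernel_two ht htu hu i j).1).2.mono'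
      ((continuous_pow i).aestronglyMeasurable.mul hmeas.aestronglyMeasurable)
      (Eventually.of_forall fun y => ?_)
  rw [← integral_const_mul]
  exact norm_integral_le_integral_norm _

lemma IsClassicalMarkovVersion.integral_pow_mul_integral_pow (i j : ℕ) :
    ((∫ y, y ^ i * ∫ z, z ^ j ∂K t u y ∂K 0 t 0 : ℝ) : ℂ) = φ (X t ^ i * X u ^ j) := by
  obtain ⟨hint, hmoment⟩ := hK.moments_pathKernel_two ht htu hu i j
  rw [← hmoment, integral_pathKernel_two hK.markov (g := fun y z => y ^ i * z ^ j)
    (by fun_prop) hint]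
  simp only [integral_const_mul]

end TwoTimes

lemma IsDistribution.eq_of_hasBoundedSupport {a : A} {μ μ' : Measure ℝ}
    (h : IsDistribution φ a μ) (h' : IsDistribution φ a μ') (hμ : HasBoundedSupport μ) :
    μ = μ' := by
  have := h.prob
  have := h'.prob
  exact hμ.eq_of_integral_eval_eq (h'.hasBoundedSupport h hμ) fun p => by
    exact_mod_cast (h.integral_eval p).trans (h'.integral_eval p).symm

variable [StarRing A] {μ : Measure ℝ}

lemma IsTwoStateFBM.hasBoundedSupport_of_isDistribution (hX : IsTwoStateFBM φ ψ α T X)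
    (hT : 0 < T) (hψ_one : ψ 1 = 1) (hφ_one : φ 1 = 1) (ht : t ∈ Set.Icc 0 T)
    (hμ : IsDistribution φ (X t) μ) : HasBoundedSupport μ :=
  hμ.hasBoundedSupport (hX.isDistribution_transitionMeasure hT hψ_one hφ_one ht)
    (hasBoundedSupport_transitionMeasure α 0 t 0)

lemma IsTwoStateFBM.eq_dirac_of_isDistribution_zero (hX : IsTwoStateFBM φ ψ α T X)
    (hφ_one : φ 1 = 1) (hμ : IsDistribution φ (X 0) μ) : μ = Measure.dirac 0 := by
  have hdirac : IsDistribution φ (X 0) (Measure.dirac 0) :=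
    (hasBoundedSupport_dirac 0).isDistribution fun p => by
      rw [integral_dirac, hX.zero, map_aeval_zero hφ_one]
  exact (hdirac.eq_of_hasBoundedSupport hμ (hasBoundedSupport_dirac 0)).symm

lemma IsTwoStateFBM.ae_integral_pow_of_pos (hX : IsTwoStateFBM φ ψ α T X) (hT : 0 < T)
    (hψ_one : ψ 1 = 1) (hφ_one : φ 1 = 1) (hK : IsClassicalMarkovVersion φ T X K)
    (ht : 0 < t) (htu : t < u) (hu : u ≤ T) (j : ℕ) : ∀ᵐ y ∂K 0 t 0,
      ∫ z, z ^ j ∂K t u y = (transitionOp α t u (Polynomial.X ^ j)).eval y := by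
  have := hK.markov 0 t
  have hμ := hK.isDistribution ⟨ht, htu.le.trans hu⟩
  have hμb := hX.hasBoundedSupport_of_isDistribution hT hψ_one hφ_one
    ⟨ht.le, htu.le.trans hu⟩ hμ
  set q := transitionOp α t u (Polynomial.X ^ j)
  have hint (i : ℕ) := hK.integrable_pow_mul_integral_pow ht htu hu i j
  have hint_q (i : ℕ) : Integrable (fun y => y ^ i * q.eval y) (K 0 t 0) :=
    hμb.integrable (by fun_prop)
  have hmoment (i : ℕ) :
      ∫ y, y ^ i * ∫ z, z ^ j ∂K t u y ∂K 0 t 0 = ∫ y, y ^ i * q.eval y ∂K 0 t 0 := by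
    have hpast : X t ^ i ∈ pastAlgebra X t := pow_mem (mem_pastAlgebra X ht.le le_rfl) i
    have hproj := hX.phi_mul_aeval_eq_transitionOp hT hψ_one hφ_one ht.le htu hu hpast
      (Polynomial.X ^ j)
    have hq := hμ.integral_eval (Polynomial.X ^ i * q)
    simp only [map_pow, map_mul, Polynomial.aeval_X, Polynomial.eval_mul, Polynomial.eval_pow,
      Polynomial.eval_X] at hproj hq
    exact_mod_cast (hK.integral_pow_mul_integral_pow ht htu hu i j).trans (hproj.trans hq.symm)
  have hzero := hμb.ae_eq_zero_of_integral_pow_mul_eq_zero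
    (d := fun y => ∫ z, z ^ j ∂K t u y - q.eval y)
    (by simpa [Pi.sub_def] using (hint 0).sub (hint_q 0)) fun i => by
      simp only [mul_sub]
      rw [integral_sub (hint i) (hint_q i), hmoment, sub_self]
  exact hzero.mono fun y hy => sub_eq_zero.1 hy

lemma IsTwoStateFBM.ae_integral_pow (hX : IsTwoStateFBM φ ψ α T X) (hT : 0 < T)
    (hψ_one : ψ 1 = 1) (hφ_one : φ 1 = 1) (hK : IsClassicalMarkovVersion φ T X K)
    (ht : 0 ≤ t) (htu : t < u) (hu : u ≤ T) (hμ : IsDistribution φ (X t) μ) (j : ℕ) :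
    ∀ᵐ y ∂μ, Integrable (fun z => z ^ j) (K t u y) ∧
      ∫ z, z ^ j ∂K t u y = (transitionOp α t u (Polynomial.X ^ j)).eval y := by
  rcases ht.eq_or_lt with rfl | ht_pos
  · rw [hX.eq_dirac_of_isDistribution_zero hφ_one hμ, ae_dirac_eq, eventually_pure]
    have hμu := hK.isDistribution ⟨htu, hu⟩
    refine ⟨hμu.integrable j, Complex.ofReal_injective ?_⟩
    rw [hμu.moment, ← hX.phi_aeval hT hψ_one hφ_one ⟨htu.le, hu⟩, map_pow (Polynomial.aeval _),
      Polynomial.aeval_X]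
  · have hμt : μ = K 0 t 0 := hμ.eq_of_hasBoundedSupport
      (hK.isDistribution ⟨ht_pos, htu.le.trans hu⟩)
      (hX.hasBoundedSupport_of_isDistribution hT hψ_one hφ_one ⟨ht, htu.le.trans hu⟩ hμ)
    rw [hμt]
    exact (hK.ae_integrable_pow ht_pos htu hu j).and
      (hX.ae_integral_pow_of_pos hT hψ_one hφ_one hK ht_pos htu hu j)

lemma IsTwoStateFBM.ae_integral_eval (hX : IsTwoStateFBM φ ψ α T X) (hT : 0 < T)
    (hψ_one : ψ 1 = 1) (hφ_one : φ 1 = 1) (hK : IsClassicalMarkovVersion φ T X K)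
    (ht : 0 ≤ t) (htu : t < u) (hu : u ≤ T) (hμ : IsDistribution φ (X t) μ)
    (p : Polynomial ℝ) : ∀ᵐ y ∂μ, Integrable (fun z => p.eval z) (K t u y) ∧
      ∫ z, p.eval z ∂K t u y = (transitionOp α t u p).eval y := by
  filter_upwards [ae_all_iff.2 (hX.ae_integral_pow hT hψ_one hφ_one hK ht htu hu hμ)] with y hy
  have hint (n : ℕ) := (hy n).1
  refine ⟨integrable_eval_of_integrable_pow hint p, ?_⟩
  rw [integral_eval_eq_sum_range hint]
  conv_rhs => rw [p.as_sum_range_C_mul_X_pow]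
  simp only [map_sum, ← Polynomial.smul_eq_C_mul, map_smul, Polynomial.eval_finsetSum,
    Polynomial.eval_smul, smul_eq_mul, (hy _).2]

end ArbitraryVersion

/-! ### The generator on polynomials -/

section DifferenceQuotients

open Polynomial

variable {k : Type*} [CommRing k]

/-- `(p(X) - p(y)) / (X - y)` for `p = X ^ n`, with the functional `m` applied in the variable
`y`. -/
noncomputable def diffQuotPow (m : k[X] →ₗ[k] k) : ℕ → k[X]
  | 0 => 0
  | n + 1 => X * diffQuotPow m n + C (m (X ^ n))

/-- The polynomial `m_y[(p(X) - p(y)) / (X - y)]`, the algebraic counterpart of `diffQuot` for a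
functional `m` on polynomials in place of a measure. -/
noncomputable def diffQuotPoly (m : k[X] →ₗ[k] k) : k[X] →ₗ[k] k[X] :=
  (basisMonomials k).constr k (diffQuotPow m)

lemma diffQuotPoly_X_pow (m : k[X] →ₗ[k] k) (n : ℕ) :
    diffQuotPoly m (X ^ n) = diffQuotPow m n := by
  have hbasis : basisMonomials k n = X ^ n :=
    (congrFun (coe_basisMonomials k) n).trans (monomial_one_right_eq_X_pow n)
  rw [← hbasis, diffQuotPoly, Module.Basis.constr_basis]

lemma diffQuotPoly_C (m : k[X] →ₗ[k] k) (a : k) : diffQuotPoly m (C a) = 0 := by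
  rw [← mul_one (C a), ← smul_eq_C_mul, map_smul, ← pow_zero X, diffQuotPoly_X_pow, diffQuotPow,
    smul_zero]

lemma diffQuotPoly_X_mul (m : k[X] →ₗ[k] k) (p : k[X]) :
    diffQuotPoly m (X * p) = X * diffQuotPoly m p + C (m p) := by
  induction p using Polynomial.induction_on' with
  | add p q hp hq =>
    simp only [mul_add, map_add, hp, hq]
    ring
  | monomial n a =>
    rw [← C_mul_X_pow_eq_monomial, mul_left_comm, ← pow_succ', ← smul_eq_C_mul, ← smul_eq_C_mul,
      map_smul, map_smul, map_smul, diffQuotPoly_X_pow, diffQuotPoly_X_pow, diffQuotPow]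
    simp only [smul_eq_C_mul, smul_eq_mul, map_mul]
    ring

lemma diffQuotPoly_eq_semicirclePoly {m : k[X] →ₗ[k] k} (hm : m 1 = 1) {P : ℕ → k[X]} {a b c : k}
    (hP_zero : P 0 = 1) (hP_one : P 1 = X - C c)
    (hP : ∀ n, P (n + 2) = (X - C a) * P (n + 1) - C b * P n) (hmP : ∀ n, m (P (n + 1)) = 0)
    (n : ℕ) : diffQuotPoly m (P (n + 1)) = semicirclePoly a b n := by
  have hP_succ (n : ℕ) : diffQuotPoly m (P (n + 2)) =
      (X - C a) * diffQuotPoly m (P (n + 1)) - C b * diffQuotPoly m (P n) := by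
    rw [hP, sub_mul, map_sub, map_sub, diffQuotPoly_X_mul, hmP, ← smul_eq_C_mul, ← smul_eq_C_mul,
      map_smul, map_smul]
    simp only [smul_eq_C_mul, map_zero]
    ring
  have hone : diffQuotPoly m (P 1) = 1 := by
    rw [hP_one, map_sub, diffQuotPoly_C, ← mul_one X, diffQuotPoly_X_mul, ← C_1, diffQuotPoly_C,
      C_1, hm]
    simp
  induction n using Nat.twoStepInduction with
  | zero => rw [hone, semicirclePoly]
  | one => rw [hP_succ, hone, hP_zero, ← C_1, diffQuotPoly_C, semicirclePoly]; simp
  | more n ih0 ih1 => rw [hP_succ, ih1, ih0, semicirclePoly_add_two]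

lemma diffQuotPoly_semicirclePoly {m : k[X] →ₗ[k] k} (hm : m 1 = 1) {a b : k}
    (hmU : ∀ n, m (semicirclePoly a b (n + 1)) = 0) (n : ℕ) :
    diffQuotPoly m (semicirclePoly a b (n + 1)) = semicirclePoly a b n :=
  diffQuotPoly_eq_semicirclePoly hm (semicirclePoly.eq_1 a b) (semicirclePoly.eq_2 a b)
    (semicirclePoly_add_two a b) hmU n

lemma diffQuotPoly_martingalePoly {m : k[X] →ₗ[k] k} (hm : m 1 = 1) {a b : k}
    (hmQ : ∀ n, m (martingalePoly a b (n + 1)) = 0) (n : ℕ) :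
    diffQuotPoly m (martingalePoly a b (n + 1)) = semicirclePoly a b n :=
  diffQuotPoly_eq_semicirclePoly (c := 0) hm (martingalePoly.eq_1 a b)
    ((martingalePoly.eq_2 a b).trans (by simp)) (martingalePoly.eq_3 a b) hmQ n

/-- The operator `α (∂ - L_m) + ∂ L_m'` on polynomials, the algebraic counterpart of `genOp`. -/
noncomputable def generatorPoly (α : k) (m m' : k[X] →ₗ[k] k) : k[X] →ₗ[k] k[X] :=
  α • (derivative - diffQuotPoly m) + derivative ∘ₗ diffQuotPoly m'

lemma generatorPoly_one (α : k) (m m' : k[X] →ₗ[k] k) : generatorPoly α m m' 1 = 0 := by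
  have hone (m : k[X] →ₗ[k] k) : diffQuotPoly m 1 = 0 := by rw [← C_1, diffQuotPoly_C]
  simp [generatorPoly, hone]

lemma generatorPoly_martingalePoly_succ {α t : k} {m m' : k[X] →ₗ[k] k} (hm : m 1 = 1)
    (hm' : m' 1 = 1) (hmQ : ∀ n, m (martingalePoly (α * t) t (n + 1)) = 0)
    (hmU : ∀ n, m' (semicirclePoly (α * t) t (n + 1)) = 0) (n : ℕ) :
    generatorPoly α m m' (martingalePoly (α * t) t (n + 1)) =
      (1 + C α * X) * derivative (semicirclePoly (α * t) t n) := by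
  simp only [generatorPoly, LinearMap.add_apply, LinearMap.smul_apply, LinearMap.sub_apply,
    LinearMap.comp_apply, diffQuotPoly_martingalePoly hm hmQ]
  rw [martingalePoly_succ, ← smul_eq_C_mul, map_add, map_add, map_smul, map_smul,
    diffQuotPoly_semicirclePoly hm' hmU]
  cases n with
  | zero =>
    rw [semicirclePoly, ← C_1, diffQuotPoly_C]
    simp [semicirclePoly]
  | succ n =>
    rw [diffQuotPoly_semicirclePoly hm' hmU, semicirclePoly_add_two]
    simp only [derivative_sub, derivative_mul, derivative_X, derivative_C, smul_eq_C_mul, map_add,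
      map_mul, zero_mul, zero_add]
    ring

lemma polynomial_induction_X_mul {P : k[X] → Prop} (hC : ∀ a, P (C a))
    (hadd : ∀ p q, P p → P q → P (p + q)) (hX : ∀ p, P p → P (X * p)) (p : k[X]) : P p := by
  induction p using Polynomial.induction_on' with
  | add p q hp hq => exact hadd p q hp hq
  | monomial n a =>
    induction n with
    | zero => exact hC a
    | succ n ih =>
      rw [← X_mul_monomial]
      exact hX _ ih

lemma sub_mul_eval_diffQuotPoly_leval (x y : k) (p : k[X]) :
    (x - y) * (diffQuotPoly (leval y) p).eval x = p.eval x - p.eval y := by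
  induction p using polynomial_induction_X_mul with
  | hC a => simp [diffQuotPoly_C]
  | hadd p q hp hq =>
    simp only [map_add, eval_add, mul_add, hp, hq]
    ring
  | hX p hp =>
    simp only [diffQuotPoly_X_mul, eval_add, eval_mul, eval_X, eval_C, leval_apply]
    linear_combination x * hp

lemma eval_diffQuotPoly_leval_self (x : k) (p : k[X]) :
    (diffQuotPoly (leval x) p).eval x = (derivative p).eval x := by
  induction p using polynomial_induction_X_mul with
  | hC a => simp [diffQuotPoly_C]
  | hadd p q hp hq => simp only [map_add, eval_add, hp, hq]
  | hX p hp =>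
    simp only [diffQuotPoly_X_mul, derivative_mul, derivative_X, one_mul, eval_add, eval_mul,
      eval_X, eval_C, leval_apply, hp]
    ring

lemma dslope_eval (p : ℝ[X]) (x y : ℝ) :
    dslope (fun z => p.eval z) x y = (diffQuotPoly (leval y) p).eval x := by
  rcases eq_or_ne y x with rfl | hyx
  · rw [dslope_same, Polynomial.deriv, eval_diffQuotPoly_leval_self]
  · have hsub := sub_mul_eval_diffQuotPoly_leval x y p
    rw [dslope_of_ne _ hyx, slope_def_field, div_eq_iff (sub_ne_zero.2 hyx)]
    linear_combination hsub

variable {μ ν : Measure ℝ}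

lemma integrable_and_integral_diffQuotPoly_leval
    (hν : ∀ n : ℕ, Integrable (fun x : ℝ => x ^ n) ν) (x : ℝ) (p : ℝ[X]) :
    Integrable (fun y => (diffQuotPoly (leval y) p).eval x) ν ∧
      ∫ y, (diffQuotPoly (leval y) p).eval x ∂ν =
        (diffQuotPoly (integralFunctional hν) p).eval x := by
  induction p using polynomial_induction_X_mul with
  | hC a => simp [diffQuotPoly_C]
  | hadd p q hp hq =>
    simp only [map_add, eval_add]
    exact ⟨hp.1.add hq.1, by rw [integral_add hp.1 hq.1, hp.2, hq.2]⟩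
  | hX p hp =>
    simp only [diffQuotPoly_X_mul, eval_add, eval_mul, eval_X, eval_C, leval_apply]
    have hint := integrable_eval_of_integrable_pow hν p
    refine ⟨(hp.1.const_mul x).add hint, ?_⟩
    rw [integral_add (hp.1.const_mul x) hint, integral_const_mul, hp.2]
    rfl

lemma diffQuot_eval (hν : ∀ n : ℕ, Integrable (fun x : ℝ => x ^ n) ν) (p : ℝ[X]) :
    diffQuot ν (fun z => p.eval z) = fun x => (diffQuotPoly (integralFunctional hν) p).eval x := by
  funext x
  simp only [diffQuot, dslope_eval, (integrable_and_integral_diffQuotPoly_leval hν x p).2]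

lemma genOp_eval (α : ℝ) (hμ : ∀ n : ℕ, Integrable (fun x : ℝ => x ^ n) μ)
    (hν : ∀ n : ℕ, Integrable (fun x : ℝ => x ^ n) ν) (p : ℝ[X]) :
    genOp α μ ν (fun z => p.eval z) = fun x =>
      (generatorPoly α (integralFunctional hμ) (integralFunctional hν) p).eval x := by
  funext x
  simp [genOp, generatorPoly, diffQuot_eval hμ, diffQuot_eval hν, Polynomial.deriv]

end DifferenceQuotients

/-! ### Dependence on time -/

section MartingaleSums

open Polynomial

variable {k : Type*} [CommRing k]

/-- A combination of the martingale polynomials of time `s` whose coefficients are polynomials in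
time, evaluated at time `u`. The two times are kept apart because the transition operators act on
the first one only. -/
noncomputable def martingaleSum (α s u : k) (c : ℕ →₀ k[X]) : k[X] :=
  c.sum fun n q => q.eval u • martingalePoly (α * s) s n

lemma martingaleSum_add (α s u : k) (c d : ℕ →₀ k[X]) :
    martingaleSum α s u (c + d) = martingaleSum α s u c + martingaleSum α s u d :=
  Finsupp.sum_add_index' (by simp) fun n p q => by rw [eval_add, add_smul]

lemma martingaleSum_single (α s u : k) (n : ℕ) (q : k[X]) :
    martingaleSum α s u (Finsupp.single n q) = q.eval u • martingalePoly (α * s) s n :=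
  Finsupp.sum_single_index (by simp)

lemma exists_martingaleSum_X_mul (α : k) (c : ℕ →₀ k[X]) :
    ∃ d, ∀ u, martingaleSum α u u d = X * martingaleSum α u u c := by
  induction c using Finsupp.induction_linear with
  | zero => exact ⟨0, fun u => by simp [martingaleSum]⟩
  | add c c' hc hc' =>
    obtain ⟨d, hd⟩ := hc
    obtain ⟨d', hd'⟩ := hc'
    exact ⟨d + d', fun u => by rw [martingaleSum_add, martingaleSum_add, hd, hd', mul_add]⟩
  | single n q =>
    cases n with
    | zero => exact ⟨Finsupp.single 1 q, fun u => by simp [martingaleSum_single, martingalePoly]⟩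
    | succ n =>
      refine ⟨Finsupp.single (n + 2) q + (Finsupp.single (n + 1) (C α * X * q) +
        Finsupp.single n (X * q)), fun u => ?_⟩
      simp only [martingaleSum_add, martingaleSum_single, martingalePoly, eval_mul, eval_X, eval_C,
        smul_eq_C_mul, map_mul]
      ring

lemma exists_martingaleSum_eq (α : k) (p : k[X]) : ∃ c, ∀ u, martingaleSum α u u c = p := by
  induction p using polynomial_induction_X_mul with
  | hC a =>
    exact ⟨Finsupp.single 0 (C a), fun u => by
      simp [martingaleSum_single, martingalePoly, smul_eq_C_mul]⟩
  | hadd p q hp hq =>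
    obtain ⟨c, hc⟩ := hp
    obtain ⟨d, hd⟩ := hq
    exact ⟨c + d, fun u => by rw [martingaleSum_add, hc, hd]⟩
  | hX p hp =>
    obtain ⟨c, hc⟩ := hp
    obtain ⟨d, hd⟩ := exists_martingaleSum_X_mul α c
    exact ⟨d, fun u => by rw [hd, hc]⟩

lemma transitionOp_martingaleSum [IsDomain k] (α s t u : k) (c : ℕ →₀ k[X]) :
    transitionOp α s t (martingaleSum α t u c) = martingaleSum α s u c := by
  simp only [martingaleSum, map_finsuppSum, map_smul, transitionOp_martingalePoly]

lemma eval_martingaleSum (α s u x : k) (c : ℕ →₀ k[X]) :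
    (martingaleSum α s u c).eval x =
      ∑ n ∈ c.support, (c n).eval u * (martingalePoly (α * s) s n).eval x := by
  simp only [martingaleSum, Finsupp.sum, eval_finsetSum, eval_smul, smul_eq_mul]

lemma eval_martingaleSum_mapRange_derivative (α s u x : k) (c : ℕ →₀ k[X]) :
    (martingaleSum α s u (c.mapRange derivative derivative_zero)).eval x =
      ∑ n ∈ c.support, (derivative (c n)).eval u * (martingalePoly (α * s) s n).eval x := by
  rw [martingaleSum, Finsupp.sum_mapRange_index (by simp)]
  simp only [Finsupp.sum, eval_finsetSum, eval_smul, smul_eq_mul]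

end MartingaleSums

section TimeDerivatives

open Polynomial

variable {α t : ℝ}

lemma hasDerivAt_eval_martingalePoly_add_two {x d d' : ℝ} {n : ℕ}
    (hd : HasDerivAt (fun u => (martingalePoly (α * u) u n).eval x) d t)
    (hd' : HasDerivAt (fun u => (martingalePoly (α * u) u (n + 1)).eval x) d' t) :
    HasDerivAt (fun u => (martingalePoly (α * u) u (n + 2)).eval x)
      ((x - α * t) * d' - t * d - (1 + α * x) * (semicirclePoly (α * t) t n).eval x) t := by
  have hlinear : HasDerivAt (fun u : ℝ => x - α * u) (-α) t := by
    simpa using ((hasDerivAt_id t).const_mul α).const_sub x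
  rw [← eval_martingalePoly_add_mul_eval_succ]
  simp only [martingalePoly, eval_sub, eval_mul, eval_X, eval_C]
  refine ((hlinear.mul hd').sub ((hasDerivAt_id t).mul hd)).congr_deriv ?_
  simp only [id]
  ring

lemma hasDerivAt_eval_martingalePoly_succ (α x t : ℝ) (n : ℕ) :
    HasDerivAt (fun u => (martingalePoly (α * u) u (n + 1)).eval x)
      (-((1 + α * x) * (derivative (semicirclePoly (α * t) t n)).eval x)) t := by
  induction n using Nat.twoStepInduction with
  | zero => simpa [martingalePoly, semicirclePoly] using hasDerivAt_const t x
  | one =>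
    have hzero : HasDerivAt (fun u => (martingalePoly (α * u) u 0).eval x) 0 t := by
      simpa [martingalePoly] using hasDerivAt_const t (1 : ℝ)
    have hone : HasDerivAt (fun u => (martingalePoly (α * u) u 1).eval x) 0 t := by
      simpa [martingalePoly] using hasDerivAt_const t x
    refine (hasDerivAt_eval_martingalePoly_add_two hzero hone).congr_deriv ?_
    simp [semicirclePoly]
  | more n ih0 ih1 =>
    refine (hasDerivAt_eval_martingalePoly_add_two ih0 ih1).congr_deriv ?_
    rw [semicirclePoly_add_two]
    simp only [derivative_sub, derivative_mul, derivative_X, derivative_C, sub_zero, one_mul,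
      zero_mul, zero_add, eval_add, eval_sub, eval_mul, eval_X, eval_C]
    ring

variable {m m' : ℝ[X] →ₗ[ℝ] ℝ}

lemma hasDerivAt_eval_martingalePoly (hm : m 1 = 1) (hm' : m' 1 = 1)
    (hmQ : ∀ n, m (martingalePoly (α * t) t (n + 1)) = 0)
    (hmU : ∀ n, m' (semicirclePoly (α * t) t (n + 1)) = 0) (n : ℕ) (x : ℝ) :
    HasDerivAt (fun u => (martingalePoly (α * u) u n).eval x)
      (-(generatorPoly α m m' (martingalePoly (α * t) t n)).eval x) t := by
  cases n with
  | zero => simpa [martingalePoly, generatorPoly_one] using hasDerivAt_const t (1 : ℝ)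
  | succ n =>
    simpa [generatorPoly_martingalePoly_succ hm hm' hmQ hmU] using
      hasDerivAt_eval_martingalePoly_succ α x t n

lemma hasDerivAt_eval_martingaleSum (hm : m 1 = 1) (hm' : m' 1 = 1)
    (hmQ : ∀ n, m (martingalePoly (α * t) t (n + 1)) = 0)
    (hmU : ∀ n, m' (semicirclePoly (α * t) t (n + 1)) = 0) (c : ℕ →₀ ℝ[X]) (x : ℝ) :
    HasDerivAt (fun u => (martingaleSum α u u c).eval x)
      ((martingaleSum α t t (c.mapRange derivative derivative_zero)).eval x
        - (generatorPoly α m m' (martingaleSum α t t c)).eval x) t := by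
  induction c using Finsupp.induction_linear with
  | zero => simpa [martingaleSum] using hasDerivAt_const t (0 : ℝ)
  | add c d hc hd =>
    have hmap := Finsupp.mapRange_add (hf := derivative_zero)
      (fun p q : ℝ[X] => map_add derivative p q) c d
    simp only [hmap, martingaleSum_add, eval_add, map_add]
    exact (hc.add hd).congr_deriv (by ring)
  | single n q =>
    simp only [martingaleSum_single, Finsupp.mapRange_single, map_smul, eval_smul, smul_eq_mul]
    exact ((q.hasDerivAt t).mul (hasDerivAt_eval_martingalePoly hm hm' hmQ hmU n x)).congr_deriv
      (by ring)

lemma generatorPoly_eq_martingaleSum (hm : m 1 = 1) (hm' : m' 1 = 1)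
    (hmQ : ∀ n, m (martingalePoly (α * t) t (n + 1)) = 0)
    (hmU : ∀ n, m' (semicirclePoly (α * t) t (n + 1)) = 0) {c : ℕ →₀ ℝ[X]} {p : ℝ[X]}
    (hc : ∀ u, martingaleSum α u u c = p) :
    generatorPoly α m m' p = martingaleSum α t t (c.mapRange derivative derivative_zero) := by
  refine Polynomial.funext fun x => ?_
  have hderiv := hasDerivAt_eval_martingaleSum hm hm' hmQ hmU c x
  simp only [hc] at hderiv
  exact (sub_eq_zero.1 (hderiv.unique (hasDerivAt_const t _))).symm

end TimeDerivatives

/-! ### The generator of the process -/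

lemma tendsto_eLpNorm_sum_mul_zero {Ω ι β : Type*} [MeasurableSpace Ω] {μ : Measure Ω}
    {q : ENNReal} (hq : 1 ≤ q) {s : Finset ι} {f : ι → Ω → ℝ} (hf : ∀ i ∈ s, MemLp (f i) q μ)
    {d : ι → β → ℝ} {l : Filter β} (hd : ∀ i ∈ s, Tendsto (d i) l (𝓝 0)) :
    Tendsto (fun b => eLpNorm (fun x => ∑ i ∈ s, d i b * f i x) q μ) l (𝓝 0) := by
  have hbound : Tendsto (fun b => ∑ i ∈ s, ‖d i b‖ₑ * eLpNorm (f i) q μ) l (𝓝 0) := by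
    rw [← Finset.sum_const_zero (s := s)]
    refine tendsto_finsetSum _ fun i hi => ?_
    have hterm := ENNReal.Tendsto.mul_const (hd i hi).enorm (Or.inr (hf i hi).2.ne)
    simpa using hterm
  refine tendsto_of_tendsto_of_tendsto_of_le_of_le tendsto_const_nhds hbound (fun _ => zero_le)
    fun b => ?_
  have hsum : (fun x => ∑ i ∈ s, d i b * f i x) = ∑ i ∈ s, d i b • f i := by
    funext x
    simp
  rw [hsum]
  exact (eLpNorm_sum_le (fun i hi => (hf i hi).1.const_smul _) hq).trans
    (Finset.sum_le_sum fun i _ => eLpNorm_const_smul_le)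

lemma integralFunctional_one {μ : Measure ℝ} [IsProbabilityMeasure μ]
    (hμ : ∀ n : ℕ, Integrable (fun x : ℝ => x ^ n) μ) : integralFunctional hμ 1 = 1 := by
  simp [integralFunctional]

section Generator

variable {A : Type*} [Ring A] [StarRing A] [Algebra ℂ A] {φ ψ : A →ₗ[ℂ] ℂ} {α T t h : ℝ}
  {X : ℝ → A} {K : ℝ → ℝ → Kernel ℝ ℝ} {μ ν : Measure ℝ} {c : ℕ →₀ Polynomial ℝ}
  {p : Polynomial ℝ}

lemma IsTwoStateFBM.integral_martingalePoly_succ (hX : IsTwoStateFBM φ ψ α T X) (hT : 0 < T)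
    (hψ_one : ψ 1 = 1) (hφ_one : φ 1 = 1) (ht : t ∈ Set.Icc 0 T)
    (hμ : IsDistribution φ (X t) μ) (n : ℕ) :
    ∫ x, (martingalePoly (α * t) t (n + 1)).eval x ∂μ = 0 := by
  apply Complex.ofReal_injective
  rw [hμ.integral_eval, hX.phi_aeval hT hψ_one hφ_one ht, transitionOp_martingalePoly]
  cases n <;> simp [martingalePoly]

lemma IsTwoStateFBM.integral_semicirclePoly_succ (hX : IsTwoStateFBM φ ψ α T X) (hT : 0 < T)
    (hψ_one : ψ 1 = 1) (ht : t ∈ Set.Icc 0 T) (hν : IsDistribution ψ (X t) ν) (n : ℕ) :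
    ∫ x, (semicirclePoly (α * t) t (n + 1)).eval x ∂ν = 0 := by
  apply Complex.ofReal_injective
  rw [hν.integral_eval, hX.psi_semicirclePoly_eq_zero hT hψ_one n.succ_pos ht, Complex.ofReal_zero]

lemma IsTwoStateFBM.genOp_eval_eq_martingaleSum (hX : IsTwoStateFBM φ ψ α T X) (hT : 0 < T)
    (hψ_one : ψ 1 = 1) (hφ_one : φ 1 = 1) (ht : t ∈ Set.Icc 0 T)
    (hμ : IsDistribution φ (X t) μ) (hν : IsDistribution ψ (X t) ν)
    (hc : ∀ u, martingaleSum α u u c = p) (x : ℝ) :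
    genOp α μ ν (fun z => p.eval z) x =
      (martingaleSum α t t
        (c.mapRange Polynomial.derivative Polynomial.derivative_zero)).eval x := by
  have := hμ.prob
  have := hν.prob
  rw [genOp_eval α hμ.integrable hν.integrable,
    generatorPoly_eq_martingaleSum (integralFunctional_one _) (integralFunctional_one _)
      (hX.integral_martingalePoly_succ hT hψ_one hφ_one ht hμ)
      (hX.integral_semicirclePoly_succ hT hψ_one ht hν) hc]

lemma IsTwoStateFBM.ae_differenceQuotient_sub_genOp (hX : IsTwoStateFBM φ ψ α T X) (hT : 0 < T)
    (hψ_one : ψ 1 = 1) (hφ_one : φ 1 = 1) (hK : IsClassicalMarkovVersion φ T X K)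
    (ht : t ∈ Set.Ico 0 T) (hh : h ∈ Set.Ioo 0 (T - t)) (hμ : IsDistribution φ (X t) μ)
    (hν : IsDistribution ψ (X t) ν) (hc : ∀ u, martingaleSum α u u c = p) :
    (fun x => h⁻¹ * ((∫ y, p.eval y ∂K t (t + h) x) - p.eval x)
        - genOp α μ ν (fun z => p.eval z) x) =ᵐ[μ]
      fun x => ∑ n ∈ c.support, (h⁻¹ * ((c n).eval (t + h) - (c n).eval t)
        - (Polynomial.derivative (c n)).eval t) * (martingalePoly (α * t) t n).eval x := by
  filter_upwards [hX.ae_integral_eval hT hψ_one hφ_one hK ht.1 (lt_add_of_pos_right t hh.1)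
    (by linarith [hh.2]) hμ p] with x hx
  rw [hx.2, hX.genOp_eval_eq_martingaleSum hT hψ_one hφ_one (Set.Ico_subset_Icc_self ht) hμ hν hc,
    eval_martingaleSum_mapRange_derivative]
  nth_rewrite 1 [← hc (t + h)]
  rw [← hc t, transitionOp_martingaleSum, eval_martingaleSum, eval_martingaleSum,
    ← Finset.sum_sub_distrib, Finset.mul_sum, ← Finset.sum_sub_distrib]
  exact Finset.sum_congr rfl fun n _ => by ring

lemma tendsto_eval_slope_sub_derivative (q : Polynomial ℝ) (t : ℝ) :
    Tendsto (fun h => h⁻¹ * (q.eval (t + h) - q.eval t) - (Polynomial.derivative q).eval t)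
      (𝓝[>] 0) (𝓝 0) := by
  simpa using (q.hasDerivAt t).tendsto_slope_zero_right.sub_const ((Polynomial.derivative q).eval t)

lemma IsTwoStateFBM.isGeneratorAt_genOp (hX : IsTwoStateFBM φ ψ α T X) (hT : 0 < T)
    (hψ_one : ψ 1 = 1) (hφ_one : φ 1 = 1) (hK : IsClassicalMarkovVersion φ T X K)
    (ht : t ∈ Set.Ico 0 T) (hμ : IsDistribution φ (X t) μ) (hν : IsDistribution ψ (X t) ν) :
    IsGeneratorAt K t μ polynomialFunctions (genOp α μ ν) := by
  have := hμ.prob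
  have hμb := hX.hasBoundedSupport_of_isDistribution hT hψ_one hφ_one
    (Set.Ico_subset_Icc_self ht) hμ
  have hsmall : ∀ᶠ h in 𝓝[>] (0 : ℝ), h ∈ Set.Ioo 0 (T - t) := Ioo_mem_nhdsGT (sub_pos.2 ht.2)
  refine ⟨?memLp, fun g hg ε hε => ?dense, ?memLp_image, ?integrable, ?tendsto⟩
  case memLp =>
    rintro _ ⟨p, rfl⟩
    exact hμb.memLp p.continuous
  case dense =>
    obtain ⟨p, hp⟩ := hμb.exists_polynomial_eLpNorm_sub_lt one_le_two ENNReal.ofNat_ne_top hg hε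
    exact ⟨_, ⟨p, rfl⟩, hp⟩
  case memLp_image =>
    rintro _ ⟨p, rfl⟩
    rw [genOp_eval α hμ.integrable hν.integrable]
    exact hμb.memLp (Polynomial.continuous _)
  case integrable =>
    rintro _ ⟨p, rfl⟩
    filter_upwards [hsmall] with h hh
    have hae := hX.ae_integral_eval hT hψ_one hφ_one hK ht.1 (lt_add_of_pos_right t hh.1)
      (by linarith [hh.2]) hμ p
    exact ⟨hae.mono fun y hy => hy.1, (hμb.memLp (transitionOp α t (t + h) p).continuous).ae_eq
      (hae.mono fun y hy => hy.2.symm)⟩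
  case tendsto =>
    rintro _ ⟨p, rfl⟩
    obtain ⟨c, hc⟩ := exists_martingaleSum_eq α p
    have hlim := tendsto_eLpNorm_sum_mul_zero one_le_two
      (fun n (_ : n ∈ c.support) => hμb.memLp (martingalePoly (α * t) t n).continuous)
      fun n _ => tendsto_eval_slope_sub_derivative (c n) t
    refine hlim.congr' (hsmall.mono fun h hh => ?_)
    exact (eLpNorm_congr_ae
      (hX.ae_differenceQuotient_sub_genOp hT hψ_one hφ_one hK ht hh hμ hν hc)).symm

end Generator

end TwoStateFree

theorem mainTheorem10_general {A : Type*} [Ring A] [StarRing A] [Algebra ℂ A]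
    (φ ψ : A →ₗ[ℂ] ℂ) (hφ : φ 1 = 1) (hψ : ψ 1 = 1)
    (α T : ℝ) (hT : 0 < T) (X : ℝ → A) (hX : TwoStateFree.IsTwoStateFBM φ ψ α T X) :
    (∀ t ∈ Set.Icc 0 T, (∃ μ : Measure ℝ, TwoStateFree.IsDistribution φ (X t) μ) ∧
      ∃ ν : Measure ℝ, TwoStateFree.IsDistribution ψ (X t) ν) ∧
    (∃ K : ℝ → ℝ → Kernel ℝ ℝ, TwoStateFree.IsClassicalMarkovVersion φ T X K) ∧
    ∀ K : ℝ → ℝ → Kernel ℝ ℝ, TwoStateFree.IsClassicalMarkovVersion φ T X K →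
      ∀ t ∈ Set.Ico 0 T, ∀ μ ν : Measure ℝ,
        TwoStateFree.IsDistribution φ (X t) μ → TwoStateFree.IsDistribution ψ (X t) ν →
        TwoStateFree.IsGeneratorAt K t μ TwoStateFree.polynomialFunctions
          (TwoStateFree.genOp α μ ν) :=
  ⟨fun _ ht => ⟨⟨_, hX.isDistribution_transitionMeasure hT hψ hφ ht⟩,
      hX.exists_isDistribution_psi hT hψ ht⟩,
    ⟨_, hX.isClassicalMarkovVersion_transitionKernel hT hψ hφ⟩,
    fun _ hK _ ht _ _ hμ hν => hX.isGeneratorAt_genOp hT hψ hφ hK ht hμ hν⟩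

theorem mainTheorem10 {A : Type*} [Ring A] [StarRing A] [Algebra ℂ A] [StarModule ℂ A]
    (φ ψ : A →ₗ[ℂ] ℂ) (hφ : TwoStateFree.IsState φ) (hψ : TwoStateFree.IsState ψ)
    (α T : ℝ) (hT : 0 < T) (X : ℝ → A) (hX : TwoStateFree.IsTwoStateFBM φ ψ α T X) :
    (∀ t ∈ Set.Icc 0 T, (∃ μ : Measure ℝ, TwoStateFree.IsDistribution φ (X t) μ) ∧
      ∃ ν : Measure ℝ, TwoStateFree.IsDistribution ψ (X t) ν) ∧
    (∃ K : ℝ → ℝ → Kernel ℝ ℝ, TwoStateFree.IsClassicalMarkovVersion φ T X K) ∧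
    ∀ K : ℝ → ℝ → Kernel ℝ ℝ, TwoStateFree.IsClassicalMarkovVersion φ T X K →
      ∀ t ∈ Set.Ico 0 T, ∀ μ ν : Measure ℝ,
        TwoStateFree.IsDistribution φ (X t) μ → TwoStateFree.IsDistribution ψ (X t) ν →
        TwoStateFree.IsGeneratorAt K t μ TwoStateFree.polynomialFunctions
          (TwoStateFree.genOp α μ ν) :=
  mainTheorem10_general φ ψ hφ.map_one hψ.map_one α T hT X hX
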